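/- Computation model. Let $k$ be a field. An algorithm over $k$ is a family of algebraic computation trees with constants in $k$: a node performs one operation $+,-,\times,/$ or one test for zero, a leaf returns the output or the word \emph{fail} (a division by zero also counts as \emph{fail}). The cost of a run is the number of arithmetic operations and zero tests executed. A tree is fixed before the extension field $K\supseteq k$ and the input in $K$ are chosen. Let $\omega\ge 2$ and $c$ be real numbers such that for every $m$ there is a tree over $k$ that multiplies any two $m\times m$ matrices over any extension of $k$ with cost at most $c\,m^\omega$. Input. Let $K\supseteq k$ be a field, $n\ge 1$, and let $I\subset K[x_1,\dots,x_n]$ be an ideal with $\dim_K K[x_1,\dots,x_n]/I=D<\infty$ ($D$ is the number of solutions counted with multiplicity). Assume that $I$ is in Shape Position: its reduced LEX Gröbner basis ($x_1>\dots>x_n$) has the form $\{x_1-h_1(x_n),\dots,x_{n-1}-h_{n-1}(x_n),h_n(x_n)\}$ with $\deg h_i<D$ for $i<n$ and $\deg h_n=D$. Let $\mathcal G_{\mathrm{drl}}$ be its reduced degree reverse lexicographic (DRL) Gröbner basis, $\epsilon_1<\dots<\epsilon_D$ the monomials that are divisible by no leading monomial of $\mathcal G_{\mathrm{drl}}$,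 and $T_n$ the $D\times D$ matrix of the multiplication by $x_n$ on $K[x_1,\dots,x_n]/I$ in the basis $(\epsilon_i)$. Let $\mathbf 1$ be the coordinate vector of the polynomial $1$. Let $\mathcal L$ be the set of $i<n$ such that $x_i$ is not its own DRL normal form, and $\mathcal L^c=\{1,\dots,n-1\}\setminus\mathcal L$. Statement. There are a constant $C$, depending only on $\omega$ and $c$, and constants $C'_d$ $(d\in\mathbb N)$, depending only on $\omega$, $c$ and $d$, such that for every $k$ as above there is an algorithm over $k$, depending only on $n$, on $\epsilon_1,\dots,\epsilon_D$ and on the list of the leading monomials of $\mathcal G_{\mathrm{drl}}$, whose inputs are the entries of $T_n$, the coefficients of $\mathcal G_{\mathrm{drl}}$ and a vector $\mathbf r\in K^D$, and whose output is \emph{fail} or the list of the coefficients of $n$ polynomials, with the following properties for all inputs as above. (1) For every $\mathbf r$: if the output is not \emph{fail}, it is $(h_1,\dots,h_n)$, i.e. the LEX Gröbner basis of $I$. The output is \emph{fail} exactly when the minimal polynomial of the linearly recurrent sequence $[(\mathbf r,T_n^j\mathbf 1)]_{0\le j\le 2D-1}$ has degree less than $D$. (2) If the entries of $\mathbf r$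 are independent and uniformly distributed in a finite nonempty set $S\subseteq K$, the probability of \emph{fail} is at most $D/|S|$. (3) For every $\mathbf r$, if $D\ge 2$ and $n\le D$, the cost is at most $C\log_2(D)\,\bigl(D^\omega+n\log_2(D)\,D\bigr)$. For arbitrary $n$ and $D\ge2$ the cost is at most $C\bigl(\log_2(D)\,(D^\omega+n\log_2(D)\,D)+\#\mathcal L\cdot\#\mathcal L^c\cdot D\bigr)$; in particular the first bound holds whenever $\mathcal G_{\mathrm{drl}}$ contains no linear polynomial with leading monomial among $x_1,\dots,x_{n-1}$. (4) For every $\mathbf r$ and every integer $d>1$, if $I$ is generated by polynomials of total degree at most $d$, the cost is at most $C'_d\,n\,d^{\omega n}$. -/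

import Mathlib

universe u

/-! ## The degree reverse lexicographic order -/

/-- Type synonym of the exponent vectors, carrying the degree reverse lexicographic order. -/
def DegRevLex (n : ℕ) : Type := Fin n →₀ ℕ

noncomputable instance (n : ℕ) : AddCommMonoid (DegRevLex n) :=
  inferInstanceAs (AddCommMonoid (Fin n →₀ ℕ))

namespace DegRevLex

/-- The comparison key: first the total degree; for equal degrees the exponents are read from the
last variable to the first one, and at the first place where they differ the monomial with the
larger exponent is the smaller one (hence the order dual `ℕᵒᵈ`). -/
noncomputable def key {n : ℕ} (a : DegRevLex n) : ℕ ×ₗ Lex (Fin n → ℕᵒᵈ) :=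
  toLex (Finsupp.degree (show Fin n →₀ ℕ from a),
    toLex fun i => OrderDual.toDual ((show Fin n →₀ ℕ from a) i.rev))

theorem key_injective {n : ℕ} : Function.Injective (key (n := n)) := by
  intro a b h
  have h2 := congrArg (fun z => (ofLex z).2) h
  refine Finsupp.ext fun i => ?_
  have h3 := congrFun h2 i.rev
  simpa [key] using h3

noncomputable instance (n : ℕ) : LinearOrder (DegRevLex n) :=
  LinearOrder.lift' key key_injective

theorem key_add {n : ℕ} (a b : DegRevLex n) : key (a + b) = key a + key b := by
  have hd : Finsupp.degree (show Fin n →₀ ℕ from a + b)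
      = Finsupp.degree (show Fin n →₀ ℕ from a) + Finsupp.degree (show Fin n →₀ ℕ from b) :=
    map_add Finsupp.degree _ _
  show toLex (_, _) = toLex (_, _)
  exact congrArg toLex (Prod.ext hd rfl)

theorem le_iff_key {n : ℕ} (a b : DegRevLex n) : a ≤ b ↔ key a ≤ key b := Iff.rfl

instance (n : ℕ) : IsOrderedAddMonoid (DegRevLex n) where
  add_le_add_left a b h c := by
    rw [le_iff_key] at h ⊢
    rw [key_add, key_add]
    exact add_le_add_left h _

theorem mono {n : ℕ} {a b : Fin n →₀ ℕ} (h : a ≤ b) :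
    (show DegRevLex n from a) ≤ (show DegRevLex n from b) := by
  rw [le_iff_key]
  obtain ⟨c, rfl⟩ := exists_add_of_le h
  rcases Nat.eq_zero_or_pos (Finsupp.degree c) with hc | hc
  · rw [Finsupp.degree_eq_zero_iff] at hc
    subst hc
    rw [add_zero]
  · refine le_of_lt (Prod.Lex.toLex_lt_toLex.2 (Or.inl ?_))
    show Finsupp.degree a < Finsupp.degree (a + c)
    rw [map_add]
    omega

instance (n : ℕ) : WellFoundedLT (DegRevLex n) := by
  have : WellQuasiOrderedLE (DegRevLex n) :=
    ⟨wellQuasiOrdered_le.of_surjective ⟨fun a : Fin n →₀ ℕ => (show DegRevLex n from a),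
      fun h => mono h⟩ (fun a => ⟨a, rfl⟩)⟩
  infer_instance

end DegRevLex

/-- The degree reverse lexicographic (DRL) order with `X 0 > X 1 > ⋯ > X (n-1)`. -/
noncomputable def drl (n : ℕ) : MonomialOrder (Fin n) where
  syn := DegRevLex n
  toSyn := { toFun := fun a => a, invFun := fun a => a, left_inv := fun _ => rfl,
             right_inv := fun _ => rfl, map_add' := fun _ _ => rfl }
  toSyn_monotone := fun _ _ h => DegRevLex.mono h

/-! ## Reduced Gröbner bases, normal forms, multiplication matrices, Shape Position -/

section Groebner

variable {K : Type u} [Field K] {n : ℕ}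

/-- `G` is the reduced Gröbner basis of the ideal `I` for the monomial order `o`. -/
structure IsReducedGB (o : MonomialOrder (Fin n)) (I : Ideal (MvPolynomial (Fin n) K))
    (G : Set (MvPolynomial (Fin n) K)) : Prop where
  finite : G.Finite
  subset : G ⊆ (I : Set (MvPolynomial (Fin n) K))
  span_leadingTerm : Ideal.span (o.leadingTerm '' (I : Set (MvPolynomial (Fin n) K)))
    = Ideal.span (o.leadingTerm '' G)
  monic : ∀ g ∈ G, o.Monic g
  reduced : ∀ g ∈ G, ∀ g' ∈ G, g' ≠ g → ∀ t ∈ g.support, ¬ o.degree g' ≤ t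

/-- The combinatorial part of a DRL Gröbner basis of a zero-dimensional ideal: the number `D` of
irreducible monomials and these monomials, the number `s` of elements of the Gröbner basis and
their leading monomials. -/
structure GBShape (n : ℕ) where
  D : ℕ
  s : ℕ
  basis : Fin D → (Fin n →₀ ℕ)
  lead : Fin s → (Fin n →₀ ℕ)

/-- `g` lists the reduced DRL Gröbner basis of `I`, and `sh` is its combinatorial part: `sh.lead`
are the leading monomials and `sh.basis` lists, in DRL increasing order, the canonical basis of the
quotient by `I`, i.e. all the monomials that no leading monomial divides. -/
structure IsDRLBasis (I : Ideal (MvPolynomial (Fin n) K)) (sh : GBShape n)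
    (g : Fin sh.s → MvPolynomial (Fin n) K) : Prop where
  isReducedGB : IsReducedGB (drl n) I (Set.range g)
  injective : Function.Injective g
  degree_eq : ∀ j, (drl n).degree (g j) = sh.lead j
  basis_strictMono : StrictMono fun i => (drl n).toSyn (sh.basis i)
  range_basis : Set.range sh.basis = {t | ∀ j, ¬ sh.lead j ≤ t}

/-- `r` is the normal form of `f` modulo `I`: no monomial of `r` is divisible by a leading
monomial, and `f - r ∈ I`. -/
def IsNormalForm (I : Ideal (MvPolynomial (Fin n) K)) (sh : GBShape n)
    (f r : MvPolynomial (Fin n) K) : Prop :=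
  (∀ t ∈ r.support, ∀ j, ¬ sh.lead j ≤ t) ∧ f - r ∈ I

/-- `T` is the matrix of the multiplication by `X v` in the canonical basis: the coordinates of the
normal form of `X v * ε_j` are in the `j`-th column. -/
def IsMultMatrix (I : Ideal (MvPolynomial (Fin n) K)) (sh : GBShape n) (v : Fin n)
    (T : Matrix (Fin sh.D) (Fin sh.D) K) : Prop :=
  ∀ j, IsNormalForm I sh (MvPolynomial.X v * MvPolynomial.monomial (sh.basis j) 1)
    (∑ i, MvPolynomial.monomial (sh.basis i) (T i j))

/-- The variables `x_v` with `v < m` (all but the last one, `x_m`) that are not their own normal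
form; they are the leading monomials of the linear polynomials of the DRL basis. -/
def reducibleVars {m : ℕ} (sh : GBShape (m + 1)) : Set (Fin (m + 1)) :=
  {v | v ≠ Fin.last m ∧ ∃ j, sh.lead j ≤ Finsupp.single v 1}

/-- The variables `x_v` with `v < m` that are their own normal form. -/
def irreducibleVars {m : ℕ} (sh : GBShape (m + 1)) : Set (Fin (m + 1)) :=
  {v | v ≠ Fin.last m ∧ ∀ j, ¬ sh.lead j ≤ Finsupp.single v 1}

/-- The set `{x_0 - h_0(x_m), …, x_{m-1} - h_{m-1}(x_m), h_m(x_m)}`. -/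
noncomputable def shapeBasis {m : ℕ} (h : Fin (m + 1) → Polynomial K) :
    Set (MvPolynomial (Fin (m + 1)) K) :=
  Set.range fun v =>
    if v = Fin.last m then Polynomial.aeval (MvPolynomial.X (Fin.last m)) (h v)
    else MvPolynomial.X v - Polynomial.aeval (MvPolynomial.X (Fin.last m)) (h v)

/-- `I` is in Shape Position (with `D` solutions). -/
def IsShapePosition {m : ℕ} (I : Ideal (MvPolynomial (Fin (m + 1)) K)) (D : ℕ) : Prop :=
  ∃ h : Fin (m + 1) → Polynomial K,
    (∀ v, v ≠ Fin.last m → (h v).degree < D) ∧ (h (Fin.last m)).degree = D ∧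
    IsReducedGB MonomialOrder.lex I (shapeBasis h)

end Groebner

/-! ## The model of computation: algebraic computation trees -/

/-- Arithmetic operations. -/
inductive ArithOp
  | add
  | sub
  | mul
  | div

/-- An operand: a constant of the base field, an input, or the result of the `j`-th arithmetic
operation done before. -/
inductive Operand (k : Type u) (ι : Type) : Type u
  | const (c : k)
  | input (i : ι)
  | reg (j : ℕ)

/-- Algebraic computation trees over `k`, with inputs indexed by `ι` and outputs by `ο`: a node does
one arithmetic operation or one test for zero, a leaf returns the outputs or `fail`. -/
inductive CompTree (k : Type u) (ι ο : Type) : Type u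
  | fail
  | ret (out : ο → Operand k ι)
  | op (o : ArithOp) (a b : Operand k ι) (next : CompTree k ι ο)
  | test (a : Operand k ι) (ifZero ifNonzero : CompTree k ι ο)

section Eval

variable {k : Type u} [Field k] {ι ο : Type} {K : Type u} [Field K] [Algebra k K]

/-- The value of an operand (a register that has not been written holds `0`). -/
def Operand.val (x : ι → K) (regs : List K) : Operand k ι → K
  | .const c => algebraMap k K c
  | .input i => x i
  | .reg j => regs.getD j 0

/-- The value of an arithmetic operation. -/
def ArithOp.val : ArithOp → K → K → K
  | .add, a, b => a + b
  | .sub, a, b => a - b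
  | .mul, a, b => a * b
  | .div, a, b => a / b

open Classical in
/-- Run a tree on the input `x`, the results of the previous operations being `regs`. The second
component is the number of arithmetic operations and zero tests that are executed. A division by
zero aborts the computation, as `fail` does. -/
noncomputable def CompTree.runFrom (x : ι → K) :
    CompTree k ι ο → List K → Option (ο → K) × ℕ
  | .fail, _ => (none, 0)
  | .ret out, regs => (some fun i => (out i).val x regs, 0)
  | .op o a b next, regs =>
      if o = ArithOp.div ∧ b.val x regs = 0 then (none, 1)
      else
        let r := next.runFrom x (regs ++ [o.val (a.val x regs) (b.val x regs)])
        (r.1, r.2 + 1)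
  | .test a t₀ t₁, regs =>
      let r := if a.val x regs = 0 then t₀.runFrom x regs else t₁.runFrom x regs
      (r.1, r.2 + 1)

/-- The output of a tree on the input `x`; `none` means `fail`. -/
noncomputable def CompTree.result (t : CompTree k ι ο) (x : ι → K) : Option (ο → K) :=
  (t.runFrom x []).1

/-- The number of operations done by a tree on the input `x`. -/
noncomputable def CompTree.cost (t : CompTree k ι ο) (x : ι → K) : ℕ :=
  (t.runFrom x []).2

end Eval

/-- Two dense `m × m` matrices can be multiplied over `k` (and its extensions) in at most
`c * m ^ ω` operations. -/
def MatMulIn (k : Type u) [Field k] (ω c : ℝ) : Prop :=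
  ∀ m : ℕ, ∃ t : CompTree k ((Fin m × Fin m) ⊕ (Fin m × Fin m)) (Fin m × Fin m),
    ∀ (K : Type u) [Field K] [Algebra k K] (A B : Matrix (Fin m) (Fin m) K),
      t.result (Sum.elim (fun p => A p.1 p.2) (fun p => B p.1 p.2))
          = some (fun p => (A * B) p.1 p.2) ∧
        (t.cost (Sum.elim (fun p => A p.1 p.2) (fun p => B p.1 p.2)) : ℝ) ≤ c * (m : ℝ) ^ ω

/-! ## The change of ordering problem -/

/-- Indices of the inputs of a probabilistic change of ordering: the entries of the multiplication
matrix, the coefficients of the DRL basis on the irreducible monomials (the leading coefficients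
are `1`), and the entries of the random vector. -/
abbrev ChgInput {n : ℕ} (sh : GBShape n) : Type :=
  (Fin sh.D × Fin sh.D) ⊕ ((Fin sh.s × Fin sh.D) ⊕ Fin sh.D)

section Change

variable {K : Type u} [Field K]

/-- The input made of the matrix `T`, the DRL basis `g` and the random vector `r`. -/
noncomputable def chgInput {n : ℕ} (sh : GBShape n) (T : Matrix (Fin sh.D) (Fin sh.D) K)
    (g : Fin sh.s → MvPolynomial (Fin n) K) (r : Fin sh.D → K) : ChgInput sh → K :=
  Sum.elim (fun p => T p.1 p.2)
    (Sum.elim (fun p => MvPolynomial.coeff (sh.basis p.2) (g p.1)) r)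

/-- The univariate polynomials encoded by an output: `D` coefficients for each of them, the last
polynomial being moreover monic of degree `D`. -/
noncomputable def outPoly {m D : ℕ} (y : Fin (m + 1) × Fin D → K) (v : Fin (m + 1)) :
    Polynomial K :=
  (if v = Fin.last m then Polynomial.X ^ D else 0)
    + ∑ i : Fin D, Polynomial.C (y (v, i)) * Polynomial.X ^ (i : ℕ)

/-- The sequence `(r, T ^ j 𝟏)`, where `𝟏` is the vector of coordinates of the polynomial `1`. -/
noncomputable def wiedemannSeq {n : ℕ} (sh : GBShape n) (T : Matrix (Fin sh.D) (Fin sh.D) K)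
    (r : Fin sh.D → K) (j : ℕ) : K :=
  r ⬝ᵥ (T ^ j).mulVec fun i => if sh.basis i = 0 then 1 else 0

/-- `p` is the characteristic polynomial of a linear recurrence that holds between the first `N`
terms of the sequence `a`. -/
def IsRecurrence (a : ℕ → K) (N : ℕ) (p : Polynomial K) : Prop :=
  p.Monic ∧ ∀ j, j + p.natDegree < N →
    ∑ i ∈ Finset.range (p.natDegree + 1), p.coeff i * a (j + i) = 0

/-- The degree of the minimal polynomial of the sequence `[a 0, …, a (N - 1)]`. -/
noncomputable def minPolyDegree (a : ℕ → K) (N : ℕ) : ℕ :=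
  sInf {e | ∃ p : Polynomial K, IsRecurrence a N p ∧ p.natDegree = e}

open Classical in
/-- The probability of the event `E` for a vector with independent entries, uniformly distributed
in the finite set `S`. -/
noncomputable def uniformProb {D : ℕ} (S : Finset K) (E : (Fin D → K) → Prop) : ℝ :=
  (((Fintype.piFinset fun _ : Fin D => S).filter E).card : ℝ) / (S.card : ℝ) ^ D

end Change

/-! Write T for the matrix of x_n, s_j = (r, T^j 𝟏), R for the matrix with rows (Tᵗ)^i r and B for
the matrix with columns T^j 𝟏, where i, j < D. Then R B is the Hankel matrix H = (s_{i+j}). In Shape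
Position the powers 1, x_n, …, x_n^{D-1} are independent modulo I, so B is invertible. For v < n the
coordinate vector of x_v is B times the coefficient vector of h_v. If H is invertible, then H⁻¹R =
B⁻¹, and this matrix sends the coordinates of x_v to the coefficients of h_v; the coefficients of
h_n form the unique recurrence of order D of the sequence. The coordinates of x_v cost nothing: x_v
is either a basis monomial, which gives a unit vector, or the leading monomial of an element of the
reduced DRL basis, whose other coefficients are the coordinates up to sign.

Cost. The rows of R, and with them all s_j, come from O(log D) matrix products by repeated squaring
(`Runs.krylov`). Berlekamp–Massey is run on the first 2D-1 terms in O(D²) operations. If its length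
is not D, its state exhibits a kernel vector of H (`BMInv.hankelSingular`). If it is D, the state
gives the recurrence and the last column of H⁻¹, and a shift recurrence yields the other columns in
O(D²) operations (`sum_hankelCol`). One product gives H⁻¹R. Reducing the variables that are leading
monomials takes one more product when n ≤ D; otherwise the sparsity of linear polynomials is used.

Failure. The sequence satisfies a recurrence of order D, so H is singular exactly when a shorter one
exists (`minPolyDegree_lt_iff`). The determinant of H is a polynomial of degree at most D in r. It
is nonzero, since r can be chosen to give s_0, …, s_{D-1} = 0, …, 0, 1; Schwartz–Zippel then bounds
the probability.

Degree bound. The cost in terms of d needs D ≤ d^n, for any number of generators (`IsShape.le_pow`).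
Compare two estimates of the dimension of K[x]/I^M: it is at most the number of monomials of degree
≤ dM + D, and at least D times a binomial coefficient growing like M^n/n!. Let M tend to infinity.

Trees are written as programs in continuation-passing style, and `Runs` is a Hoare-style triple
recording value and cost together. -/

/-! ## Programs: computation trees in continuation-passing style -/

section Programs

variable {k : Type u} {ι ο : Type}

/-- A program that computes a value of type `α`: given the number of registers in use and the
tree that follows (as a function of the new number of registers and of the value), it builds
a computation tree. -/
def Prog (k : Type u) (ι ο : Type) (α : Type u) : Type u :=
  ℕ → (ℕ → α → CompTree k ι ο) → CompTree k ι ο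

namespace Prog

variable {α β : Type u}

/-- The program without operations. -/
def pure (a : α) : Prog k ι ο α := fun N κ => κ N a

/-- Sequential composition. -/
def bind (p : Prog k ι ο α) (f : α → Prog k ι ο β) : Prog k ι ο β :=
  fun N κ => p N fun N' a => f a N' κ

/-- One arithmetic operation. -/
def op (o : ArithOp) (a b : Operand k ι) : Prog k ι ο (Operand k ι) :=
  fun N κ => .op o a b (κ (N + 1) (.reg N))

/-- One test for zero. -/
def ifZero (a : Operand k ι) (p q : Prog k ι ο α) : Prog k ι ο α :=
  fun N κ => .test a (p N κ) (q N κ)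

/-- Run a family of programs one after the other. -/
def vec : (n : ℕ) → (Fin n → Prog k ι ο α) → Prog k ι ο (Fin n → α)
  | 0, _ => pure Fin.elim0
  | n + 1, p => bind (p 0) fun a => bind (vec n fun i => p i.succ) fun v => pure (Fin.cons a v)

/-- Iterate a program. -/
def iter (f : ℕ → α → Prog k ι ο α) (a : α) : ℕ → Prog k ι ο α
  | 0 => pure a
  | n + 1 => bind (iter f a n) (f n)

/-- The sum of the products of pairs of operands. -/
def dot : List (Operand k ι × Operand k ι) → Operand k ι → Prog k ι ο (Operand k ι)
  | [], z => pure z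
  | p :: l, z => bind (op .mul p.1 p.2) fun w => bind (op .add z w) fun z' => dot l z'

end Prog

/-- Renaming of the operands of a tree that is called from a program having `N` registers,
`n` operations of the called tree being done. -/
def Operand.subst {ι' : Type} [Zero k] (σ : ι' → Operand k ι) (N n : ℕ) :
    Operand k ι' → Operand k ι
  | .const c => .const c
  | .input i => σ i
  -- An unwritten register of the called tree reads 0, but the caller may use the register of the
  -- shifted number; hence the constant.
  | .reg j => if j < n then .reg (N + j) else .const 0

/-- Call of a tree, after `n` of its operations. -/
def CompTree.callFrom {ι' ο' : Type} [Zero k] (σ : ι' → Operand k ι) (N : ℕ)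
    (κ : ℕ → (ο' → Operand k ι) → CompTree k ι ο) : CompTree k ι' ο' → ℕ → CompTree k ι ο
  | .fail, _ => .fail
  | .ret out, n => κ (N + n) fun o => (out o).subst σ N n
  | .op o a b next, n =>
      .op o (a.subst σ N n) (b.subst σ N n) (callFrom σ N κ next (n + 1))
  | .test a t₀ t₁, n => .test (a.subst σ N n) (callFrom σ N κ t₀ n) (callFrom σ N κ t₁ n)

/-- Call of a tree as a subprogram. -/
def Prog.call {ι' ο' : Type} [Zero k] (t : CompTree k ι' ο') (σ : ι' → Operand k ι) :
    Prog k ι ο (ο' → Operand k ι) :=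
  fun N κ => t.callFrom σ N κ 0

end Programs

/-! ### Semantics of programs: Hoare-style rules for value and cost. -/

section Semantics

variable {k : Type u} [Field k] {ι ο : Type} {K : Type u} [Field K] [Algebra k K]

/-- The operand `o` holds the value `v`, now and after any further operations. -/
def Den (x : ι → K) (regs : List K) (o : Operand k ι) (v : K) : Prop :=
  ∀ regs', regs <+: regs' → o.val x regs' = v

theorem Den.mono {x : ι → K} {regs regs' : List K} {o : Operand k ι} {v : K}
    (h : Den x regs o v) (hr : regs <+: regs') : Den x regs' o v :=
  fun r hr' => h r (hr.trans hr')

theorem Den.val_eq {x : ι → K} {regs : List K} {o : Operand k ι} {v : K}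
    (h : Den x regs o v) : o.val x regs = v := h _ (List.prefix_refl _)

theorem den_const (x : ι → K) (regs : List K) (c : k) :
    Den x regs (.const c) (algebraMap k K c) := fun _ _ => rfl

theorem den_zero (x : ι → K) (regs : List K) : Den x regs (.const (0 : k)) 0 :=
  fun _ _ => map_zero _

theorem den_one (x : ι → K) (regs : List K) : Den x regs (.const (1 : k)) 1 :=
  fun _ _ => map_one _

theorem den_input (x : ι → K) (regs : List K) (i : ι) :
    Den x regs (.input i : Operand k ι) (x i) := fun _ _ => rfl

theorem den_reg (x : ι → K) (regs : List K) (v : K) :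
    Den x (regs ++ [v]) (.reg regs.length : Operand k ι) v := by
  rintro _ ⟨t, rfl⟩
  simp [Operand.val]

theorem CompTree.runFrom_op {x : ι → K} {regs : List K} {o : ArithOp} {a b : Operand k ι}
    {next : CompTree k ι ο} {va vb : K} (ha : a.val x regs = va) (hb : b.val x regs = vb)
    (h : ¬ (o = ArithOp.div ∧ vb = 0)) :
    (CompTree.op o a b next).runFrom x regs =
      ((next.runFrom x (regs ++ [o.val va vb])).1,
        (next.runFrom x (regs ++ [o.val va vb])).2 + 1) := by
  subst ha hb
  rw [CompTree.runFrom, if_neg h]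

theorem CompTree.runFrom_test_zero {x : ι → K} {regs : List K} {a : Operand k ι}
    {t₀ t₁ : CompTree k ι ο} (h : a.val x regs = 0) :
    (CompTree.test a t₀ t₁).runFrom x regs =
      ((t₀.runFrom x regs).1, (t₀.runFrom x regs).2 + 1) := by
  simp only [CompTree.runFrom, if_pos h]

theorem CompTree.runFrom_test_ne {x : ι → K} {regs : List K} {a : Operand k ι}
    {t₀ t₁ : CompTree k ι ο} (h : a.val x regs ≠ 0) :
    (CompTree.test a t₀ t₁).runFrom x regs =
      ((t₁.runFrom x regs).1, (t₁.runFrom x regs).2 + 1) := by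
  simp only [CompTree.runFrom, if_neg h]

/-- On the input `x` and with the registers `regs`, the program `p` does at most `C` operations
and computes a value with the property `Q`. -/
def Runs {α : Type u} (x : ι → K) (regs : List K) (p : Prog k ι ο α) (C : ℕ)
    (Q : List K → α → Prop) : Prop :=
  ∃ regs' a c, regs <+: regs' ∧ c ≤ C ∧ Q regs' a ∧
    -- The registers, the value and the cost are chosen before the continuation. This makes
    -- specifications compose, and it also says that `p` itself never fails.
    ∀ κ, (p regs.length κ).runFrom x regs =
      (((κ regs'.length a).runFrom x regs').1, ((κ regs'.length a).runFrom x regs').2 + c)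

namespace Runs

variable {α β : Type u} {x : ι → K} {regs : List K}

theorem mono {p : Prog k ι ο α} {C C' : ℕ} {Q Q' : List K → α → Prop}
    (h : Runs x regs p C Q) (hC : C ≤ C')
    (hQ : ∀ regs' a, regs <+: regs' → Q regs' a → Q' regs' a) : Runs x regs p C' Q' := by
  obtain ⟨r, a, c, h1, h2, h3, h4⟩ := h
  exact ⟨r, a, c, h1, h2.trans hC, hQ _ _ h1 h3, h4⟩

theorem pure {a : α} {Q : List K → α → Prop} (h : Q regs a) :
    Runs x regs (Prog.pure a : Prog k ι ο α) 0 Q :=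
  ⟨regs, a, 0, List.prefix_refl _, le_rfl, h, fun _ => rfl⟩

theorem bind {p : Prog k ι ο α} {f : α → Prog k ι ο β} {C₁ C₂ : ℕ}
    {Q₁ : List K → α → Prop} {Q : List K → β → Prop} (hp : Runs x regs p C₁ Q₁)
    (hf : ∀ regs' a, regs <+: regs' → Q₁ regs' a → Runs x regs' (f a) C₂ Q) :
    Runs x regs (p.bind f) (C₁ + C₂) Q := by
  obtain ⟨r, a, c, h1, h2, h3, h4⟩ := hp
  obtain ⟨r', b, c', h1', h2', h3', h4'⟩ := hf r a h1 h3
  refine ⟨r', b, c' + c, h1.trans h1', by omega, h3', fun κ => ?_⟩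
  simp only [Prog.bind]
  rw [h4, h4', add_assoc]

theorem op {o : ArithOp} {a b : Operand k ι} {va vb : K} (ha : Den x regs a va)
    (hb : Den x regs b vb) (hdiv : o = ArithOp.div → vb ≠ 0) :
    Runs x regs (Prog.op o a b : Prog k ι ο _) 1 fun r z => Den x r z (o.val va vb) := by
  refine ⟨regs ++ [o.val va vb], .reg regs.length, 1, List.prefix_append _ _, le_rfl,
    den_reg _ _ _, fun κ => ?_⟩
  rw [Prog.op, CompTree.runFrom_op ha.val_eq hb.val_eq fun h => hdiv h.1 h.2]
  simp

theorem ifZero {a : Operand k ι} {va : K} (ha : Den x regs a va) {p q : Prog k ι ο α} {C : ℕ}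
    {Q : List K → α → Prop} (hp : va = 0 → Runs x regs p C Q)
    (hq : va ≠ 0 → Runs x regs q C Q) : Runs x regs (Prog.ifZero a p q) (C + 1) Q := by
  by_cases h : va = 0
  · obtain ⟨r, b, c, h1, h2, h3, h4⟩ := hp h
    refine ⟨r, b, c + 1, h1, by omega, h3, fun κ => ?_⟩
    rw [Prog.ifZero, CompTree.runFrom_test_zero (ha.val_eq.trans h), h4, add_assoc]
  · obtain ⟨r, b, c, h1, h2, h3, h4⟩ := hq h
    refine ⟨r, b, c + 1, h1, by omega, h3, fun κ => ?_⟩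
    rw [Prog.ifZero, CompTree.runFrom_test_ne (ha.val_eq.trans_ne h), h4, add_assoc]

/-- Each property must survive the registers written by the later programs. The cost may depend on
the index, so that some entries can be free. -/
theorem vec {n : ℕ} : ∀ {regs : List K} {p : Fin n → Prog k ι ο α} {C : Fin n → ℕ}
    {Q : Fin n → List K → α → Prop}
    (_ : ∀ i r r' a, r <+: r' → Q i r a → Q i r' a)
    (_ : ∀ i r, regs <+: r → Runs x r (p i) (C i) (Q i)),
    Runs x regs (Prog.vec n p) (∑ i, C i) fun r v => ∀ i, Q i r (v i) := by
  induction n with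
  | zero =>
    intro regs p C Q _ _
    exact Runs.pure fun i => i.elim0
  | succ n ih =>
    intro regs p C Q hst hp
    rw [Fin.sum_univ_succ]
    refine (hp 0 regs (List.prefix_refl _)).bind fun r a hr ha => ?_
    rw [← add_zero (∑ i : Fin n, _)]
    refine (ih (Q := fun i => Q i.succ) (fun i => hst i.succ)
      fun i r' hr' => hp i.succ r' (hr.trans hr')).bind fun r' v hr' hv => ?_
    refine Runs.pure fun i => ?_
    refine Fin.cases ?_ (fun i => ?_) i
    · exact hst _ _ _ _ hr' ha
    · exact hv i

theorem iter {f : ℕ → α → Prog k ι ο α} {a : α} {C : ℕ} {n : ℕ}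
    {Q : ℕ → List K → α → Prop} (h0 : Q 0 regs a)
    (hf : ∀ i r a, i < n → regs <+: r → Q i r a → Runs x r (f i a) C (Q (i + 1))) :
    Runs x regs (Prog.iter f a n) (n * C) (Q n) := by
  induction n with
  | zero => rw [zero_mul]; exact Runs.pure h0
  | succ n ih =>
    rw [add_mul, one_mul]
    exact (ih fun i r a hi => hf i r a (by omega)).bind
      fun r a hr ha => hf n r a (by omega) hr ha

theorem dot {κ : Type*} {l : List κ} {A B : κ → Operand k ι} {a b : κ → K} :
    ∀ {regs : List K} {z : Operand k ι} {vz : K}, (∀ i, Den x regs (A i) (a i)) →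
      (∀ i, Den x regs (B i) (b i)) → Den x regs z vz →
    Runs x regs (Prog.dot (l.map fun i => (A i, B i)) z : Prog k ι ο _) (2 * l.length)
      fun r o => Den x r o (vz + (l.map fun i => a i * b i).sum) := by
  induction l with
  | nil => intro regs z vz _ _ hz; exact Runs.pure (by simpa using hz)
  | cons j l ih =>
    intro regs z vz hA hB hz
    refine Runs.mono (C := 1 + (1 + 2 * l.length)) ?_ (by simp; omega) fun _ _ _ h => h
    refine (Runs.op (hA j) (hB j) (by simp)).bind fun r o hr ho => ?_
    refine (Runs.op (hz.mono hr) ho (by simp)).bind fun r' o' hr' ho' => ?_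
    refine (ih (fun i => (hA i).mono (hr.trans hr')) (fun i => (hB i).mono (hr.trans hr'))
      ho').mono le_rfl fun r'' o'' _ h => ?_
    simpa [ArithOp.val, add_assoc] using h

end Runs

theorem Operand.den_subst {ι' : Type} {x : ι → K} {x' : ι' → K} {σ : ι' → Operand k ι}
    {regs : List K} (hσ : ∀ i, Den x regs (σ i) (x' i)) (loc : List K) (a : Operand k ι') :
    Den x (regs ++ loc) (a.subst σ regs.length loc.length) (a.val x' loc) := by
  cases a with
  | const c => exact den_const _ _ _
  | input i => exact (hσ i).mono (List.prefix_append _ _)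
  | reg j =>
    simp only [Operand.subst, Operand.val]
    split_ifs with h
    · rintro _ ⟨t, rfl⟩
      simp [Operand.val, List.getD_eq_getElem?_getD, List.getElem?_append, h]
    · rw [List.getD_eq_default _ _ (by omega)]
      exact den_zero _ _

/-- Induction on the called tree: its local registers `loc` sit right after those of the caller, so
both runs take the same branches and pay the same cost. A successful result excludes `fail` leaves
and divisions by zero. -/
theorem CompTree.runFrom_callFrom {ι' ο' : Type} {x : ι → K} {x' : ι' → K}
    {σ : ι' → Operand k ι} {regs : List K} (hσ : ∀ i, Den x regs (σ i) (x' i))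
    (t : CompTree k ι' ο') : ∀ (loc : List K) (y : ο' → K), (t.runFrom x' loc).1 = some y →
    ∃ loc' out, (∀ o, Den x (regs ++ loc') (out o) (y o)) ∧ loc <+: loc' ∧
      ∀ κ : ℕ → (ο' → Operand k ι) → CompTree k ι ο,
        (t.callFrom σ regs.length κ loc.length).runFrom x (regs ++ loc) =
          (((κ (regs ++ loc').length out).runFrom x (regs ++ loc')).1,
            ((κ (regs ++ loc').length out).runFrom x (regs ++ loc')).2 + (t.runFrom x' loc).2) := by
  induction t with
  | fail => intro loc y h; simp [CompTree.runFrom] at h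
  | ret out =>
    intro loc y h
    simp only [CompTree.runFrom, Option.some.injEq] at h
    subst h
    refine ⟨loc, fun o => (out o).subst σ regs.length loc.length,
      fun o => Operand.den_subst hσ loc (out o), List.prefix_refl _, fun κ => ?_⟩
    simp [CompTree.callFrom, CompTree.runFrom]
  | op o a b next ih =>
    intro loc y h
    have ha := (Operand.den_subst hσ loc a).val_eq
    have hb := (Operand.den_subst hσ loc b).val_eq
    by_cases hd : o = ArithOp.div ∧ b.val x' loc = 0
    · simp [CompTree.runFrom, hd] at h
    · rw [CompTree.runFrom_op rfl rfl hd] at h ⊢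
      obtain ⟨loc', out, h1, h2, h3⟩ := ih _ y h
      refine ⟨loc', out, h1, (List.prefix_append _ _).trans h2, fun κ => ?_⟩
      have h4 := h3 κ
      simp only [List.length_append, List.length_singleton] at h4 ⊢
      rw [CompTree.callFrom, CompTree.runFrom_op ha hb hd, List.append_assoc, h4]
      simp [add_assoc]
  | test a t₀ t₁ ih₀ ih₁ =>
    intro loc y h
    have ha := (Operand.den_subst hσ loc a).val_eq
    by_cases hd : a.val x' loc = 0
    · rw [CompTree.runFrom_test_zero hd] at h ⊢
      obtain ⟨loc', out, h1, h2, h3⟩ := ih₀ _ y h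
      refine ⟨loc', out, h1, h2, fun κ => ?_⟩
      rw [CompTree.callFrom, CompTree.runFrom_test_zero (ha.trans hd), h3]
      simp [add_assoc]
    · rw [CompTree.runFrom_test_ne hd] at h ⊢
      obtain ⟨loc', out, h1, h2, h3⟩ := ih₁ _ y h
      refine ⟨loc', out, h1, h2, fun κ => ?_⟩
      rw [CompTree.callFrom, CompTree.runFrom_test_ne (ha.trans_ne hd), h3]
      simp [add_assoc]

theorem Runs.call {ι' ο' : Type} {x : ι → K} {x' : ι' → K} {σ : ι' → Operand k ι}
    {regs : List K} {t : CompTree k ι' ο'} {y : ο' → K} {C : ℕ}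
    (hσ : ∀ i, Den x regs (σ i) (x' i)) (hy : t.result x' = some y) (hC : t.cost x' ≤ C) :
    Runs x regs (Prog.call t σ : Prog k ι ο _) C fun r out => ∀ o, Den x r (out o) (y o) := by
  obtain ⟨loc', out, h1, _, h3⟩ := CompTree.runFrom_callFrom (ο := ο) hσ t [] y hy
  refine ⟨regs ++ loc', out, _, List.prefix_append _ _, hC, h1, fun κ => ?_⟩
  have h4 := h3 κ
  rw [List.append_nil] at h4
  exact h4

end Semantics

/-! ## Products of matrices and Krylov sequences -/

/-- Extend a rectangular array to a square one, with the value `z`. -/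
def padArray {γ : Type u} {p q : ℕ} (N : ℕ) (z : γ) (A : Fin p → Fin q → γ) (i j : Fin N) : γ :=
  if h : (i : ℕ) < p ∧ (j : ℕ) < q then A ⟨i, h.1⟩ ⟨j, h.2⟩ else z

/-- The tree `t` multiplies `N × N` matrices over `K` in at most `μ` operations. -/
def IsMulTree {k : Type u} [Field k] {N : ℕ}
    (t : CompTree k ((Fin N × Fin N) ⊕ (Fin N × Fin N)) (Fin N × Fin N))
    (K : Type u) [Field K] [Algebra k K] (μ : ℕ) : Prop :=
  ∀ A B : Matrix (Fin N) (Fin N) K,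
    t.result (Sum.elim (fun p => A p.1 p.2) (fun p => B p.1 p.2))
        = some (fun p => (A * B) p.1 p.2) ∧
      t.cost (Sum.elim (fun p => A p.1 p.2) (fun p => B p.1 p.2)) ≤ μ

section

variable {k : Type u} [Field k] {ι ο : Type} {N : ℕ}
  (t : CompTree k ((Fin N × Fin N) ⊕ (Fin N × Fin N)) (Fin N × Fin N))

/-- The product of rectangular matrices of dimensions at most `N`. -/
def Prog.mul {p q r : ℕ} (A : Fin p → Fin q → Operand k ι) (B : Fin q → Fin r → Operand k ι) :
    Prog k ι ο (Fin p → Fin r → Operand k ι) :=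
  .bind (.call t (Sum.elim (fun e => padArray N (.const 0) A e.1 e.2)
      (fun e => padArray N (.const 0) B e.1 e.2))) fun out =>
    .pure fun i j => if h : (i : ℕ) < N ∧ (j : ℕ) < N then out (⟨i, h.1⟩, ⟨j, h.2⟩) else .const 0

/-- One doubling step of the computation of a Krylov sequence. -/
def Prog.krylovStep {D M : ℕ} (s : ℕ)
    (S : (Fin D → Fin D → Operand k ι) × (Fin D → Fin M → Operand k ι)) :
    Prog k ι ο ((Fin D → Fin D → Operand k ι) × (Fin D → Fin M → Operand k ι)) :=
  .bind (.mul t S.1 S.2) fun W => .bind (.mul t S.1 S.1) fun A' =>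
    -- Column j with 2^s ≤ j < 2^(s+1) is A^(2^s) times column j - 2^s. Later columns hold
    -- unspecified values that further steps overwrite.
    .pure (A', fun i j => if (j : ℕ) < 2 ^ s then S.2 i j
      else W i ⟨j - 2 ^ s, lt_of_le_of_lt (Nat.sub_le _ _) j.2⟩)

/-- The first `M` vectors (the columns of the result) of the Krylov sequence of the matrix `A`
and the vector `v`, if `M ≤ 2 ^ ℓ`. -/
def Prog.krylov {D : ℕ} (M ℓ : ℕ) (A : Fin D → Fin D → Operand k ι) (v : Fin D → Operand k ι) :
    Prog k ι ο (Fin D → Fin M → Operand k ι) :=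
  .bind (.iter (.krylovStep t) (A, fun i _ => v i) ℓ) fun S => .pure S.2

variable {K : Type u} [Field K] [Algebra k K] {t} {μ : ℕ} {x : ι → K} {regs : List K}

theorem den_padArray {p q : ℕ} {A : Fin p → Fin q → Operand k ι} {a : Fin p → Fin q → K}
    (h : ∀ i j, Den x regs (A i j) (a i j)) (i j : Fin N) :
    Den x regs (padArray N (.const 0) A i j) (padArray N 0 a i j) := by
  unfold padArray
  split_ifs
  · exact h _ _
  · exact den_zero _ _

/-- The padding is by zeros, so the extra terms of the inner sum vanish. -/
theorem padArray_mul {p q r : ℕ} (hq : q ≤ N) (A : Matrix (Fin p) (Fin q) K)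
    (B : Matrix (Fin q) (Fin r) K) (i : Fin p) (j : Fin r) (hi : (i : ℕ) < N)
    (hj : (j : ℕ) < N) :
    (Matrix.of (padArray N 0 A) * Matrix.of (padArray N 0 B)) ⟨i, hi⟩ ⟨j, hj⟩ = (A * B) i j := by
  obtain ⟨e, rfl⟩ := Nat.exists_eq_add_of_le hq
  simp [Matrix.mul_apply, Fin.sum_univ_add, padArray]

theorem Runs.mul {p q r : ℕ} (ht : IsMulTree t K μ) (hp : p ≤ N) (hq : q ≤ N) (hr : r ≤ N)
    {A : Fin p → Fin q → Operand k ι} {B : Fin q → Fin r → Operand k ι}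
    {a : Matrix (Fin p) (Fin q) K} {b : Matrix (Fin q) (Fin r) K}
    (hA : ∀ i j, Den x regs (A i j) (a i j)) (hB : ∀ i j, Den x regs (B i j) (b i j)) :
    Runs x regs (Prog.mul t A B : Prog k ι ο _) μ
      fun rg O => ∀ i j, Den x rg (O i j) ((a * b) i j) := by
  obtain ⟨h1, h2⟩ := ht (Matrix.of (padArray N 0 a)) (Matrix.of (padArray N 0 b))
  refine Runs.bind (C₂ := 0) (Runs.call ?_ h1 h2) fun rg out _ hout => Runs.pure fun i j => ?_
  · rintro (e | e)
    · exact den_padArray hA _ _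
    · exact den_padArray hB _ _
  · have hi : (i : ℕ) < N := by omega
    have hj : (j : ℕ) < N := by omega
    rw [dif_pos ⟨hi, hj⟩, ← padArray_mul hq a b i j hi hj]
    exact hout _

/-- Keller-Gehrig doubling: each step squares the matrix and doubles the number of correct columns,
with two matrix products. -/
theorem Runs.krylov {D M ℓ : ℕ} (ht : IsMulTree t K μ) (hD : D ≤ N) (hM : M ≤ N)
    (hℓ : M ≤ 2 ^ ℓ) {A : Fin D → Fin D → Operand k ι} {v : Fin D → Operand k ι}
    {a : Matrix (Fin D) (Fin D) K} {w : Fin D → K}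
    (hA : ∀ i j, Den x regs (A i j) (a i j)) (hv : ∀ i, Den x regs (v i) (w i)) :
    Runs x regs (Prog.krylov t M ℓ A v : Prog k ι ο _) (ℓ * (2 * μ))
      fun rg V => ∀ i (j : Fin M), Den x rg (V i j) ((a ^ (j : ℕ)).mulVec w i) := by
  refine Runs.bind (C₂ := 0) (Runs.iter (Q := fun s rg S =>
    -- `X` is whatever the columns contain; the invariant constrains only the first 2^s of them.
    (∀ i j, Den x rg (S.1 i j) ((a ^ 2 ^ s) i j)) ∧ ∃ X : Matrix (Fin D) (Fin M) K,
      (∀ i j, Den x rg (S.2 i j) (X i j)) ∧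
        ∀ i (j : Fin M), (j : ℕ) < 2 ^ s → X i j = (a ^ (j : ℕ)).mulVec w i) ?_ ?_) ?_
  · refine ⟨by simpa using hA, fun i _ => w i, fun i _ => hv i, fun i j hj => ?_⟩
    rw [pow_zero, Nat.lt_one_iff] at hj
    simp [hj]
  · rintro s rg ⟨A, V⟩ - - ⟨hA, X, hV, hX⟩
    refine (Runs.bind (C₂ := μ + 0) (Runs.mul ht hD hD hM hA hV) fun rg' W hrg hW => ?_).mono
      (by omega) fun _ _ _ h => h
    refine Runs.bind (Runs.mul ht hD hD hD (fun i j => (hA i j).mono hrg)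
      fun i j => (hA i j).mono hrg) fun rg'' A' hrg' hA' => Runs.pure ?_
    refine ⟨fun i j => ?_, fun i j => if (j : ℕ) < 2 ^ s then X i j
      else (a ^ 2 ^ s * X : Matrix (Fin D) (Fin M) K) i ⟨j - 2 ^ s, lt_of_le_of_lt (Nat.sub_le _ _) j.2⟩,
      fun i j => ?_, fun i j hj => ?_⟩
    · have := hA' i j
      rwa [← pow_add, ← two_mul, ← pow_succ'] at this
    · dsimp only
      split_ifs
      · exact (hV i j).mono (hrg.trans hrg')
      · exact (hW i _).mono hrg'
    · beta_reduce
      split_ifs with h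
      · exact hX i j h
      · have h1 : (j : ℕ) - 2 ^ s < 2 ^ s := by rw [pow_succ] at hj; omega
        have h2 : (a ^ (j : ℕ)) = a ^ 2 ^ s * a ^ ((j : ℕ) - 2 ^ s) := by
          rw [← pow_add]; congr 1; omega
        rw [h2, ← Matrix.mulVec_mulVec, Matrix.mul_apply, Matrix.mulVec, dotProduct]
        exact Finset.sum_congr rfl fun l _ => by rw [hX _ _ h1]
  · rintro rg ⟨A, V⟩ - ⟨-, X, hV, hX⟩
    refine Runs.pure fun i j => ?_
    rw [← hX i j (j.2.trans_le hℓ)]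
    exact hV i j

end

/-! ## The Berlekamp–Massey algorithm and the inverse of a Hankel matrix -/

section BerlekampMassey

variable {K : Type u} [Field K]

/-- Coefficient of degree `n` of the product of the series with coefficients `c` and `s`. -/
def conv (c s : ℕ → K) (n : ℕ) : K := ∑ i ∈ Finset.range (n + 1), c i * s (n - i)

/-- Multiplication by the variable of a list of coefficients. -/
def shiftSeq {γ : Type u} (z : γ) (c : ℕ → γ) : ℕ → γ
  | 0 => z
  | i + 1 => c i

theorem conv_sub_smul (c q s : ℕ → K) (d : K) (n : ℕ) :
    conv (fun i => c i - d * q i) s n = conv c s n - d * conv q s n := by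
  simp only [conv, Finset.mul_sum, ← Finset.sum_sub_distrib]
  exact Finset.sum_congr rfl fun _ _ => by ring

theorem conv_div (c s : ℕ → K) (d : K) (n : ℕ) :
    conv (fun i => c i / d) s n = conv c s n / d := by
  simp only [conv, Finset.sum_div]
  exact Finset.sum_congr rfl fun _ _ => by ring

theorem conv_shiftSeq_succ (c s : ℕ → K) (n : ℕ) :
    conv (shiftSeq 0 c) s (n + 1) = conv c s n := by
  rw [conv, Finset.sum_range_succ']
  simp [shiftSeq, conv]

/-- The state of the Berlekamp–Massey algorithm after `n` terms of the sequence `s`: `c` is a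
connection polynomial of length `L` and `q` an auxiliary polynomial. -/
structure BMInv (s : ℕ → K) (n L : ℕ) (c q : ℕ → K) : Prop where
  c_zero : c 0 = 1
  c_deg : ∀ i, L < i → c i = 0
  c_conv : ∀ j, L ≤ j → j < n → conv c s j = 0
  le : L ≤ n
  -- Once the length has changed, `q` is the connection polynomial from before the last change,
  -- divided by its discrepancy and multiplied by a power of the variable, so that its discrepancy
  -- at `n` is 1. Its degree is at most n + 1 - L, and its discrepancies vanish from that index up
  -- to `n`.
  aux : (L = 0 ∧ ∀ i, q i = 0) ∨ (0 < L ∧ q 0 = 0 ∧ (∀ i, n + 1 < i + L → q i = 0) ∧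
    (∀ j, n + 1 ≤ j + L → j < n → conv q s j = 0) ∧ conv q s n = 1)

theorem BMInv.init (s : ℕ → K) : BMInv s 0 0 (fun i => if i = 0 then 1 else 0) fun _ => 0 where
  c_zero := by simp
  c_deg i hi := by rw [if_neg (by omega)]
  c_conv j _ hj := by omega
  le := le_rfl
  aux := Or.inl ⟨rfl, fun _ => rfl⟩

variable {s c q : ℕ → K} {n L : ℕ}

/-- When the length is unchanged, multiplying `q` by the variable moves its unit discrepancy from
`n` to `n + 1`. -/
theorem BMInv.aux_shift (H : BMInv s n L c q) :
    (L = 0 ∧ ∀ i, shiftSeq 0 q i = 0) ∨ (0 < L ∧ shiftSeq 0 q 0 = 0 ∧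
      (∀ i, n + 1 + 1 < i + L → shiftSeq 0 q i = 0) ∧
      (∀ j, n + 1 + 1 ≤ j + L → j < n + 1 → conv (shiftSeq 0 q) s j = 0) ∧
      conv (shiftSeq 0 q) s (n + 1) = 1) := by
  rcases H.aux with ⟨h1, h2⟩ | ⟨h1, h2, h3, h4, h5⟩
  · exact Or.inl ⟨h1, fun i => by cases i <;> simp [shiftSeq, h2]⟩
  · refine Or.inr ⟨h1, rfl, fun i hi => ?_, fun j hj hj' => ?_, ?_⟩
    · cases i with
      | zero => rfl
      | succ i => exact h3 i (by omega)
    · cases j with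
      | zero => simp [conv, shiftSeq]
      | succ j => rw [conv_shiftSeq_succ]; exact h4 j (by omega) (by omega)
    · rw [conv_shiftSeq_succ, h5]

theorem BMInv.of_zero (H : BMInv s n L c q) (hd : conv c s n = 0) :
    BMInv s (n + 1) L c (shiftSeq 0 q) where
  c_zero := H.c_zero
  c_deg := H.c_deg
  c_conv j hj hj' := by
    rcases Nat.lt_succ_iff_lt_or_eq.1 hj' with h | rfl
    · exact H.c_conv j hj h
    · exact hd
  le := H.le.trans n.le_succ
  aux := H.aux_shift

/-- The discrepancy of `q` at `n` is 1, so subtracting the right multiple of `q` cancels that of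
`c`. As n < 2L, the degree n + 1 - L of `q` does not exceed L and the length is kept. -/
theorem BMInv.of_lt (H : BMInv s n L c q) (hL : n < 2 * L) :
    BMInv s (n + 1) L (fun i => c i - conv c s n * q i) (shiftSeq 0 q) := by
  obtain ⟨h1, h2, h3, h4, h5⟩ := H.aux.resolve_left fun h => by omega
  refine ⟨by simp [H.c_zero, h2], fun i hi => ?_, fun j hj hj' => ?_, H.le.trans n.le_succ,
    H.aux_shift⟩
  · rw [H.c_deg i hi, h3 i (by omega)]; ring
  · rw [conv_sub_smul]
    rcases Nat.lt_succ_iff_lt_or_eq.1 hj' with h | rfl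
    · rw [H.c_conv j hj h, h4 j (by omega) h]; ring
    · rw [h5]; ring

/-- Here the correction may exceed the length L, which jumps to n + 1 - L. The old `c`, divided by
its discrepancy, becomes the new auxiliary polynomial. -/
theorem BMInv.of_le (H : BMInv s n L c q) (hd : conv c s n ≠ 0) (hL : 2 * L ≤ n) :
    BMInv s (n + 1) (n + 1 - L) (fun i => c i - conv c s n * q i)
      (shiftSeq 0 fun i => c i / conv c s n) := by
  have hq0 : q 0 = 0 := by
    rcases H.aux with ⟨-, h2⟩ | ⟨-, h2, -⟩
    exacts [h2 0, h2]
  refine ⟨by simp [H.c_zero, hq0], fun i hi => ?_, fun j hj hj' => ?_, Nat.sub_le _ _,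
    Or.inr ⟨by omega, rfl, fun i hi => ?_, fun j hj hj' => ?_, ?_⟩⟩
  · rw [H.c_deg i (by omega)]
    rcases H.aux with ⟨-, h2⟩ | ⟨-, -, h3, -⟩
    · rw [h2]; ring
    · rw [h3 i (by omega)]; ring
  · rw [conv_sub_smul]
    rcases H.aux with ⟨h1, -⟩ | ⟨-, -, -, h4, h5⟩
    -- With L = 0 the new length is n + 1, and no equation has to hold yet.
    · omega
    rcases Nat.lt_succ_iff_lt_or_eq.1 hj' with h | rfl
    · rw [H.c_conv j (by omega) h, h4 j (by omega) h]; ring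
    · rw [h5]; ring
  · cases i with
    | zero => rfl
    | succ i => simp only [shiftSeq]; rw [H.c_deg i (by omega), zero_div]
  · cases j with
    | zero => simp [conv, shiftSeq]
    | succ j => rw [conv_shiftSeq_succ, conv_div, H.c_conv j (by omega) (by omega), zero_div]
  · rw [conv_shiftSeq_succ, conv_div, div_self hd]

/-- The bridge to Hankel matrices: a connection polynomial of degree at most D, read backwards, is a
vector whose products with Hankel rows are its discrepancies. -/
theorem conv_eq_sum_of_degree {D : ℕ} (hc : ∀ i, D < i → c i = 0) (a : ℕ) :
    conv c s (D + a) = ∑ i ∈ Finset.range (D + 1), c (D - i) * s (i + a) := by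
  rw [conv, show D + a + 1 = D + 1 + a by omega, Finset.sum_range_add,
    Finset.sum_eq_zero (s := Finset.range a) fun i _ => by rw [hc _ (by omega), zero_mul],
    add_zero, ← Finset.sum_range_reflect]
  refine Finset.sum_congr rfl fun i hi => ?_
  rw [Finset.mem_range] at hi
  congr 2; omega

/-- The Hankel matrix `(s (i + j))`, with `i, j < D`, is singular. -/
def HankelSingular (s : ℕ → K) (D : ℕ) : Prop :=
  ∃ a : ℕ → K, (∃ i < D, a i ≠ 0) ∧ ∀ b < D, ∑ i ∈ Finset.range D, a i * s (i + b) = 0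

/-- The 2D - 1 terms are exactly the entries of the Hankel matrix. If L < D, the reversed `c` is a
kernel vector, nonzero because c 0 = 1. If L > D, then `q` has degree at most 2D - L < D and its
reversal is a kernel vector, nonzero because its discrepancy at 2D - 1 is 1. -/
theorem BMInv.hankelSingular {D : ℕ} (hD : 0 < D) (H : BMInv s (2 * D - 1) L c q) (hL : L ≠ D) :
    HankelSingular s D := by
  obtain ⟨E, rfl⟩ := Nat.exists_eq_succ_of_ne_zero hD.ne'
  rcases lt_or_gt_of_ne hL with hL | hL
  · refine ⟨fun i => c (E - i), ⟨E, by omega, by simp [H.c_zero]⟩, fun b hb => ?_⟩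
    rw [← conv_eq_sum_of_degree fun i hi => H.c_deg i (by omega)]
    exact H.c_conv _ (by omega) (by omega)
  · obtain ⟨h1, h2, h3, h4, h5⟩ := H.aux.resolve_left fun h => by omega
    have hq : ∀ i, E < i → q i = 0 := fun i hi => h3 i (by omega)
    refine ⟨fun i => q (E - i), ?_, fun b hb => ?_⟩
    · by_contra! hcon
      have hq' : ∀ i, q i = 0 := fun i => by
        rcases lt_or_ge E i with hi | hi
        · exact hq i hi
        · simpa [Nat.sub_sub_self hi] using hcon (E - i) (by omega)
      simp [conv, hq'] at h5
    · rw [← conv_eq_sum_of_degree hq]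
      exact h4 _ (by omega) (by omega)

/-- One more correction, at index 2D - 1, cannot change the length D. It makes the recurrence hold
for all D equations, the last of which involves term 2D - 1. -/
theorem BMInv.hankel_recurrence {D : ℕ} (H : BMInv s (2 * D - 1) D c q) {a : ℕ} (ha : a < D) :
    ∑ i ∈ Finset.range D, (c (D - i) - conv c s (2 * D - 1) * q (D - i)) * s (i + a)
      = - s (D + a) := by
  obtain ⟨h1, h2, h3, h4, h5⟩ := H.aux.resolve_left fun h => by omega
  have hdeg : ∀ i, D < i → c i - conv c s (2 * D - 1) * q i = 0 := fun i hi => by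
    rw [H.c_deg i hi, h3 i (by omega)]; ring
  have h6 := conv_eq_sum_of_degree (s := s) hdeg a
  rw [Finset.sum_range_succ, conv_sub_smul] at h6
  have h7 : conv c s (D + a) - conv c s (2 * D - 1) * conv q s (D + a) = 0 := by
    rcases eq_or_ne (D + a) (2 * D - 1) with h | h
    · rw [h, h5]; ring
    · rw [H.c_conv _ (by omega) (by omega), h4 _ (by omega) (by omega)]; ring
  rw [h7] at h6
  simp only [Nat.sub_self, H.c_zero, h2] at h6
  linear_combination -h6

/-- The discrepancies of `q` from D to 2D - 1 are 0, …, 0, 1, so its reversal is the last column of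
the inverse Hankel matrix. Since q 0 = 0, only D coefficients remain. -/
theorem BMInv.hankel_last {D : ℕ} (H : BMInv s (2 * D - 1) D c q) {a : ℕ} (ha : a < D) :
    ∑ i ∈ Finset.range D, q (D - i) * s (i + a) = if a + 1 = D then 1 else 0 := by
  obtain ⟨h1, h2, h3, h4, h5⟩ := H.aux.resolve_left fun h => by omega
  have h6 := conv_eq_sum_of_degree (s := s) (fun i hi => h3 i (by omega) : ∀ i, D < i → q i = 0) a
  rw [Finset.sum_range_succ, Nat.sub_self, h2, zero_mul, add_zero] at h6
  rw [← h6]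
  split_ifs with h
  · rw [← h5]; congr 1; omega
  · exact h4 _ (by omega) (by omega)

/-- The columns of the inverse of a Hankel matrix of dimension `E + 1`, from the last one to the
first one: `u` is the last column and `h` the recurrence of the sequence. -/
def hankelCol (h u : ℕ → K) (E : ℕ) : ℕ → ℕ → K
  | 0 => u
  | t + 1 => fun i => shiftSeq 0 (hankelCol h u E t) i - h i * hankelCol h u E t E
      + h (E - t) * u i

/-- Shifting a column `z` of the inverse shifts the rows of the product with the Hankel matrix. The
coefficient that would leave the range is replaced through the recurrence `h`. The last row then
becomes - h (E - t) instead of 0, and a multiple of the last column `u` repairs it. -/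
theorem sum_hankelCol {h u : ℕ → K} {E : ℕ}
    (hh : ∀ a < E + 1, ∑ i ∈ Finset.range (E + 1), h i * s (i + a) = - s (E + 1 + a))
    (hu : ∀ a < E + 1, ∑ i ∈ Finset.range (E + 1), u i * s (i + a) = if a = E then 1 else 0)
    (t : ℕ) (ht : t < E + 1) : ∀ a < E + 1,
    ∑ i ∈ Finset.range (E + 1), hankelCol h u E t i * s (i + a) = if a + t = E then 1 else 0 := by
  induction t with
  | zero => exact hu
  | succ t ih =>
    specialize ih (by omega)
    intro a ha
    set z := hankelCol h u E t with hz
    have h1 : ∑ i ∈ Finset.range (E + 1), hankelCol h u E (t + 1) i * s (i + a)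
        = ∑ i ∈ Finset.range (E + 1), z i * s (i + (a + 1))
          + h (E - t) * if a = E then 1 else 0 := by
      rw [← hu a ha, Finset.mul_sum, Finset.sum_range_succ (fun i => z i * s (i + (a + 1))),
        show E + (a + 1) = E + 1 + a by omega, ← neg_neg (s (E + 1 + a)), ← hh a ha]
      have h2 : ∑ i ∈ Finset.range (E + 1), shiftSeq 0 z i * s (i + a)
          = ∑ i ∈ Finset.range E, z i * s (i + (a + 1)) := by
        rw [Finset.sum_range_succ']
        simp only [shiftSeq, zero_mul, add_zero]
        exact Finset.sum_congr rfl fun i _ => by rw [add_right_comm, add_assoc]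
      rw [← h2, mul_neg, Finset.mul_sum, ← Finset.sum_neg_distrib, ← Finset.sum_add_distrib,
        ← Finset.sum_add_distrib]
      refine Finset.sum_congr rfl fun i _ => ?_
      simp only [hankelCol, ← hz]
      ring
    rw [h1]
    rcases eq_or_ne a E with rfl | hne
    · rw [if_pos rfl, if_neg (by omega), mul_one]
      -- In the last row, the terms beyond the Hankel matrix are expanded by the recurrence; the
      -- induction hypothesis then leaves only the index E - t.
      have h3 : ∀ i, i ∈ Finset.range (a + 1) → z i * s (i + (a + 1)) =
          - ∑ j ∈ Finset.range (a + 1), h j * (z i * s (i + j)) := fun i hi => by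
        rw [show i + (a + 1) = a + 1 + i by omega, ← neg_neg (s (a + 1 + i)),
          ← hh i (Finset.mem_range.1 hi), mul_neg, Finset.mul_sum]
        congr 1
        exact Finset.sum_congr rfl fun j _ => by rw [add_comm i j]; ring
      rw [Finset.sum_congr rfl h3, Finset.sum_neg_distrib, Finset.sum_comm]
      simp only [← Finset.mul_sum]
      rw [Finset.sum_congr rfl fun j hj => by rw [ih j (Finset.mem_range.1 hj)],
        Finset.sum_eq_single (a - t)]
      · rw [if_pos (by omega)]; ring
      · intro b _ hb; rw [if_neg (by omega), mul_zero]
      · intro hb; exact absurd (Finset.mem_range.2 (by omega)) hb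
    · rw [if_neg hne, mul_zero, add_zero, ih (a + 1) (by omega)]
      exact if_congr (by omega) rfl rfl

/-- The vectors `z t` are the columns of an inverse, in reverse order; by symmetry, pairing a kernel
vector with one of them isolates a single entry. -/
theorem not_hankelSingular {D : ℕ} {z : ℕ → ℕ → K}
    (hz : ∀ t < D, ∀ a < D, ∑ i ∈ Finset.range D, z t i * s (i + a)
      = if a + t + 1 = D then 1 else 0) : ¬ HankelSingular s D := by
  rintro ⟨a, ⟨l, hl, hal⟩, ha⟩
  apply hal
  have h1 : ∑ b ∈ Finset.range D, z (D - 1 - l) b * ∑ i ∈ Finset.range D, a i * s (i + b) = 0 :=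
    Finset.sum_eq_zero fun b hb => by rw [ha b (Finset.mem_range.1 hb), mul_zero]
  simp only [Finset.mul_sum] at h1
  rw [Finset.sum_comm] at h1
  have h2 : ∀ i ∈ Finset.range D, ∑ b ∈ Finset.range D, z (D - 1 - l) b * (a i * s (i + b)) =
      a i * if i + (D - 1 - l) + 1 = D then 1 else 0 := fun i hi => by
    rw [← hz _ (by omega) i (Finset.mem_range.1 hi), Finset.mul_sum]
    exact Finset.sum_congr rfl fun b _ => by rw [add_comm i b]; ring
  rw [Finset.sum_congr rfl h2, Finset.sum_eq_single l, if_pos (by omega), mul_one] at h1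
  · exact h1
  · intro b _ hb; rw [if_neg (by omega), mul_zero]
  · intro hb; exact absurd (Finset.mem_range.2 hl) hb

end BerlekampMassey

/-! ## The corresponding programs -/

section

variable {k : Type u} [Field k] {ι ο : Type}

/-- Compute a list of `W` operands. -/
def Prog.table (W : ℕ) (f : ℕ → Prog k ι ο (Operand k ι)) : Prog k ι ο (ℕ → Operand k ι) :=
  .bind (.vec W fun i => f i) fun v => .pure fun i => if h : i < W then v ⟨i, h⟩ else .const 0

/-- The coefficient of degree `n` of a product. -/
def Prog.conv (c s : ℕ → Operand k ι) (n : ℕ) : Prog k ι ο (Operand k ι) :=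
  .dot ((List.finRange (n + 1)).map fun i : Fin (n + 1) => (c i, s (n - (i : ℕ)))) (.const 0)

/-- `a - b * c` -/
def Prog.subMul (a b c : Operand k ι) : Prog k ι ο (Operand k ι) :=
  .bind (.op .mul b c) fun w => .op .sub a w

/-- The length of the current connection polynomial, this polynomial, and the auxiliary one. -/
abbrev BMState (k : Type u) (ι : Type) : Type u := ℕ × (ℕ → Operand k ι) × (ℕ → Operand k ι)

/-- One step of the Berlekamp–Massey algorithm. -/
def Prog.bmStep (W : ℕ) (s : ℕ → Operand k ι) (n : ℕ) (S : BMState k ι) :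
    Prog k ι ο (BMState k ι) :=
  .bind (.conv S.2.1 s n) fun d =>
    .ifZero d (.pure (S.1, S.2.1, shiftSeq (.const 0) S.2.2)) <|
      .bind (.table W fun i => .subMul (S.2.1 i) d (S.2.2 i)) fun c =>
        -- The length is known when the tree is built, along each branch, so this comparison is not
        -- an operation of the tree.
        if 2 * S.1 ≤ n then
          .bind (.table W fun i => .op .div (S.2.1 i) d) fun q =>
            .pure (n + 1 - S.1, c, shiftSeq (.const 0) q)
        else .pure (S.1, c, shiftSeq (.const 0) S.2.2)

/-- The Berlekamp–Massey algorithm on the first `n` terms of the sequence `s`. -/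
def Prog.bm (W : ℕ) (s : ℕ → Operand k ι) (n : ℕ) : Prog k ι ο (BMState k ι) :=
  .iter (.bmStep W s) (0, (fun i => if i = 0 then .const 1 else .const 0), fun _ => .const 0) n

/-- One column of the inverse of a Hankel matrix. -/
def Prog.hankelStep (E : ℕ) (h u : ℕ → Operand k ι) (t : ℕ) (S : ℕ → ℕ → Operand k ι) :
    Prog k ι ο (ℕ → ℕ → Operand k ι) :=
  .bind (.table (E + 1) fun i =>
    .bind (.subMul (shiftSeq (.const 0) (S t) i) (h i) (S t E)) fun w =>
      .bind (.op .mul (h (E - t)) (u i)) fun w' => .op .add w w') fun z =>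
    .pure (Function.update S (t + 1) z)

/-- The inverse of a Hankel matrix, column by column. -/
def Prog.hankelInv (E : ℕ) (h u : ℕ → Operand k ι) : Prog k ι ο (ℕ → ℕ → Operand k ι) :=
  .iter (.hankelStep E h u) (fun _ => u) E

variable {K : Type u} [Field K] [Algebra k K] {x : ι → K} {regs : List K}

theorem Runs.table {W C : ℕ} {f : ℕ → Prog k ι ο (Operand k ι)} {v : ℕ → K}
    (h : ∀ i < W, ∀ r, regs <+: r → Runs x r (f i) C fun r' o => Den x r' o (v i)) :
    Runs x regs (Prog.table W f) (W * C) fun r T => ∀ i < W, Den x r (T i) (v i) := by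
  refine (Runs.bind (C₂ := 0) (Runs.vec (Q := fun i r o => Den x r o (v i))
    (fun i r r' a hr ha => ha.mono hr) fun i r hr => h i i.2 r hr)
    fun r V _ hV => Runs.pure fun i hi => ?_).mono (by simp) fun _ _ _ h => h
  beta_reduce
  rw [dif_pos hi]
  exact hV ⟨i, hi⟩

theorem Runs.conv {c s : ℕ → Operand k ι} {vc vs : ℕ → K} {n : ℕ}
    (hc : ∀ i ≤ n, Den x regs (c i) (vc i)) (hs : ∀ i ≤ n, Den x regs (s i) (vs i)) :
    Runs x regs (Prog.conv c s n : Prog k ι ο _) (2 * (n + 1))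
      fun r o => Den x r o (_root_.conv vc vs n) := by
  refine (Runs.dot (l := List.finRange (n + 1)) (A := fun i : Fin (n + 1) => c i) (B := fun i : Fin (n + 1) => s (n - (i : ℕ)))
    (fun i => hc i (by omega)) (fun i => hs (n - i) (by omega)) (den_zero x regs)).mono
    (C' := 2 * (n + 1)) (by simp) fun r o _ h => ?_
  rwa [zero_add, ← Fin.sum_univ_def,
    Fin.sum_univ_eq_sum_range (fun i => vc i * vs (n - i)) (n + 1)] at h

theorem Runs.subMul {a b c : Operand k ι} {va vb vc : K} (ha : Den x regs a va)
    (hb : Den x regs b vb) (hc : Den x regs c vc) :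
    Runs x regs (Prog.subMul a b c : Prog k ι ο _) 2 fun r o => Den x r o (va - vb * vc) :=
  (Runs.op hb hc (by simp)).bind fun _ _ hr hw => Runs.op (ha.mono hr) hw (by simp)

theorem den_shiftSeq {W : ℕ} {c : ℕ → Operand k ι} {vc : ℕ → K}
    (hc : ∀ i < W, Den x regs (c i) (vc i)) (i : ℕ) (hi : i < W) :
    Den x regs (shiftSeq (.const 0) c i) (shiftSeq 0 vc i) := by
  cases i with
  | zero => exact den_zero _ _
  | succ i => exact hc i (by omega)

/-- Each step takes at most 2W operations for the discrepancy, 3W for the two tables and one test,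
hence at most 6W. -/
theorem Runs.bm {W n : ℕ} (hn : n ≤ W) {s : ℕ → Operand k ι} {vs : ℕ → K}
    (hs : ∀ i < W, Den x regs (s i) (vs i)) :
    Runs x regs (Prog.bm W s n : Prog k ι ο _) (n * (6 * W)) fun r S =>
      ∃ c q, BMInv vs n S.1 c q ∧ (∀ i < W, Den x r (S.2.1 i) (c i)) ∧
        ∀ i < W, Den x r (S.2.2 i) (q i) := by
  refine Runs.iter (Q := fun n r (S : BMState k ι) => ∃ c q, BMInv vs n S.1 c q ∧
    (∀ i < W, Den x r (S.2.1 i) (c i)) ∧ ∀ i < W, Den x r (S.2.2 i) (q i)) ?_ ?_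
  · refine ⟨_, _, BMInv.init vs, fun i _ => ?_, fun i _ => den_zero _ _⟩
    dsimp only
    split_ifs
    exacts [den_one _ _, den_zero _ _]
  · rintro j r ⟨L, C, Q⟩ hj hr ⟨c, q, H, hC, hQ⟩
    dsimp only at H hC hQ
    refine (Runs.bind (C₂ := W * 2 + (W * 1 + 0) + 1) (Runs.conv (fun i hi => hC i (by omega))
      fun i hi => (hs i (by omega)).mono hr) fun r₁ d hr₁ hd => ?_).mono (by omega)
      fun _ _ _ h => h
    refine Runs.ifZero hd (fun h0 => ?_) fun h0 => ?_
    · exact (Runs.pure ⟨c, _, H.of_zero h0, fun i hi => (hC i hi).mono hr₁,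
        den_shiftSeq fun i hi => (hQ i hi).mono hr₁⟩).mono (Nat.zero_le _) fun _ _ _ h => h
    · refine Runs.bind (Runs.table fun i hi r' hr' =>
        Runs.subMul ((hC i hi).mono (hr₁.trans hr')) (hd.mono hr')
          ((hQ i hi).mono (hr₁.trans hr'))) fun r₂ c' hr₂ hc' => ?_
      split_ifs with hL
      · refine Runs.bind (Runs.table fun i hi r' hr' => Runs.op
          ((hC i hi).mono ((hr₁.trans hr₂).trans hr')) (hd.mono (hr₂.trans hr'))
          fun _ => h0) fun r₃ q' hr₃ hq' => ?_
        exact Runs.pure ⟨_, _, H.of_le h0 hL, fun i hi => (hc' i hi).mono hr₃,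
          den_shiftSeq hq'⟩
      · exact (Runs.pure ⟨_, _, H.of_lt (not_le.1 hL), hc', den_shiftSeq fun i hi =>
          (hQ i hi).mono (hr₁.trans hr₂)⟩).mono (Nat.zero_le _) fun _ _ _ h => h

theorem Runs.hankelInv {E : ℕ} {h u : ℕ → Operand k ι} {vh vu : ℕ → K}
    (hh : ∀ i < E + 1, Den x regs (h i) (vh i)) (hu : ∀ i < E + 1, Den x regs (u i) (vu i)) :
    Runs x regs (Prog.hankelInv E h u : Prog k ι ο _) (E * ((E + 1) * 4)) fun r S =>
      ∀ t < E + 1, ∀ i < E + 1, Den x r (S t i) (hankelCol vh vu E t i) := by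
  refine (Runs.iter (Q := fun n r S => ∀ t ≤ n, ∀ i < E + 1,
    Den x r (S t i) (hankelCol vh vu E t i)) ?_ ?_).mono le_rfl
    fun r S _ H t ht => H t (by omega)
  · intro t ht i hi
    rw [Nat.le_zero.1 ht]
    exact hu i hi
  · intro n r S hn hr H
    rw [← add_zero ((E + 1) * 4)]
    refine Runs.bind (Runs.table (v := hankelCol vh vu E (n + 1))
      fun i hi r' hr' => ?_) fun r' z hr' hz => Runs.pure fun t ht i hi => ?_
    · refine (Runs.subMul ((den_shiftSeq (H n le_rfl) i hi).mono hr')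
        ((hh i hi).mono (hr.trans hr')) ((H n le_rfl E (by omega)).mono hr')).bind (C₂ := 1 + 1)
        fun r₁ w hr₁ hw => ?_
      refine (Runs.op ((hh (E - n) (by omega)).mono ((hr.trans hr').trans hr₁))
        ((hu i hi).mono ((hr.trans hr').trans hr₁)) (by simp)).bind fun r₂ w' hr₂ hw' => ?_
      exact Runs.op (hw.mono hr₂) hw' (by simp)
    · rcases eq_or_ne t (n + 1) with rfl | hne
      · rw [Function.update_self]
        exact hz i hi
      · rw [Function.update_of_ne hne]
        exact (H t (by omega) i hi).mono hr'

end

/-! ## Coordinates modulo an ideal in Shape Position -/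

section Groebner

open MvPolynomial

variable {K : Type u} [Field K]

theorem IsReducedGB.leadingTerm_eq {n : ℕ} {o : MonomialOrder (Fin n)}
    {I : Ideal (MvPolynomial (Fin n) K)} {G : Set (MvPolynomial (Fin n) K)}
    (hG : IsReducedGB o I G) :
    o.leadingTerm '' G = (fun t => monomial t (1 : K)) '' (o.degree '' G) := by
  rw [Set.image_image]
  refine Set.image_congr fun g hg => ?_
  rw [MonomialOrder.leadingTerm, (hG.monic g hg).leadingCoeff_eq_one]

/-- Otherwise the leading monomial of `f` would lie in the initial ideal, hence be divisible by that
of some element of `G`. This gives uniqueness of normal forms. -/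
theorem IsReducedGB.eq_zero {n : ℕ} {o : MonomialOrder (Fin n)}
    {I : Ideal (MvPolynomial (Fin n) K)} {G : Set (MvPolynomial (Fin n) K)}
    (hG : IsReducedGB o I G) {f : MvPolynomial (Fin n) K} (hf : f ∈ I)
    (h : ∀ t ∈ f.support, ∀ g ∈ G, ¬ o.degree g ≤ t) : f = 0 := by
  by_contra hf0
  have h1 : o.leadingTerm f ∈ Ideal.span (o.leadingTerm '' G) := by
    rw [← hG.span_leadingTerm]
    exact Ideal.subset_span ⟨f, hf, rfl⟩
  rw [hG.leadingTerm_eq, mem_ideal_span_monomial_image] at h1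
  obtain ⟨_, ⟨g, hg, rfl⟩, hle⟩ := h1 (o.degree f) (by
    rw [o.support_leadingTerm' hf0]; simp)
  exact h _ (o.degree_mem_support hf0) g hg hle

theorem IsReducedGB.span_eq {n : ℕ} {o : MonomialOrder (Fin n)}
    {I : Ideal (MvPolynomial (Fin n) K)} {G : Set (MvPolynomial (Fin n) K)}
    (hG : IsReducedGB o I G) : Ideal.span G = I := by
  refine le_antisymm (Ideal.span_le.2 hG.subset) fun f hf => ?_
  obtain ⟨q, r, hfr, -, hr⟩ := o.div_set (B := G)
    (fun b hb => by rw [(hG.monic b hb).leadingCoeff_eq_one]; exact isUnit_one) f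
  have hq : Finsupp.linearCombination (MvPolynomial (Fin n) K)
      (fun b : G => (b : MvPolynomial (Fin n) K)) q ∈ Ideal.span G := by
    rw [Finsupp.linearCombination_apply]
    exact Submodule.sum_mem _ fun b _ => Ideal.mul_mem_left _ _ (Ideal.subset_span b.2)
  have hr0 : r = 0 := by
    refine hG.eq_zero ?_ hr
    rw [← sub_eq_iff_eq_add'.2 hfr]
    exact I.sub_mem hf (Ideal.span_le.2 hG.subset hq)
  rw [hfr, hr0, add_zero]
  exact hq

theorem coeff_aeval_X {σ : Type*} [DecidableEq σ] (v : σ) (p : Polynomial K) (t : σ →₀ ℕ) :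
    coeff t (Polynomial.aeval (X v : MvPolynomial σ K) p)
      = ∑ i ∈ Finset.range (p.natDegree + 1), if Finsupp.single v i = t then p.coeff i else 0 := by
  rw [Polynomial.aeval_eq_sum_range, coeff_sum]
  refine Finset.sum_congr rfl fun i _ => ?_
  rw [coeff_smul, coeff_X_pow, smul_eq_mul, mul_ite, mul_one, mul_zero]

theorem coeff_single_aeval_X {σ : Type*} (v : σ) (p : Polynomial K) (i : ℕ) :
    coeff (Finsupp.single v i) (Polynomial.aeval (X v : MvPolynomial σ K) p) = p.coeff i := by
  classical
  rw [coeff_aeval_X]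
  simp only [(Finsupp.single_injective v).eq_iff]
  rw [Finset.sum_ite_eq']
  split_ifs with h
  · rfl
  · rw [Polynomial.coeff_eq_zero_of_natDegree_lt]
    simpa using h

/-- Every monomial order sorts the powers of one variable by exponent. This transfers monicity from
the LEX basis to the univariate polynomial. -/
theorem leadingCoeff_aeval_X {σ : Type*} (o : MonomialOrder σ) (v : σ) (p : Polynomial K) :
    o.leadingCoeff (Polynomial.aeval (X v : MvPolynomial σ K) p) = p.leadingCoeff := by
  classical
  rcases eq_or_ne p 0 with rfl | hp
  · simp
  set f := Polynomial.aeval (X v : MvPolynomial σ K) p with hf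
  have h1 : Finsupp.single v p.natDegree ∈ f.support := by
    rw [mem_support_iff, coeff_single_aeval_X]
    simpa using hp
  have hf0 : f ≠ 0 := by rintro h; simp [h] at h1
  have h2 := o.degree_mem_support hf0
  rw [mem_support_iff, hf, coeff_aeval_X] at h2
  obtain ⟨i, hi, hne⟩ := Finset.exists_ne_zero_of_sum_ne_zero h2
  rw [ne_eq, ite_eq_right_iff, Classical.not_imp, ← hf] at hne
  have h3 : p.natDegree ≤ i := by
    by_contra! hlt
    have h4 := o.le_degree h1
    rw [← hne.1] at h4
    exact absurd h4 (not_le.2 (o.toSyn_strictMono (by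
      refine lt_of_le_of_ne (by simpa using hlt.le) ?_
      simpa [(Finsupp.single_injective v).eq_iff] using hlt.ne)))
  rw [Finset.mem_range] at hi
  rw [MonomialOrder.leadingCoeff, ← hne.1, coeff_single_aeval_X, show i = p.natDegree by omega]
  rfl

/-- The polynomials `h v` describe the LEX Gröbner basis of the ideal `I` in Shape Position. -/
structure IsShape {m : ℕ} (I : Ideal (MvPolynomial (Fin (m + 1)) K)) (D : ℕ)
    (h : Fin (m + 1) → Polynomial K) : Prop where
  degree_lt : ∀ v, v ≠ Fin.last m → (h v).degree < D
  degree_last : (h (Fin.last m)).degree = D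
  gb : IsReducedGB MonomialOrder.lex I (shapeBasis h)

namespace IsShape

variable {m D : ℕ} {I : Ideal (MvPolynomial (Fin (m + 1)) K)} {h : Fin (m + 1) → Polynomial K}

theorem monic (H : IsShape I D h) : (h (Fin.last m)).Monic := by
  have h1 := H.gb.monic (Polynomial.aeval (X (Fin.last m)) (h (Fin.last m)))
    ⟨Fin.last m, by simp⟩
  rwa [MonomialOrder.Monic, leadingCoeff_aeval_X] at h1

theorem natDegree_last (H : IsShape I D h) : (h (Fin.last m)).natDegree = D :=
  Polynomial.natDegree_eq_of_degree_eq_some H.degree_last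

theorem last_mem (H : IsShape I D h) :
    Polynomial.aeval (X (Fin.last m)) (h (Fin.last m)) ∈ I :=
  H.gb.subset ⟨Fin.last m, by simp⟩

theorem sub_mem (H : IsShape I D h) {v : Fin (m + 1)} (hv : v ≠ Fin.last m) :
    X v - Polynomial.aeval (X (Fin.last m)) (h v) ∈ I :=
  H.gb.subset ⟨v, by simp [hv]⟩

/-- The substitution x_v ↦ h_v, x_m ↦ X sends `I` into the ideal generated by the last polynomial,
which has degree D. Hence the first D powers of x_m are independent modulo `I`. -/
theorem eq_zero_of_mem (H : IsShape I D h) {p : Polynomial K} (hp : p.degree < D)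
    (hpI : Polynomial.aeval (X (Fin.last m) : MvPolynomial (Fin (m + 1)) K) p ∈ I) : p = 0 := by
  let ψ : MvPolynomial (Fin (m + 1)) K →ₐ[K] Polynomial K :=
    aeval fun v => if v = Fin.last m then Polynomial.X else h v
  have hψ : ∀ q : Polynomial K, ψ (Polynomial.aeval (X (Fin.last m)) q) = q := fun q => by
    rw [← Polynomial.aeval_algHom_apply]
    simp [ψ]
  have h1 : I ≤ (Ideal.span {h (Fin.last m)}).comap ψ := by
    rw [← H.gb.span_eq, Ideal.span_le]
    rintro _ ⟨v, rfl⟩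
    simp only [SetLike.mem_coe, Ideal.mem_comap]
    split_ifs with hv
    · rw [hψ, hv]
      exact Ideal.mem_span_singleton_self _
    · rw [map_sub, hψ]
      simp [ψ, hv]
  have h2 := h1 hpI
  rw [Ideal.mem_comap, hψ, Ideal.mem_span_singleton] at h2
  exact Polynomial.eq_zero_of_dvd_of_degree_lt h2 (by rwa [H.degree_last])

theorem outPoly_eq (H : IsShape I D h) {y : Fin (m + 1) × Fin D → K}
    (hy : ∀ v i, y (v, i) = (h v).coeff i) : outPoly y = h := by
  funext v
  have h1 : ∀ q : Polynomial K, ∑ i : Fin D, Polynomial.C (q.coeff i) * Polynomial.X ^ (i : ℕ)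
      = ∑ i ∈ Finset.range D, Polynomial.C (q.coeff i) * Polynomial.X ^ i := fun q =>
    Fin.sum_univ_eq_sum_range (fun i => Polynomial.C (q.coeff i) * Polynomial.X ^ i) D
  simp only [outPoly, hy, h1]
  split_ifs with hv
  · subst hv
    conv_rhs => rw [(H.monic).as_sum, H.natDegree_last]
  · rw [zero_add]
    ext i
    simp only [Polynomial.finsetSum_coeff, Polynomial.coeff_C_mul_X_pow, Finset.sum_ite_eq,
      Finset.mem_range, ite_eq_left_iff, not_lt]
    exact fun hi => ((Polynomial.degree_lt_iff_coeff_zero _ _).1 (H.degree_lt v hv) i hi).symm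

end IsShape

end Groebner

section Coordinates

open MvPolynomial

variable {K : Type u} [Field K]

/-- The polynomial with the coordinates `c` on the irreducible monomials. -/
noncomputable def ofCoords {n : ℕ} (sh : GBShape n) :
    (Fin sh.D → K) →ₗ[K] MvPolynomial (Fin n) K :=
  ∑ i, (monomial (sh.basis i)) ∘ₗ LinearMap.proj i

theorem ofCoords_apply {n : ℕ} (sh : GBShape n) (c : Fin sh.D → K) :
    ofCoords sh c = ∑ i, monomial (sh.basis i) (c i) := by
  simp [ofCoords]

/-- The coordinates of the polynomial `1`. -/
def oneCoords {n : ℕ} (sh : GBShape n) (K : Type u) [Field K] (i : Fin sh.D) : K :=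
  if sh.basis i = 0 then 1 else 0

namespace IsDRLBasis

variable {n : ℕ} {I : Ideal (MvPolynomial (Fin n) K)} {sh : GBShape n}
  {g : Fin sh.s → MvPolynomial (Fin n) K}

theorem basis_injective (H : IsDRLBasis I sh g) : Function.Injective sh.basis := fun _ _ hij =>
  H.basis_strictMono.injective (congrArg (drl n).toSyn hij)

theorem not_lead_le (H : IsDRLBasis I sh g) (i : Fin sh.D) (j : Fin sh.s) :
    ¬ sh.lead j ≤ sh.basis i :=
  (H.range_basis.le ⟨i, rfl⟩ : sh.basis i ∈ {t | ∀ j, ¬ sh.lead j ≤ t}) j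

theorem coeff_ofCoords (H : IsDRLBasis I sh g) (c : Fin sh.D → K) (i : Fin sh.D) :
    coeff (sh.basis i) (ofCoords sh c) = c i := by
  classical
  rw [ofCoords_apply, coeff_sum]
  simp [coeff_monomial, H.basis_injective.eq_iff]

theorem eq_basis_of_mem_support {c : Fin sh.D → K} {t : Fin n →₀ ℕ}
    (ht : t ∈ (ofCoords sh c).support) : ∃ i, sh.basis i = t := by
  classical
  rw [mem_support_iff, ofCoords_apply, coeff_sum] at ht
  obtain ⟨i, -, hi⟩ := Finset.exists_ne_zero_of_sum_ne_zero ht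
  rw [coeff_monomial] at hi
  exact ⟨i, (ite_ne_right_iff.1 hi).1⟩

theorem eq_zero_of_mem (H : IsDRLBasis I sh g) {c : Fin sh.D → K} (hc : ofCoords sh c ∈ I) :
    c = 0 := by
  have h1 : ofCoords sh c = 0 := by
    refine H.isReducedGB.eq_zero hc ?_
    rintro t ht _ ⟨j, rfl⟩
    obtain ⟨i, rfl⟩ := eq_basis_of_mem_support ht
    rw [H.degree_eq]
    exact H.not_lead_le i j
  funext i
  rw [← H.coeff_ofCoords c i, h1, coeff_zero]
  rfl

theorem eq_of_sub_mem (H : IsDRLBasis I sh g) {c c' : Fin sh.D → K}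
    {f : MvPolynomial (Fin n) K} (hc : ofCoords sh c - f ∈ I) (hc' : ofCoords sh c' - f ∈ I) :
    c = c' := by
  refine sub_eq_zero.1 (H.eq_zero_of_mem ?_)
  rw [map_sub]
  simpa using I.sub_mem hc hc'

/-- A leading monomial dividing 1 would divide every monomial, leaving none irreducible. -/
theorem exists_basis_eq_zero (H : IsDRLBasis I sh g) (hD : 0 < sh.D) : ∃ i, sh.basis i = 0 := by
  have h1 : (0 : Fin n →₀ ℕ) ∈ Set.range sh.basis := by
    rw [H.range_basis]
    exact fun j hj => H.not_lead_le ⟨0, hD⟩ j (hj.trans (zero_le))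
  exact h1

theorem ofCoords_one (H : IsDRLBasis I sh g) (hD : 0 < sh.D) :
    ofCoords sh (oneCoords sh K) = 1 := by
  obtain ⟨i, hi⟩ := H.exists_basis_eq_zero hD
  rw [ofCoords_apply, Finset.sum_eq_single i]
  · simp [oneCoords, hi]
  · intro b _ hb
    have : sh.basis b ≠ 0 := by rw [← hi]; exact fun h => hb (H.basis_injective h)
    simp [oneCoords, this]
  · simp

theorem sub_X_mul_mem {v : Fin n} {T : Matrix (Fin sh.D) (Fin sh.D) K}
    (hT : IsMultMatrix I sh v T) (c : Fin sh.D → K) :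
    ofCoords sh (T.mulVec c) - X v * ofCoords sh c ∈ I := by
  have h1 : ofCoords sh (T.mulVec c) - X v * ofCoords sh c = - ∑ j, C (c j) *
      (X v * monomial (sh.basis j) 1 - ∑ i, monomial (sh.basis i) (T i j)) := by
    simp only [mul_sub, Finset.sum_sub_distrib, ofCoords_apply, Finset.mul_sum, Matrix.mulVec,
      dotProduct, map_sum]
    rw [Finset.sum_comm, neg_sub]
    congr 1
    · refine Finset.sum_congr rfl fun j _ => Finset.sum_congr rfl fun i _ => ?_
      rw [C_mul_monomial, mul_comm]
    · refine Finset.sum_congr rfl fun j _ => ?_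
      rw [mul_left_comm, C_mul_monomial, mul_one]
  rw [h1]
  exact I.neg_mem (I.sum_mem fun j _ => I.mul_mem_left _ (hT j).2)

theorem sub_X_pow_mem (H : IsDRLBasis I sh g) (hD : 0 < sh.D) {v : Fin n}
    {T : Matrix (Fin sh.D) (Fin sh.D) K} (hT : IsMultMatrix I sh v T) (j : ℕ) :
    ofCoords sh ((T ^ j).mulVec (oneCoords sh K)) - X v ^ j ∈ I := by
  induction j with
  | zero => simp [H.ofCoords_one hD]
  | succ j ih =>
    have h1 := I.add_mem (sub_X_mul_mem hT ((T ^ j).mulVec (oneCoords sh K)))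
      (I.mul_mem_left (X v) ih)
    rw [Matrix.mulVec_mulVec, ← pow_succ'] at h1
    convert h1 using 1
    ring

theorem sub_aeval_mem (H : IsDRLBasis I sh g) (hD : 0 < sh.D) {v : Fin n}
    {T : Matrix (Fin sh.D) (Fin sh.D) K} (hT : IsMultMatrix I sh v T) (p : Polynomial K) {N : ℕ}
    (hN : p.natDegree < N) :
    ofCoords sh (∑ j ∈ Finset.range N, p.coeff j • (T ^ j).mulVec (oneCoords sh K))
      - Polynomial.aeval (X v) p ∈ I := by
  rw [Polynomial.aeval_eq_sum_range' hN, map_sum, ← Finset.sum_sub_distrib]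
  refine I.sum_mem fun j _ => ?_
  rw [map_smul, ← smul_sub, smul_eq_C_mul]
  exact I.mul_mem_left _ (H.sub_X_pow_mem hD hT j)

theorem ofCoords_single (i : Fin sh.D) :
    ofCoords sh (Pi.single i (1 : K)) = monomial (sh.basis i) 1 := by
  rw [ofCoords_apply, Finset.sum_eq_single i]
  · simp
  · intro b _ hb; simp [Pi.single_eq_of_ne hb]
  · simp

/-- Reducedness makes every non-leading term of `g j` irreducible, so the normal form of a leading
monomial is read directly from the inputs. -/
theorem ofCoords_coeff (H : IsDRLBasis I sh g) (j : Fin sh.s) :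
    ofCoords sh (fun i => - coeff (sh.basis i) (g j)) = monomial (sh.lead j) 1 - g j := by
  classical
  have hlead : coeff (sh.lead j) (g j) = 1 := by
    rw [← H.degree_eq]
    exact (H.isReducedGB.monic _ ⟨j, rfl⟩).coeff_degree
  ext t
  rw [coeff_sub, coeff_monomial]
  by_cases ht : ∃ i, sh.basis i = t
  · obtain ⟨i, rfl⟩ := ht
    rw [H.coeff_ofCoords, if_neg fun h => H.not_lead_le i j h.le, zero_sub]
  · have h1 : coeff t (ofCoords sh fun i => - coeff (sh.basis i) (g j)) = 0 := by
      by_contra h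
      exact ht (eq_basis_of_mem_support (mem_support_iff.2 h))
    rw [h1]
    split_ifs with h
    · rw [← h, hlead, sub_self]
    · rw [eq_comm, zero_sub, neg_eq_zero]
      by_contra hne
      have h2 : t ∈ (g j).support := mem_support_iff.2 hne
      have h3 : t ∉ Set.range sh.basis := ht
      rw [H.range_basis] at h3
      simp only [Set.mem_ofPred_eq, not_forall, not_not] at h3
      obtain ⟨j', hj'⟩ := h3
      -- A term divisible by the leading monomial of its own polynomial is that monomial, being also
      -- at most equal to it in the order; any other divisor contradicts reducedness.
      rcases eq_or_ne (g j') (g j) with heq | hne'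
      · have h4 : sh.lead j' = sh.lead j := by rw [← H.degree_eq, heq, H.degree_eq]
        rw [h4] at hj'
        have h5 := (drl n).le_degree h2
        rw [H.degree_eq] at h5
        exact h ((drl n).toSyn.injective (le_antisymm ((drl n).toSyn_monotone hj') h5))
      · refine H.isReducedGB.reduced _ ⟨j, rfl⟩ _ ⟨j', rfl⟩ hne' t h2 ?_
        rwa [H.degree_eq]

theorem lead_eq_of_le_single (H : IsDRLBasis I sh g) (hD : 0 < sh.D) {v : Fin n} {j : Fin sh.s}
    (hj : sh.lead j ≤ Finsupp.single v 1) : sh.lead j = Finsupp.single v 1 := by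
  have h1 : sh.lead j ≠ 0 := fun h => H.not_lead_le ⟨0, hD⟩ j (h ▸ zero_le)
  have h2 : ∀ w, w ≠ v → sh.lead j w = 0 := fun w hw => by
    have := hj w
    rw [Finsupp.single_eq_of_ne hw] at this
    omega
  have h3 : sh.lead j v ≤ 1 := by simpa using hj v
  ext w
  rcases eq_or_ne w v with rfl | hw
  · rw [Finsupp.single_eq_same]
    by_contra hne
    apply h1
    ext w'
    rcases eq_or_ne w' w with rfl | hw'
    · simp; omega
    · simpa using h2 w' hw'
  · rw [h2 w hw, Finsupp.single_eq_of_ne hw]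

theorem exists_basis_or_lead (H : IsDRLBasis I sh g) (hD : 0 < sh.D) (v : Fin n) :
    (∃ i, sh.basis i = Finsupp.single v 1) ∨ ∃ j, sh.lead j = Finsupp.single v 1 := by
  by_cases h : ∃ j, sh.lead j ≤ Finsupp.single v 1
  · obtain ⟨j, hj⟩ := h
    exact Or.inr ⟨j, H.lead_eq_of_le_single hD hj⟩
  · have h1 : Finsupp.single v 1 ∈ Set.range sh.basis := by
      rw [H.range_basis]
      simpa using h
    exact Or.inl h1

end IsDRLBasis

end Coordinates

/-! ## Hankel systems and the LEX Gröbner basis -/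

section Recurrence

variable {K : Type u} [Field K]

/-- A recurrence of degree less than D restricts to a kernel vector of the Hankel matrix.
Conversely, the order-D recurrence `b` propagates a kernel vector from D shifts to all of them, and
such a vector, normalised, is a shorter recurrence. -/
theorem minPolyDegree_lt_iff {s : ℕ → K} {D : ℕ} {b : ℕ → K}
    (hb : ∀ j, ∑ i ∈ Finset.range D, b i * s (i + j) = - s (D + j)) :
    minPolyDegree s (2 * D) < D ↔ HankelSingular s D := by
  constructor
  · intro h
    -- The infimum of the empty set is 0, so some recurrence must be exhibited before `sInf` can be
    -- used; the one given by `b` serves.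
    have hne : {e | ∃ p : Polynomial K, IsRecurrence s (2 * D) p ∧ p.natDegree = e}.Nonempty := by
      let q : Polynomial K := ∑ i ∈ Finset.range D, Polynomial.C (b i) * Polynomial.X ^ i
      have hq : q.degree < D := by
        refine (Polynomial.degree_lt_iff_coeff_zero _ _).2 fun i hi => ?_
        simp only [q, Polynomial.finsetSum_coeff, Polynomial.coeff_C_mul_X_pow,
          Finset.sum_ite_eq, Finset.mem_range]
        rw [if_neg (by omega)]
      have hdeg : (Polynomial.X ^ D + q).natDegree = D := by
        rw [Polynomial.natDegree_add_eq_left_of_degree_lt (by simpa using hq),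
          Polynomial.natDegree_X_pow]
      refine ⟨D, Polynomial.X ^ D + q, ⟨Polynomial.monic_X_pow_add hq, fun j hj => ?_⟩, hdeg⟩
      rw [hdeg, Finset.sum_range_succ]
      have h1 : ∀ i ∈ Finset.range D, (Polynomial.X ^ D + q).coeff i * s (j + i)
          = b i * s (i + j) := fun i hi => by
        have hi' := Finset.mem_range.1 hi
        simp [q, Polynomial.coeff_X_pow, hi'.ne, hi', Polynomial.finsetSum_coeff, add_comm]
      rw [Finset.sum_congr rfl h1, hb]
      have h2 : (Polynomial.X ^ D + q).coeff D = 1 := by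
        rw [Polynomial.coeff_add, Polynomial.coeff_X_pow_self,
          Polynomial.coeff_eq_zero_of_degree_lt hq, add_zero]
      rw [h2, add_comm D j]
      ring
    obtain ⟨p, ⟨hp, hrec⟩, he⟩ := Nat.sInf_mem hne
    have hlt : p.natDegree < D := he.trans_lt h
    refine ⟨p.coeff, ⟨p.natDegree, hlt, by simp [hp]⟩, fun a ha => ?_⟩
    rw [← hrec a (by omega)]
    rw [← Finset.sum_subset (Finset.range_mono hlt) fun i _ hi => ?_]
    · exact Finset.sum_congr rfl fun i _ => by rw [add_comm]
    · rw [Polynomial.coeff_eq_zero_of_natDegree_lt (by simpa using hi), zero_mul]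
  · rintro ⟨a, ⟨l, hl, hal⟩, ha⟩
    have hu : ∀ j, ∑ i ∈ Finset.range D, a i * s (i + j) = 0 := by
      intro j
      induction j using Nat.strong_induction_on with
      | _ j ih =>
        rcases lt_or_ge j D with hj | hj
        · exact ha j hj
        · obtain ⟨e, rfl⟩ := Nat.exists_eq_add_of_le hj
          have h1 : ∀ i ∈ Finset.range D, a i * s (i + (D + e))
              = - ∑ t ∈ Finset.range D, b t * (a i * s (i + (t + e))) := fun i _ => by
            rw [show i + (D + e) = D + (i + e) by omega, ← neg_neg (s _), ← hb, mul_neg,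
              Finset.mul_sum]
            congr 1
            exact Finset.sum_congr rfl fun t _ => by
              rw [show t + (i + e) = i + (t + e) by omega]; ring
          rw [Finset.sum_congr rfl h1, Finset.sum_neg_distrib, Finset.sum_comm]
          simp only [← Finset.mul_sum]
          rw [Finset.sum_eq_zero fun t ht => ?_, neg_zero]
          rw [ih _ (by have := Finset.mem_range.1 ht; omega), mul_zero]
    let q : Polynomial K := ∑ i ∈ Finset.range D, Polynomial.C (a i) * Polynomial.X ^ i
    have hqc : ∀ i, q.coeff i = if i < D then a i else 0 := fun i => by
      simp [q, Polynomial.finsetSum_coeff]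
    have hq0 : q ≠ 0 := fun h => hal (by have := hqc l; simpa [h, hl] using this.symm)
    have hq : q.natDegree < D := by
      rw [Polynomial.natDegree_lt_iff_degree_lt hq0, Polynomial.degree_lt_iff_coeff_zero]
      intro i hi
      rw [hqc, if_neg (by omega)]
    refine lt_of_le_of_lt (Nat.sInf_le ⟨_, ⟨Polynomial.monic_mul_leadingCoeff_inv hq0,
      fun j _ => ?_⟩, rfl⟩) ((Polynomial.natDegree_mul_C_of_isUnit
        (IsUnit.mk0 _ (inv_ne_zero (Polynomial.leadingCoeff_ne_zero.2 hq0))) q).trans_lt hq)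
    rw [Polynomial.natDegree_mul_C_of_isUnit
        (IsUnit.mk0 _ (inv_ne_zero (Polynomial.leadingCoeff_ne_zero.2 hq0)))]
    have h2 : ∑ i ∈ Finset.range (q.natDegree + 1), q.coeff i * s (j + i) = 0 := by
      rw [← hu j]
      rw [← Finset.sum_subset (Finset.range_mono hq) fun i hiD hi => ?_]
      · refine Finset.sum_congr rfl fun i hi => ?_
        rw [hqc, if_pos (by have := Finset.mem_range.1 hi; omega), add_comm]
      · have hi' : q.natDegree < i := by simpa using hi
        have := hqc i
        rw [Polynomial.coeff_eq_zero_of_natDegree_lt hi'] at this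
        rw [if_pos (Finset.mem_range.1 hiD)] at this
        rw [← this, zero_mul]
    simp only [Polynomial.coeff_mul_C, mul_right_comm _ (q.leadingCoeff⁻¹)]
    rw [← Finset.sum_mul, h2, zero_mul]

end Recurrence

/-! ### Factorisation of the Hankel matrix and recovery of the coefficients. -/

section Solve

open MvPolynomial

variable {K : Type u} [Field K]

/-- The factorisation of the Hankel matrix as R B, with half of the power moved to the transpose. -/
theorem wiedemannSeq_eq {n : ℕ} (sh : GBShape n) (T : Matrix (Fin sh.D) (Fin sh.D) K)
    (r : Fin sh.D → K) (i j : ℕ) :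
    wiedemannSeq sh T r (i + j)
      = ((T.transpose ^ i).mulVec r) ⬝ᵥ (T ^ j).mulVec (oneCoords sh K) := by
  rw [← Matrix.transpose_pow, Matrix.mulVec_transpose, ← Matrix.dotProduct_mulVec,
    Matrix.mulVec_mulVec, ← pow_add]
  rfl

variable {m : ℕ} {I : Ideal (MvPolynomial (Fin (m + 1)) K)} {sh : GBShape (m + 1)}
  {g : Fin sh.s → MvPolynomial (Fin (m + 1)) K} {T : Matrix (Fin sh.D) (Fin sh.D) K}
  {h : Fin (m + 1) → Polynomial K}

theorem IsShape.natDegree_lt (S : IsShape I sh.D h) (hD : 0 < sh.D) {v : Fin (m + 1)}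
    (hv : v ≠ Fin.last m) : (h v).natDegree < sh.D := by
  rcases eq_or_ne (h v) 0 with h0 | h0
  · simpa [h0] using hD
  · exact (Polynomial.natDegree_lt_iff_degree_lt h0).2 (S.degree_lt v hv)

theorem IsShape.sum_last (S : IsShape I sh.D h) (H : IsDRLBasis I sh g) (hD : 0 < sh.D)
    (hT : IsMultMatrix I sh (Fin.last m) T) :
    ∑ j ∈ Finset.range (sh.D + 1),
      (h (Fin.last m)).coeff j • (T ^ j).mulVec (oneCoords sh K) = 0 := by
  refine H.eq_zero_of_mem ?_
  have h1 := H.sub_aeval_mem hD hT (h (Fin.last m)) (N := sh.D + 1)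
    (by rw [S.natDegree_last]; omega)
  simpa using I.add_mem h1 S.last_mem

/-- The coefficients of `h v` are the coordinates of x_v on the powers of x_m; both sides are normal
forms of x_v. -/
theorem IsShape.sum_eq (S : IsShape I sh.D h) (H : IsDRLBasis I sh g) (hD : 0 < sh.D)
    (hT : IsMultMatrix I sh (Fin.last m) T) {v : Fin (m + 1)} (hv : v ≠ Fin.last m)
    {c : Fin sh.D → K} (hc : ofCoords sh c - X v ∈ I) :
    ∑ j ∈ Finset.range sh.D, (h v).coeff j • (T ^ j).mulVec (oneCoords sh K) = c := by
  refine H.eq_of_sub_mem ?_ hc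
  have h1 := H.sub_aeval_mem hD hT (h v) (S.natDegree_lt hD hv)
  simpa using I.sub_mem h1 (S.sub_mem hv)

theorem IsShape.wiedemannSeq_recurrence (S : IsShape I sh.D h) (H : IsDRLBasis I sh g)
    (hD : 0 < sh.D) (hT : IsMultMatrix I sh (Fin.last m) T) (r : Fin sh.D → K) (j : ℕ) :
    ∑ i ∈ Finset.range sh.D, (h (Fin.last m)).coeff i * wiedemannSeq sh T r (i + j)
      = - wiedemannSeq sh T r (sh.D + j) := by
  have h1 := congrArg (fun x => ((T.transpose ^ j).mulVec r) ⬝ᵥ x) (S.sum_last H hD hT)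
  simp only [dotProduct_sum, dotProduct_smul, smul_eq_mul, ← wiedemannSeq_eq,
    dotProduct_zero] at h1
  have h2 : (h (Fin.last m)).coeff sh.D = 1 := by
    have := S.monic.coeff_natDegree
    rwa [S.natDegree_last] at this
  rw [Finset.sum_range_succ, h2, one_mul] at h1
  simp only [add_comm j] at h1
  exact eq_neg_of_add_eq_zero_left h1

theorem IsShape.exists_not_hankelSingular (S : IsShape I sh.D h) (H : IsDRLBasis I sh g)
    (hD : 0 < sh.D) (hT : IsMultMatrix I sh (Fin.last m) T) :
    ∃ r, ¬ HankelSingular (wiedemannSeq sh T r) sh.D := by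
  let B : Matrix (Fin sh.D) (Fin sh.D) K :=
    Matrix.of fun l j => (T ^ (j : ℕ)).mulVec (oneCoords sh K) l
  have hB : IsUnit B := by
    rw [← Matrix.linearIndependent_cols_iff_isUnit, Fintype.linearIndependent_iff]
    intro a ha
    let a' : ℕ → K := fun i => if hi : i < sh.D then a ⟨i, hi⟩ else 0
    let p : Polynomial K := ∑ i ∈ Finset.range sh.D, Polynomial.C (a' i) * Polynomial.X ^ i
    have hpc : ∀ i, p.coeff i = a' i := fun i => by
      simp only [p, Polynomial.finsetSum_coeff, Polynomial.coeff_C_mul_X_pow,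
          Finset.sum_ite_eq, Finset.mem_range]
      simp only [a']
      split_ifs <;> rfl
    have hp : p.degree < sh.D := by
      rw [Polynomial.degree_lt_iff_coeff_zero]
      intro i hi
      rw [hpc]
      exact dif_neg (by omega)
    have hpn : p.natDegree < sh.D := by
      rcases eq_or_ne p 0 with h0 | h0
      · simpa [h0] using hD
      · exact (Polynomial.natDegree_lt_iff_degree_lt h0).2 hp
    have hsum : ∑ j ∈ Finset.range sh.D, p.coeff j • (T ^ j).mulVec (oneCoords sh K) = 0 := by
      rw [← ha, ← Fin.sum_univ_eq_sum_range
        (fun j => p.coeff j • (T ^ j).mulVec (oneCoords sh K))]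
      refine Finset.sum_congr rfl fun j _ => ?_
      rw [hpc]
      simp only [a', j.2, dite_true]
      rfl
    have hmem := H.sub_aeval_mem hD hT p hpn
    rw [hsum, map_zero, zero_sub, neg_mem_iff] at hmem
    have hp0 := S.eq_zero_of_mem hp hmem
    intro i
    have := hpc i
    rw [hp0] at this
    simpa [a'] using this.symm
  -- With first D terms 0, …, 0, 1, the Hankel matrix is zero above its antidiagonal and 1 on it.
  -- Since `B` is invertible, some `r` produces these terms.
  let e : Fin sh.D → K := fun j => if (j : ℕ) + 1 = sh.D then 1 else 0
  refine ⟨Matrix.vecMul e B⁻¹, fun hs => ?_⟩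
  have hseq : ∀ j (hj : j < sh.D), wiedemannSeq sh T (Matrix.vecMul e B⁻¹) j = e ⟨j, hj⟩ := by
    intro j hj
    have h1 : Matrix.vecMul (Matrix.vecMul e B⁻¹) B = e := by
      rw [Matrix.vecMul_vecMul, Matrix.nonsing_inv_mul _ ((Matrix.isUnit_iff_isUnit_det B).1 hB),
        Matrix.vecMul_one]
    exact congrFun h1 ⟨j, hj⟩
  obtain ⟨a, ⟨l, hl, hal⟩, ha⟩ := hs
  -- Back substitution: row b of the triangular system shows that entry D - 1 - b of the kernel
  -- vector vanishes.
  have hall : ∀ b, ∀ i, i < sh.D → sh.D ≤ i + 1 + b → a i = 0 := by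
    intro b
    induction b with
    | zero =>
      intro i hi hib
      have h1 := ha 0 hD
      rw [Finset.sum_eq_single i] at h1
      · rw [add_zero, hseq i hi] at h1
        simpa [e, show i + 1 = sh.D by omega] using h1
      · intro i' hi' hne
        have hi'' := Finset.mem_range.1 hi'
        rw [add_zero, hseq i' hi'']
        simp [e, show i' + 1 ≠ sh.D by omega]
      · intro hi'; exact absurd (Finset.mem_range.2 hi) hi'
    | succ b ih =>
      intro i hi hib
      rcases eq_or_ne sh.D (i + 1 + (b + 1)) with heq | hne
      · have h1 := ha (b + 1) (by omega)
        rw [Finset.sum_eq_single i] at h1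
        · rw [hseq (i + (b + 1)) (by omega)] at h1
          simpa [e, show i + (b + 1) + 1 = sh.D by omega] using h1
        · intro i' hi' hne'
          have hi'' := Finset.mem_range.1 hi'
          rcases lt_or_gt_of_ne hne' with hlt | hlt
          · rw [hseq (i' + (b + 1)) (by omega)]
            simp [e, show i' + (b + 1) + 1 ≠ sh.D by omega]
          · rw [ih i' hi'' (by omega), zero_mul]
        · intro hi'; exact absurd (Finset.mem_range.2 hi) hi'
      · exact ih i hi (by omega)
  exact hal (hall sh.D l hl (by omega))

/-- With Z the inverse of the Hankel matrix R B, the product Z R inverts B, which sends the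
coefficients `p` to the given vector. The index D - 1 - b restores the order of the columns. -/
theorem mulVec_hankelInv {z : ℕ → ℕ → K} {r : Fin sh.D → K}
    (hz : ∀ t < sh.D, ∀ a < sh.D, ∑ i ∈ Finset.range sh.D,
      z t i * wiedemannSeq sh T r (i + a) = if a + t + 1 = sh.D then 1 else 0) (p : ℕ → K) :
    ((Matrix.of fun (a b : Fin sh.D) => z (sh.D - 1 - b) a) *
      (Matrix.of fun (i l : Fin sh.D) => (T.transpose ^ (i : ℕ)).mulVec r l)).mulVec
        (∑ j ∈ Finset.range sh.D, p j • (T ^ j).mulVec (oneCoords sh K))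
      = fun a : Fin sh.D => p a := by
  set Z : Matrix (Fin sh.D) (Fin sh.D) K := Matrix.of fun a b => z (sh.D - 1 - b) a with hZ
  set R : Matrix (Fin sh.D) (Fin sh.D) K :=
    Matrix.of fun i l => (T.transpose ^ (i : ℕ)).mulVec r l with hR
  let B : Matrix (Fin sh.D) (Fin sh.D) K :=
    Matrix.of fun l j => (T ^ (j : ℕ)).mulVec (oneCoords sh K) l
  have hRB : ∀ i j, (R * B) i j = wiedemannSeq sh T r (i + j) := fun i j => by
    rw [wiedemannSeq_eq]; rfl
  have h1 : (R * B) * Z = 1 := by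
    ext a b
    rw [Matrix.mul_apply]
    have h2 := hz (sh.D - 1 - b) (by omega) a a.2
    rw [← Fin.sum_univ_eq_sum_range
      (fun i => z (sh.D - 1 - b) i * wiedemannSeq sh T r (i + a))] at h2
    rw [Finset.sum_congr rfl fun i _ => by rw [hRB, mul_comm, add_comm (a : ℕ)]]
    refine h2.trans ?_
    rw [Matrix.one_apply]
    exact if_congr (by rw [Fin.ext_iff]; omega) rfl rfl
  have h3 : Z * R * B = 1 := by rw [mul_assoc]; exact mul_eq_one_comm.1 h1
  have h4 : ∑ j ∈ Finset.range sh.D, p j • (T ^ j).mulVec (oneCoords sh K)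
      = B.mulVec fun j => p j := by
    rw [← Fin.sum_univ_eq_sum_range (fun j => p j • (T ^ j).mulVec (oneCoords sh K))]
    funext l
    simp only [Finset.sum_apply, Pi.smul_apply, smul_eq_mul, Matrix.mulVec, dotProduct, B,
      Matrix.of_apply]
    exact Finset.sum_congr rfl fun j _ => mul_comm _ _
  rw [h4, Matrix.mulVec_mulVec, h3, Matrix.one_mulVec]

theorem IsShape.coeff_last_eq (S : IsShape I sh.D h) (H : IsDRLBasis I sh g)
    (hD : 0 < sh.D) (hT : IsMultMatrix I sh (Fin.last m) T) {r : Fin sh.D → K}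
    (hs : ¬ HankelSingular (wiedemannSeq sh T r) sh.D) {b : ℕ → K}
    (hb : ∀ a < sh.D, ∑ i ∈ Finset.range sh.D, b i * wiedemannSeq sh T r (i + a)
      = - wiedemannSeq sh T r (sh.D + a)) {i : ℕ} (hi : i < sh.D) :
    b i = (h (Fin.last m)).coeff i := by
  by_contra hne
  refine hs ⟨fun i => b i - (h (Fin.last m)).coeff i, ⟨i, hi, sub_ne_zero.2 hne⟩, fun a ha => ?_⟩
  simp only [sub_mul, Finset.sum_sub_distrib]
  rw [hb a ha, S.wiedemannSeq_recurrence H hD hT, sub_self]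

end Solve

/-! ## The change of ordering -/

section ChangeOfOrdering

open MvPolynomial

namespace GBShape

variable {n : ℕ} (sh : GBShape n)

open Classical in
/-- The position of a leading monomial. -/
noncomputable def leadIdx (a : Fin n →₀ ℕ) : Option (Fin sh.s) :=
  if h : ∃ j, sh.lead j = a then some h.choose else none

open Classical in
/-- The position of an irreducible monomial. -/
noncomputable def basisIdx (a : Fin n →₀ ℕ) : Option (Fin sh.D) :=
  if h : ∃ i, sh.basis i = a then some h.choose else none

/-- The positions of the irreducible monomials of degree at most one. -/
noncomputable def lowIdx : Finset (Fin sh.D) :=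
  Finset.univ.filter fun i => (sh.basis i).degree ≤ 1

variable {sh} {a : Fin n →₀ ℕ}

theorem lead_of_leadIdx {j : Fin sh.s} (h : sh.leadIdx a = some j) : sh.lead j = a := by
  unfold leadIdx at h
  split_ifs at h with h'
  rw [← Option.some.inj h]
  exact h'.choose_spec

theorem exists_leadIdx (h : ∃ j, sh.lead j = a) : ∃ j, sh.leadIdx a = some j :=
  ⟨_, dif_pos h⟩

theorem basis_of_basisIdx {i : Fin sh.D} (h : sh.basisIdx a = some i) : sh.basis i = a := by
  unfold basisIdx at h
  split_ifs at h with h'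
  rw [← Option.some.inj h]
  exact h'.choose_spec

theorem exists_basisIdx (h : ∃ i, sh.basis i = a) : ∃ i, sh.basisIdx a = some i :=
  ⟨_, dif_pos h⟩

end GBShape

/-! ### The program for the change of ordering. -/

section Programs

variable {k : Type u} [Field k] {ο : Type} {N m : ℕ}
  (t : CompTree k ((Fin N × Fin N) ⊕ (Fin N × Fin N)) (Fin N × Fin N)) (sh : GBShape (m + 1))

/-- An entry of the multiplication matrix. -/
def GBShape.opT (i j : Fin sh.D) : Operand k (ChgInput sh) := .input (.inl (i, j))

/-- A coefficient of the Gröbner basis. -/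
def GBShape.opG (j : Fin sh.s) (i : Fin sh.D) : Operand k (ChgInput sh) := .input (.inr (.inl (j, i)))

/-- An entry of the random vector. -/
def GBShape.opR (i : Fin sh.D) : Operand k (ChgInput sh) := .input (.inr (.inr i))

/-- The terms of the Wiedemann sequence, read in the Krylov vectors. -/
noncomputable def GBShape.seqOp {ι : Type} (V : Fin sh.D → Fin (2 * sh.D) → Operand k ι) (j : ℕ) :
    Operand k ι :=
  if hj : j < 2 * sh.D then (sh.basisIdx 0).elim (.const 0) fun i => V i ⟨j, hj⟩ else .const 0

/-- Krylov vectors and Berlekamp–Massey algorithm. -/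
noncomputable def Prog.krylovBM : Prog k (ChgInput sh) ο
    ((Fin sh.D → Fin (2 * sh.D) → Operand k (ChgInput sh)) × BMState k (ChgInput sh)) :=
  -- The indices are exchanged to iterate the transpose of T on r: the coordinate at the monomial 1
  -- gives the sequence, and the same vectors serve later as the rows of R.
  .bind (.krylov t (2 * sh.D) (Nat.clog 2 (2 * sh.D)) (fun i j => sh.opT j i) sh.opR) fun V =>
    .bind (.bm (2 * sh.D) (sh.seqOp V) (2 * sh.D - 1)) fun S => .pure (V, S)

/-- The vectors `- B * g j`, for the linear polynomials `g j`, by a product of matrices. -/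
noncomputable def Prog.reduceDense (B : Fin sh.D → Fin sh.D → Operand k (ChgInput sh)) :
    Prog k (ChgInput sh) ο (Fin (m + 1) → ℕ → Operand k (ChgInput sh)) :=
  .bind (.mul t B fun l (v : Fin (m + 1)) =>
      (sh.leadIdx (Finsupp.single v 1)).elim (.const 0) fun j => sh.opG j l) fun P =>
    .vec (m + 1) fun v => .table sh.D fun i =>
      if hi : i < sh.D then .op .sub (.const 0) (P ⟨i, hi⟩ v) else .pure (.const 0)

/-- The vectors `- B * g j`, for the linear polynomials `g j`, one after the other. -/
noncomputable def Prog.reduceSparse (B : Fin sh.D → Fin sh.D → Operand k (ChgInput sh)) :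
    Prog k (ChgInput sh) ο (Fin (m + 1) → ℕ → Operand k (ChgInput sh)) :=
  .vec (m + 1) fun v => if v = Fin.last m then .pure fun _ => .const 0 else
    (sh.leadIdx (Finsupp.single v 1)).elim (.pure fun _ => .const 0) fun j =>
      .table sh.D fun i => if hi : i < sh.D then
        .bind (.dot (sh.lowIdx.toList.map fun l => (B ⟨i, hi⟩ l, sh.opG j l)) (.const 0)) fun w =>
          .op .sub (.const 0) w else .pure (.const 0)

/-- The matrix of the operands of the inverse of the Hankel matrix. -/
def GBShape.opZ {ι : Type} (Z : ℕ → ℕ → Operand k ι) (a b : Fin sh.D) : Operand k ι :=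
  Z (sh.D - 1 - b) a

/-- The first half of the Krylov vectors. -/
def GBShape.opV {ι : Type} (V : Fin sh.D → Fin (2 * sh.D) → Operand k ι) (i l : Fin sh.D) :
    Operand k ι :=
  V l ⟨i, by omega⟩

/-- The resolution of the Hankel systems, when the connection polynomial has length `D`. -/
noncomputable def Prog.solve (V : Fin sh.D → Fin (2 * sh.D) → Operand k (ChgInput sh))
    (S : BMState k (ChgInput sh)) :
    Prog k (ChgInput sh) ο (Fin (m + 1) × Fin sh.D → Operand k (ChgInput sh)) :=
  -- The discrepancy at index 2D - 1, the only term not yet used, gives the last correction of the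
  -- recurrence.
  .bind (.conv S.2.1 (sh.seqOp V) (2 * sh.D - 1)) fun d =>
  .bind (.table sh.D fun i => .subMul (S.2.1 (sh.D - i)) d (S.2.2 (sh.D - i))) fun h =>
  .bind (.hankelInv (sh.D - 1) h fun i => S.2.2 (sh.D - i)) fun Z =>
  .bind (.mul t (sh.opZ Z) (sh.opV V)) fun B =>
  -- When n ≤ D the coordinate vectors fit into one matrix product. The choice depends only on the
  -- shape and costs nothing.
  .bind (if m + 1 ≤ sh.D then .reduceDense t sh B else .reduceSparse sh B) fun F =>
  .pure fun e => if e.1 = Fin.last m then h e.2 else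
    (sh.basisIdx (Finsupp.single e.1 1)).elim (F e.1 e.2) fun l => B e.2 l

/-- The change of ordering. -/
noncomputable def changeTree : CompTree k (ChgInput sh) (Fin (m + 1) × Fin sh.D) :=
  -- Without solutions the output has no entries, so the constant is never read.
  if sh.D = 0 then .ret fun _ => .const 0 else
    Prog.krylovBM t sh 0 fun N₁ P =>
      if P.2.1 = sh.D then Prog.solve t sh P.1 P.2 N₁ fun _ out => .ret out else .fail

end Programs

/-! ### Correctness and cost of the Krylov, Berlekamp–Massey and reduction steps. -/

section Semantics

variable {k : Type u} [Field k] {ο : Type} {N m : ℕ}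
  {t : CompTree k ((Fin N × Fin N) ⊕ (Fin N × Fin N)) (Fin N × Fin N)} {sh : GBShape (m + 1)}
  {K : Type u} [Field K] [Algebra k K] {μ : ℕ} {regs : List K}
  {T : Matrix (Fin sh.D) (Fin sh.D) K} {g : Fin sh.s → MvPolynomial (Fin (m + 1)) K}
  {r : Fin sh.D → K} {I : Ideal (MvPolynomial (Fin (m + 1)) K)}

theorem den_opT (i j : Fin sh.D) : Den (k := k) (chgInput sh T g r) regs (sh.opT i j) (T i j) :=
  den_input _ _ _

theorem den_opG (j : Fin sh.s) (i : Fin sh.D) :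
    Den (k := k) (chgInput sh T g r) regs (sh.opG j i) (coeff (sh.basis i) (g j)) :=
  den_input _ _ _

theorem den_opR (i : Fin sh.D) : Den (k := k) (chgInput sh T g r) regs (sh.opR i) (r i) :=
  den_input _ _ _

theorem den_seqOp (H : IsDRLBasis I sh g) (hD : 0 < sh.D) {ι : Type} {x : ι → K}
    {V : Fin sh.D → Fin (2 * sh.D) → Operand k ι}
    (hV : ∀ i j, Den x regs (V i j) ((T.transpose ^ (j : ℕ)).mulVec r i)) (j : ℕ)
    (hj : j < 2 * sh.D) : Den x regs (sh.seqOp V j) (wiedemannSeq sh T r j) := by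
  obtain ⟨i, hi⟩ := GBShape.exists_basisIdx (H.exists_basis_eq_zero hD)
  have hi' := GBShape.basis_of_basisIdx hi
  have h1 : wiedemannSeq sh T r j = (T.transpose ^ j).mulVec r i := by
    have h2 : oneCoords sh K = Pi.single i 1 := by
      funext l
      rcases eq_or_ne l i with rfl | hne
      · simp [oneCoords, hi']
      · have : sh.basis l ≠ 0 := by rw [← hi']; exact fun h => hne (H.basis_injective h)
        simp [oneCoords, this, hne]
    have h3 := wiedemannSeq_eq sh T r j 0
    rw [add_zero, pow_zero, Matrix.one_mulVec, h2, dotProduct_single_one] at h3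
    exact h3
  rw [h1, GBShape.seqOp, dif_pos hj, hi]
  exact hV i ⟨j, hj⟩

theorem Runs.krylovBM (ht : IsMulTree t K μ) (hN : 2 * sh.D ≤ N) (H : IsDRLBasis I sh g)
    (hD : 0 < sh.D) : Runs (chgInput sh T g r) regs (Prog.krylovBM t sh : Prog k _ ο _)
      (Nat.clog 2 (2 * sh.D) * (2 * μ) + (2 * sh.D - 1) * (6 * (2 * sh.D))) fun rg P =>
      (∀ i j, Den (chgInput sh T g r) rg (P.1 i j) ((T.transpose ^ (j : ℕ)).mulVec r i)) ∧
      ∃ c q, BMInv (wiedemannSeq sh T r) (2 * sh.D - 1) P.2.1 c q ∧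
        (∀ i < 2 * sh.D, Den (chgInput sh T g r) rg (P.2.2.1 i) (c i)) ∧
        ∀ i < 2 * sh.D, Den (chgInput sh T g r) rg (P.2.2.2 i) (q i) := by
  rw [← add_zero ((2 * sh.D - 1) * _)]
  refine Runs.bind (Runs.krylov (w := r) ht (by omega) hN (Nat.le_pow_clog one_lt_two _)
    (fun i j => den_opT j i) (fun i => den_opR i)) fun rg V hrg hV => ?_
  refine Runs.bind (Runs.bm (by omega) fun j hj => den_seqOp H hD hV j hj)
    fun rg' S hrg' hS => Runs.pure ⟨fun i j => (hV i j).mono hrg', hS⟩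

theorem degree_le_of_drl_le {n : ℕ} {a b : Fin n →₀ ℕ}
    (h : (drl n).toSyn a ≤ (drl n).toSyn b) : a.degree ≤ b.degree := by
  have h1 : DegRevLex.key (show DegRevLex n from a) ≤ DegRevLex.key (show DegRevLex n from b) := h
  rcases Prod.Lex.toLex_le_toLex.1 h1 with h2 | h2
  exacts [le_of_lt h2, h2.1.le]

/-- DRL compares degrees first, so a basis element whose leading monomial is a variable has only
terms of degree at most 1. This sparsity is what `reduceSparse` exploits. -/
theorem IsDRLBasis.coeff_eq_zero (H : IsDRLBasis I sh g) {v : Fin (m + 1)} {j : Fin sh.s}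
    (hj : sh.lead j = Finsupp.single v 1) {l : Fin sh.D} (hl : l ∉ sh.lowIdx) :
    coeff (sh.basis l) (g j) = 0 := by
  by_contra hne
  apply hl
  have h1 := degree_le_of_drl_le ((drl (m + 1)).le_degree (mem_support_iff.2 hne))
  rw [H.degree_eq, hj] at h1
  simpa [GBShape.lowIdx] using h1

theorem Runs.reduceDense (ht : IsMulTree t K μ) (hN : sh.D ≤ N) (hm : m + 1 ≤ sh.D)
    {B : Fin sh.D → Fin sh.D → Operand k (ChgInput sh)} {b : Matrix (Fin sh.D) (Fin sh.D) K}
    (hB : ∀ i l, Den (chgInput sh T g r) regs (B i l) (b i l)) :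
    Runs (chgInput sh T g r) regs (Prog.reduceDense t sh B : Prog k _ ο _)
      (μ + (m + 1) * sh.D) fun rg F => ∀ v, v ≠ Fin.last m → ∀ j,
        sh.leadIdx (Finsupp.single v 1) = some j → ∀ i : Fin sh.D,
        Den (chgInput sh T g r) rg (F v i) (-∑ l, b i l * coeff (sh.basis l) (g j)) := by
  let G : Matrix (Fin sh.D) (Fin (m + 1)) K := Matrix.of fun l v =>
    (sh.leadIdx (Finsupp.single v 1)).elim 0 fun j => coeff (sh.basis l) (g j)
  refine Runs.bind (Runs.mul ht hN hN (hm.trans hN) hB (b := G) fun l v => ?_)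
    fun rg P hrg hP => ?_
  · simp only [G, Matrix.of_apply]
    cases sh.leadIdx (Finsupp.single v 1) with
    | none => exact den_zero _ _
    | some j => exact den_opG j l
  · let w : Fin (m + 1) → ℕ → K := fun v i =>
      if hi : i < sh.D then 0 - (b * G) ⟨i, hi⟩ v else 0
    refine (Runs.vec (C := fun _ => sh.D * 1) (Q := fun v rg (F : ℕ → Operand k (ChgInput sh)) => ∀ i < sh.D,
      Den (chgInput sh T g r) rg (F i) (w v i)) (fun v r₁ r₂ F h12 h i hi => (h i hi).mono h12)
      fun v rg' hrg' => Runs.table fun i hi rg'' hrg'' => ?_).mono (by simp)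
      fun rg' F _ hF v _ j hj i => ?_
    · simp only [w, dif_pos hi]
      exact Runs.op (den_zero _ _) ((hP _ _).mono (hrg'.trans hrg'')) (by simp)
    · have h1 := hF v i i.2
      have h2 : w v i = -∑ l, b i l * coeff (sh.basis l) (g j) := by
        simp [w, Matrix.mul_apply, G, hj]
      rwa [h2] at h1

theorem Runs.reduceSparse (H : IsDRLBasis I sh g)
    {B : Fin sh.D → Fin sh.D → Operand k (ChgInput sh)} {b : Matrix (Fin sh.D) (Fin sh.D) K}
    (hB : ∀ i l, Den (chgInput sh T g r) regs (B i l) (b i l)) :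
    Runs (chgInput sh T g r) regs (Prog.reduceSparse sh B : Prog k _ ο _)
      ((reducibleVars sh).ncard * (sh.D * (2 * sh.lowIdx.card + 1))) fun rg F =>
        ∀ v, v ≠ Fin.last m → ∀ j,
        sh.leadIdx (Finsupp.single v 1) = some j → ∀ i : Fin sh.D,
        Den (chgInput sh T g r) rg (F v i) (-∑ l, b i l * coeff (sh.basis l) (g j)) := by
  classical
  -- Only the reducible variables are charged; the other entries are filled without any operation.
  refine (Runs.vec (C := fun v => if v ∈ reducibleVars sh then
    sh.D * (2 * sh.lowIdx.card + 1) else 0) (Q := fun v rg (F : ℕ → Operand k (ChgInput sh)) => v ≠ Fin.last m → ∀ j,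
        sh.leadIdx (Finsupp.single v 1) = some j → ∀ i : Fin sh.D,
        Den (chgInput sh T g r) rg (F i) (-∑ l, b i l * coeff (sh.basis l) (g j)))
    (fun v r₁ r₂ F h12 h hv j hj i => (h hv j hj i).mono h12) fun v rg hrg => ?_).mono ?_
    fun _ _ _ h => h
  · split_ifs with hv hv'
    · subst hv; exact absurd rfl hv'.1
    · exact Runs.pure fun h => absurd hv h
    · cases hj : sh.leadIdx (Finsupp.single v 1) with
      | none => exact (Runs.pure fun _ j hj' => by simp at hj').mono (Nat.zero_le _)
                  fun _ _ _ h => h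
      | some j =>
        rw [Option.elim_some]
        let w : ℕ → K := fun i =>
          if hi : i < sh.D then 0 - (0 + (sh.lowIdx.toList.map fun l =>
            b ⟨i, hi⟩ l * coeff (sh.basis l) (g j)).sum) else 0
        refine Runs.mono (Runs.table (v := w) (C := 2 * sh.lowIdx.card + 1)
          fun i hi rg' hrg' => ?_) le_rfl ?_
        · simp only [w, dif_pos hi]
          rw [← Finset.length_toList]
          exact Runs.bind (Runs.dot (fun l => (hB _ l).mono (hrg.trans hrg'))
            (fun l => den_opG j l) (den_zero _ _)) fun rg'' o hr ho =>
              Runs.op (den_zero _ _) ho (by simp)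
        · intro rg' F _ hF _ j' hj' i
          obtain rfl := Option.some.inj hj'
          have h1 := hF i i.2
          have h2 : w i = -∑ l, b i l * coeff (sh.basis l) (g j) := by
            simp only [w, Fin.is_lt, dite_true, zero_sub, zero_add, Finset.sum_map_toList]
            congr 1
            refine Finset.sum_subset (Finset.subset_univ _) fun l _ hl => ?_
            rw [H.coeff_eq_zero (GBShape.lead_of_leadIdx hj) hl, mul_zero]
          rwa [h2] at h1
    · cases hj : sh.leadIdx (Finsupp.single v 1) with
      | none => exact Runs.pure fun _ j hj' => by simp at hj'
      | some j => exact absurd ⟨hv, j, (GBShape.lead_of_leadIdx hj).le⟩ ‹¬ v ∈ reducibleVars sh›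
  · rw [Finset.sum_ite, Finset.sum_const_zero, add_zero, Finset.sum_const, smul_eq_mul,
      Set.ncard_eq_toFinset_card' (reducibleVars sh)]
    refine Nat.mul_le_mul_right _ (Finset.card_le_card fun v hv => ?_)
    simpa using hv

end Semantics

end ChangeOfOrdering

/-! ### Resolution of the Hankel systems and specification of the whole tree. -/

section ChangeOfOrdering

open MvPolynomial

theorem BMInv.hankel_inverse {K : Type u} [Field K] {s c q : ℕ → K} {D : ℕ} (hD : 0 < D)
    (H : BMInv s (2 * D - 1) D c q) : ∀ t < D, ∀ a < D, ∑ i ∈ Finset.range D,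
      hankelCol (fun i => c (D - i) - conv c s (2 * D - 1) * q (D - i)) (fun i => q (D - i))
        (D - 1) t i * s (i + a) = if a + t + 1 = D then 1 else 0 := by
  have h1 := @BMInv.hankel_recurrence _ _ _ _ _ _ H
  have h2 := @BMInv.hankel_last _ _ _ _ _ _ H
  obtain ⟨E, rfl⟩ := Nat.exists_eq_succ_of_ne_zero hD.ne'
  intro t ht a ha
  refine (sum_hankelCol (fun a ha => h1 ha) (fun a ha => (h2 ha).trans ?_) t ht a ha).trans ?_
  · exact if_congr (by omega) rfl rfl
  · exact if_congr (by omega) rfl rfl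

variable {k : Type u} [Field k] {ο : Type} {N m : ℕ}
  {t : CompTree k ((Fin N × Fin N) ⊕ (Fin N × Fin N)) (Fin N × Fin N)} {sh : GBShape (m + 1)}
  {K : Type u} [Field K] [Algebra k K] {μ : ℕ} {regs : List K}
  {T : Matrix (Fin sh.D) (Fin sh.D) K} {g : Fin sh.s → MvPolynomial (Fin (m + 1)) K}
  {r : Fin sh.D → K} {I : Ideal (MvPolynomial (Fin (m + 1)) K)}
  {h : Fin (m + 1) → Polynomial K}

theorem Runs.hankelInv' {ι : Type} {x : ι → K} {D : ℕ} (hD : 0 < D) {h u : ℕ → Operand k ι}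
    {vh vu : ℕ → K} (hh : ∀ i < D, Den x regs (h i) (vh i))
    (hu : ∀ i < D, Den x regs (u i) (vu i)) :
    Runs x regs (Prog.hankelInv (D - 1) h u : Prog k ι ο _) ((D - 1) * (D * 4)) fun r S =>
      ∀ t < D, ∀ i < D, Den x r (S t i) (hankelCol vh vu (D - 1) t i) := by
  obtain ⟨E, rfl⟩ := Nat.exists_eq_succ_of_ne_zero hD.ne'
  exact Runs.hankelInv hh hu

/-- A bound for the cost of the reduction of the variables that are leading monomials. -/
noncomputable def reduceCost (sh : GBShape (m + 1)) (μ : ℕ) : ℕ :=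
  if m + 1 ≤ sh.D then μ + (m + 1) * sh.D
  else (reducibleVars sh).ncard * (sh.D * (2 * sh.lowIdx.card + 1))

theorem Runs.reduce (H : IsDRLBasis I sh g) (ht : IsMulTree t K μ) (hN : sh.D ≤ N)
    {B : Fin sh.D → Fin sh.D → Operand k (ChgInput sh)} {b : Matrix (Fin sh.D) (Fin sh.D) K}
    (hB : ∀ i l, Den (chgInput sh T g r) regs (B i l) (b i l)) :
    Runs (chgInput sh T g r) regs
      (if m + 1 ≤ sh.D then Prog.reduceDense t sh B else Prog.reduceSparse sh B : Prog k _ ο _)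
      (reduceCost sh μ) fun rg F => ∀ v, v ≠ Fin.last m → ∀ j,
        sh.leadIdx (Finsupp.single v 1) = some j → ∀ i : Fin sh.D,
        Den (chgInput sh T g r) rg (F v i) (-∑ l, b i l * coeff (sh.basis l) (g j)) := by
  unfold reduceCost
  split_ifs with hm
  · exact Runs.reduceDense ht hN hm hB
  · exact Runs.reduceSparse H hB

theorem IsShape.coeff_eq (S : IsShape I sh.D h) (H : IsDRLBasis I sh g)
    (hD : 0 < sh.D) (hT : IsMultMatrix I sh (Fin.last m) T) {v : Fin (m + 1)}
    (hv : v ≠ Fin.last m) {z : ℕ → ℕ → K} (hz : ∀ t < sh.D, ∀ a < sh.D,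
      ∑ i ∈ Finset.range sh.D, z t i * wiedemannSeq sh T r (i + a)
        = if a + t + 1 = sh.D then 1 else 0) {c : Fin sh.D → K}
    (hc : ofCoords sh c - X v ∈ I) (i : Fin sh.D) :
    ((Matrix.of fun (a b : Fin sh.D) => z (sh.D - 1 - b) a) *
      (Matrix.of fun (i l : Fin sh.D) => (T.transpose ^ (i : ℕ)).mulVec r l)).mulVec c i
      = (h v).coeff i := by
  rw [← S.sum_eq H hD hT hv hc]
  exact congrFun (mulVec_hankelInv hz (h v).coeff) i

theorem Runs.solve (S : IsShape I sh.D h) (H : IsDRLBasis I sh g) (hD : 0 < sh.D)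
    (hT : IsMultMatrix I sh (Fin.last m) T) (ht : IsMulTree t K μ) (hN : 2 * sh.D ≤ N)
    {V : Fin sh.D → Fin (2 * sh.D) → Operand k (ChgInput sh)} {P : BMState k (ChgInput sh)}
    {c q : ℕ → K}
    (hV : ∀ i j, Den (chgInput sh T g r) regs (V i j) ((T.transpose ^ (j : ℕ)).mulVec r i))
    (hBM : BMInv (wiedemannSeq sh T r) (2 * sh.D - 1) sh.D c q)
    (hc : ∀ i < 2 * sh.D, Den (chgInput sh T g r) regs (P.2.1 i) (c i))
    (hq : ∀ i < 2 * sh.D, Den (chgInput sh T g r) regs (P.2.2 i) (q i)) :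
    Runs (chgInput sh T g r) regs (Prog.solve t sh V P : Prog k _ ο _)
      (2 * (2 * sh.D - 1 + 1) + (sh.D * 2 + ((sh.D - 1) * (sh.D * 4) +
        (μ + (reduceCost sh μ + 0))))) fun rg out =>
      ∀ e, Den (chgInput sh T g r) rg (out e) ((h e.1).coeff e.2) := by
  have hinv := hBM.hankel_inverse hD
  refine Runs.bind (Runs.conv (fun i hi => hc i (by omega))
    fun i hi => den_seqOp H hD hV i (by omega)) fun r₁ d h₁ hd => ?_
  refine Runs.bind (Runs.table fun i hi r' hr' =>
    Runs.subMul ((hc (sh.D - i) (by omega)).mono (h₁.trans hr')) (hd.mono hr')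
      ((hq (sh.D - i) (by omega)).mono (h₁.trans hr'))) fun r₂ hh h₂ hhh => ?_
  refine Runs.bind (Runs.hankelInv' hD hhh
    fun i hi => (hq (sh.D - i) (by omega)).mono (h₁.trans h₂)) fun r₃ Z h₃ hZ => ?_
  refine Runs.bind (Runs.mul ht (by omega) (by omega) (by omega)
    (a := Matrix.of fun (a b : Fin sh.D) => hankelCol _ _ (sh.D - 1) (sh.D - 1 - b) a)
    (b := Matrix.of fun (i l : Fin sh.D) => (T.transpose ^ (i : ℕ)).mulVec r l)
    (fun a b => hZ (sh.D - 1 - b) (by omega) a a.2)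
    (fun i l => (hV l ⟨i, by omega⟩).mono ((h₁.trans h₂).trans h₃))) fun r₄ B h₄ hB => ?_
  refine Runs.bind (Runs.reduce H ht (by omega) hB) fun r₅ F h₅ hF => Runs.pure ?_
  rintro ⟨v, i⟩
  dsimp only
  split_ifs with hv
  · subst hv
    rw [← S.coeff_last_eq H hD hT (not_hankelSingular hinv)
      (fun a ha => hBM.hankel_recurrence ha) i.2]
    exact (hhh i i.2).mono ((h₃.trans h₄).trans h₅)
  -- If x_v is a basis monomial, its coordinates form a unit vector and the answer is a column of
  -- the inverse of B; otherwise x_v is a leading monomial.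
  · cases hl : sh.basisIdx (Finsupp.single v 1) with
    | some l =>
      rw [← S.coeff_eq H hD hT hv hinv (c := Pi.single l 1) ?_ i, Matrix.mulVec_single_one]
      · exact (hB i l).mono h₅
      · rw [IsDRLBasis.ofCoords_single, GBShape.basis_of_basisIdx hl]
        simp [X]
    | none =>
      have hlead : ∃ j, sh.lead j = Finsupp.single v 1 := by
        refine (H.exists_basis_or_lead hD v).resolve_left fun hcon => ?_
        obtain ⟨l, hl'⟩ := GBShape.exists_basisIdx hcon
        rw [hl] at hl'
        simp at hl'
      obtain ⟨j, hj⟩ := GBShape.exists_leadIdx hlead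
      rw [← S.coeff_eq H hD hT hv hinv (c := fun i => - coeff (sh.basis i) (g j)) ?_ i]
      · simp only [Matrix.mulVec, dotProduct, mul_neg, Finset.sum_neg_distrib]
        exact hF v hv j hj i
      · rw [H.ofCoords_coeff, GBShape.lead_of_leadIdx hj]
        have : g j ∈ I := H.isReducedGB.subset ⟨j, rfl⟩
        simpa [X] using this

/-- A bound for the cost of the change of ordering. -/
noncomputable def changeCost (sh : GBShape (m + 1)) (μ : ℕ) : ℕ :=
  -- Two products per doubling step and one for Z R; 34 D² covers Berlekamp–Massey, the last
  -- correction and the inverse Hankel matrix.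
  (2 * Nat.clog 2 (2 * sh.D) + 1) * μ + 34 * sh.D ^ 2 + reduceCost sh μ

/-- Length D gives an explicit inverse of the Hankel matrix, and any other length a kernel vector,
so the free comparison of the length with D decides failure exactly. -/
theorem changeTree_spec (S : IsShape I sh.D h) (H : IsDRLBasis I sh g) (hD : 0 < sh.D)
    (hT : IsMultMatrix I sh (Fin.last m) T) (ht : IsMulTree t K μ) (hN : 2 * sh.D ≤ N)
    (r : Fin sh.D → K) :
    ((HankelSingular (wiedemannSeq sh T r) sh.D ∧
        (changeTree t sh).result (chgInput sh T g r) = none) ∨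
      (¬ HankelSingular (wiedemannSeq sh T r) sh.D ∧
        (changeTree t sh).result (chgInput sh T g r) = some fun e => (h e.1).coeff e.2)) ∧
    (changeTree t sh).cost (chgInput sh T g r) ≤ changeCost sh μ := by
  obtain ⟨rg, P, c₁, -, hc₁, ⟨hV, c, q, hBM, hc, hq⟩, hrun⟩ :=
    Runs.krylovBM (regs := []) (r := r) (T := T) (ο := Fin (m + 1) × Fin sh.D) ht hN H hD
  have hE : ∃ E, sh.D = E + 1 := Nat.exists_eq_succ_of_ne_zero hD.ne'
  have hcost : Nat.clog 2 (2 * sh.D) * (2 * μ) + (2 * sh.D - 1) * (6 * (2 * sh.D)) +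
      (2 * (2 * sh.D - 1 + 1) + (sh.D * 2 + ((sh.D - 1) * (sh.D * 4) +
        (μ + (reduceCost sh μ + 0))))) ≤ changeCost sh μ := by
    unfold changeCost
    generalize reduceCost sh μ = ρ
    generalize Nat.clog 2 (2 * sh.D) = ℓ
    obtain ⟨E, hE⟩ := hE
    rw [hE, show 2 * (E + 1) - 1 = 2 * E + 1 by omega, show E + 1 - 1 = E by omega]
    nlinarith
  simp only [CompTree.result, CompTree.cost, changeTree, if_neg hD.ne']
  have hrun' := hrun fun N₁ P => if P.2.1 = sh.D then
    Prog.solve t sh P.1 P.2 N₁ fun _ out => .ret out else .fail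
  rw [List.length_nil] at hrun'
  rw [hrun']
  by_cases hL : P.2.1 = sh.D
  · rw [hL] at hBM
    simp only [if_pos hL]
    obtain ⟨rg', out, c₂, -, hc₂, hout, hrun₂⟩ :=
      Runs.solve (ο := Fin (m + 1) × Fin sh.D) S H hD hT ht hN hV hBM hc hq
    rw [hrun₂]
    refine ⟨Or.inr ⟨not_hankelSingular (hBM.hankel_inverse hD), ?_⟩, ?_⟩
    · simp only [CompTree.runFrom, Option.some.injEq]
      funext e
      exact (hout e).val_eq
    · simp only [CompTree.runFrom]
      omega
  · simp only [if_neg hL]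
    refine ⟨Or.inl ⟨hBM.hankelSingular hD hL, rfl⟩, ?_⟩
    simp only [CompTree.runFrom]
    omega

end ChangeOfOrdering

/-! ## Bézout's bound for an ideal in Shape Position -/

section Bezout

open MvPolynomial

theorem sum_choose_antidiag (n B : ℕ) :
    ∑ i ∈ Finset.range (B + 1), (n + i - 1).choose i = (n + B).choose B := by
  induction B with
  | zero => simp
  | succ B ih =>
    rw [Finset.sum_range_succ, ih, show n + (B + 1) - 1 = n + B by omega, ← add_assoc,
      Nat.choose_succ_succ]

/-- The dimension of the space of jets divided by D: a monomial of degree j in n variables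
contributes M - j. -/
theorem sum_choose_mul (n M : ℕ) :
    ∑ j ∈ Finset.range M, (n + j - 1).choose j * (M - j) = (n + M).choose (n + 1) := by
  induction M with
  | zero => simp
  | succ M ih =>
    have h1 : ∑ j ∈ Finset.range M, (n + j - 1).choose j * (M + 1 - j)
        = ∑ j ∈ Finset.range M, (n + j - 1).choose j * (M - j)
          + ∑ j ∈ Finset.range M, (n + j - 1).choose j := by
      rw [← Finset.sum_add_distrib]
      refine Finset.sum_congr rfl fun j hj => ?_
      rw [Nat.succ_sub (Finset.mem_range.1 hj).le, Nat.mul_succ]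
    have h2 := sum_choose_antidiag n M
    rw [Finset.sum_range_succ] at h2
    have h3 : (n + M).choose M = (n + M).choose n := by
      rw [Nat.choose_symm_add]
    rw [Finset.sum_range_succ, h1, ih, Nat.add_sub_cancel_left, mul_one, add_assoc, h2, h3,
      ← add_assoc, Nat.choose_succ_succ, add_comm]

/-- Divide by M^n and let M tend to infinity. -/
theorem le_pow_of_forall_mul_pow_le {D d n e : ℕ}
    (h : ∀ M : ℕ, D * M ^ n ≤ (d * M + e) ^ n) : D ≤ d ^ n := by
  have h1 : Filter.Tendsto (fun M : ℕ => ((d : ℝ) + e / M) ^ n) Filter.atTop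
      (nhds (((d : ℝ) + 0) ^ n)) :=
    (tendsto_const_nhds.add (tendsto_const_div_atTop_nhds_zero_nat (e : ℝ))).pow n
  rw [add_zero] at h1
  have h2 : (D : ℝ) ≤ (d : ℝ) ^ n := by
    refine ge_of_tendsto h1 (Filter.eventually_atTop.2 ⟨1, fun M hM => ?_⟩)
    have hM' : (0 : ℝ) < M := by exact_mod_cast hM
    have h3 : (D : ℝ) * M ^ n ≤ (d * M + e) ^ n := by exact_mod_cast h M
    rw [← div_le_div_iff_of_pos_right (pow_pos hM' n), mul_div_cancel_right₀ _ (by positivity),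
      ← div_pow] at h3
    convert h3 using 2
    field_simp
  exact_mod_cast h2

variable {K : Type u} [Field K]

/-- The exponent vectors of degree less than `B`, sorted by degree. -/
abbrev ExpLT (n B : ℕ) : Type :=
  (i : Fin B) × (Finset.finsuppAntidiag (Finset.univ : Finset (Fin n)) (i : ℕ))

theorem ExpLT.degree_eq {n B : ℕ} (a : ExpLT n B) : a.2.1.degree = a.1 := by
  have := (Finset.mem_finsuppAntidiag.1 a.2.2).1
  rwa [Finsupp.degree_eq_sum]

theorem ExpLT.ext_val {n B : ℕ} {a b : ExpLT n B} (h : a.2.1 = b.2.1) : a = b := by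
  obtain ⟨i, a⟩ := a
  obtain ⟨j, b⟩ := b
  have h1 : (i : ℕ) = j := by
    rw [← ExpLT.degree_eq ⟨i, a⟩, ← ExpLT.degree_eq ⟨j, b⟩]
    exact congrArg _ h
  obtain rfl := Fin.ext h1
  simp only at h
  rw [Subtype.ext h]

theorem ExpLT.card (n B : ℕ) : Fintype.card (ExpLT n (B + 1)) = (n + B).choose B := by
  rw [Fintype.card_sigma, ← sum_choose_antidiag, ← Fin.sum_univ_eq_sum_range
    (fun i => (n + i - 1).choose i)]
  simp [Finset.card_finsuppAntidiag_nat_eq_choose]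

namespace IsShape

variable {m D : ℕ} {I : Ideal (MvPolynomial (Fin (m + 1)) K)} {h : Fin (m + 1) → Polynomial K}

theorem exists_univariate (S : IsShape I D h) (f : MvPolynomial (Fin (m + 1)) K) :
    ∃ q : Polynomial K, f - Polynomial.aeval (X (Fin.last m)) q ∈ I := by
  induction f using MvPolynomial.induction_on with
  | C a => exact ⟨Polynomial.C a, by simp [algebraMap_eq]⟩
  | add f f' hf hf' =>
    obtain ⟨q, hq⟩ := hf
    obtain ⟨q', hq'⟩ := hf'
    refine ⟨q + q', ?_⟩
    rw [map_add, add_sub_add_comm]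
    exact I.add_mem hq hq'
  | mul_X f v hf =>
    obtain ⟨q, hq⟩ := hf
    rcases eq_or_ne v (Fin.last m) with rfl | hv
    · refine ⟨q * Polynomial.X, ?_⟩
      rw [map_mul, Polynomial.aeval_X, ← sub_mul]
      exact I.mul_mem_right _ hq
    · refine ⟨q * h v, ?_⟩
      have h1 := I.add_mem (I.mul_mem_right (X v) hq)
        (I.mul_mem_left (Polynomial.aeval (X (Fin.last m)) q) (S.sub_mem hv))
      rw [map_mul]
      convert h1 using 1
      ring

theorem totalDegree_aeval_X_le {σ : Type*} (v : σ) (q : Polynomial K) :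
    (Polynomial.aeval (X v : MvPolynomial σ K) q).totalDegree ≤ q.natDegree := by
  rw [Polynomial.aeval_eq_sum_range]
  refine (totalDegree_finsetSum _ _).trans (Finset.sup_le fun i hi => ?_)
  refine (totalDegree_smul_le _ _).trans ?_
  rw [totalDegree_X_pow]
  exact Nat.lt_succ_iff.1 (Finset.mem_range.1 hi)

/-- Every class is that of a polynomial in x_m alone, which can be divided by the last polynomial.
-/
theorem exists_low_degree (S : IsShape I D h) (f : MvPolynomial (Fin (m + 1)) K) :
    ∃ p ∈ restrictTotalDegree (Fin (m + 1)) K D, f - p ∈ I := by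
  obtain ⟨q, hq⟩ := S.exists_univariate f
  refine ⟨Polynomial.aeval (X (Fin.last m)) (q %ₘ h (Fin.last m)), ?_, ?_⟩
  · rw [mem_restrictTotalDegree]
    refine (totalDegree_aeval_X_le _ _).trans ((Polynomial.natDegree_modByMonic_le q S.monic).trans
      S.natDegree_last.le)
  · have h1 := I.add_mem hq (I.mul_mem_right
      (Polynomial.aeval (X (Fin.last m)) (q /ₘ h (Fin.last m))) S.last_mem)
    have h2 := congrArg (Polynomial.aeval (X (Fin.last m) : MvPolynomial (Fin (m + 1)) K))
      (Polynomial.modByMonic_add_div q (h (Fin.last m)))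
    rw [map_add, map_mul] at h2
    rw [← h2] at h1
    convert h1 using 1
    ring

variable {F : Set (MvPolynomial (Fin (m + 1)) K)} {d : ℕ}

/-- Induction on M: a product of a generator of degree at most d with p + b', where p has low degree
and b' lies in I^(M+1), has one part whose degree bound grows by d and another in I^(M+2). -/
theorem pow_le_sup (S : IsShape I D h) (hF : Ideal.span F = I)
    (hd : ∀ f ∈ F, f.totalDegree ≤ d) (M : ℕ) : (I ^ M).restrictScalars K ≤
      restrictTotalDegree (Fin (m + 1)) K (d * M + D) ⊔ (I ^ (M + 1)).restrictScalars K := by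
  induction M with
  | zero =>
    intro f _
    obtain ⟨p, hp, hfp⟩ := S.exists_low_degree f
    rw [mul_zero, zero_add, zero_add, pow_one]
    exact Submodule.mem_sup.2 ⟨p, hp, f - p, hfp, by ring⟩
  | succ M ih =>
    set W := restrictTotalDegree (Fin (m + 1)) K (d * (M + 1) + D) ⊔
      (I ^ (M + 1 + 1)).restrictScalars K with hW
    have h1 : ∀ a ∈ Ideal.span F, ∀ b ∈ I ^ M, a * b ∈ W := by
      intro a ha
      induction ha using Submodule.span_induction with
      | mem f hf =>
        intro b hb
        obtain ⟨p, hp, b', hb', rfl⟩ := Submodule.mem_sup.1 (ih hb)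
        rw [mul_add]
        refine Submodule.add_mem_sup ?_ ?_
        · rw [mem_restrictTotalDegree] at hp ⊢
          refine (totalDegree_mul _ _).trans ((add_le_add (hd f hf) hp).trans ?_)
          rw [mul_add, mul_one]
          omega
        · rw [Submodule.restrictScalars_mem, pow_succ']
          exact Ideal.mul_mem_mul (hF ▸ Ideal.subset_span hf) hb'
      | zero => intro b _; rw [zero_mul]; exact W.zero_mem
      | add a a' _ _ ha ha' =>
        intro b hb; rw [add_mul]; exact W.add_mem (ha b hb) (ha' b hb)
      | smul c a _ ha =>
        intro b hb
        -- A polynomial multiplier would spoil the degree bound, so it is absorbed into the factor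
        -- in I^M.
        rw [smul_eq_mul, mul_comm c, mul_assoc]
        exact ha _ (Ideal.mul_mem_left _ c hb)
    intro f hf
    rw [Submodule.restrictScalars_mem, pow_succ'] at hf
    refine Submodule.mul_induction_on hf (fun a ha b hb => h1 a (hF ▸ ha) b hb)
      fun a b ha hb => W.add_mem ha hb

theorem exists_low_degree_pow (S : IsShape I D h) (hF : Ideal.span F = I)
    (hd : ∀ f ∈ F, f.totalDegree ≤ d) (M : ℕ) (f : MvPolynomial (Fin (m + 1)) K) :
    ∃ p ∈ restrictTotalDegree (Fin (m + 1)) K (d * M + D), f - p ∈ I ^ M := by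
  have h1 : ∀ M, f ∈ restrictTotalDegree (Fin (m + 1)) K (d * M + D) ⊔
      (I ^ M).restrictScalars K := by
    intro M
    induction M with
    | zero => exact Submodule.mem_sup_right (by simp)
    | succ M ih =>
      have hmono : restrictTotalDegree (Fin (m + 1)) K (d * M + D) ≤
          restrictTotalDegree (Fin (m + 1)) K (d * (M + 1) + D) := fun p hp => by
        rw [mem_restrictTotalDegree] at hp ⊢
        refine hp.trans ?_
        rw [mul_add]
        omega
      have h2 := sup_le (le_refl (restrictTotalDegree (Fin (m + 1)) K (d * M + D)) |>.trans
        le_sup_left) (S.pow_le_sup hF hd M) ih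
      exact sup_le_sup_right hmono _ h2
  obtain ⟨p, hp, q, hq, hpq⟩ := Submodule.mem_sup.1 (h1 M)
  exact ⟨p, hp, by rw [← hpq, add_sub_cancel_left]; exact hq⟩

/-- The change of variables `x_v ↦ x_v + h_v(x_m)`. -/
noncomputable def straighten (h : Fin (m + 1) → Polynomial K) :
    MvPolynomial (Fin (m + 1)) K →ₐ[K] MvPolynomial (Fin m) (Polynomial K) :=
  aeval (Fin.lastCases (C Polynomial.X) fun v => X v + C (h v.castSucc))

theorem straighten_aeval (q : Polynomial K) :
    straighten h (Polynomial.aeval (X (Fin.last m)) q) = C q := by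
  rw [← Polynomial.aeval_algHom_apply]
  have h1 : straighten h (X (Fin.last m)) = C Polynomial.X := by simp [straighten]
  rw [h1]
  induction q using Polynomial.induction_on' with
  | add p q hp hq => rw [map_add, hp, hq, map_add]
  | monomial n a =>
    rw [Polynomial.aeval_monomial, ← map_pow, ← Polynomial.C_mul_X_pow_eq_monomial, map_mul]
    rfl

theorem straighten_X_sub (v : Fin m) :
    straighten h (X v.castSucc - Polynomial.aeval (X (Fin.last m)) (h v.castSucc)) = X v := by
  rw [map_sub, straighten_aeval]
  simp [straighten]

theorem straighten_surjective : Function.Surjective (straighten h) := by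
  intro f
  induction f using MvPolynomial.induction_on with
  | C q => exact ⟨_, straighten_aeval q⟩
  | add f f' hf hf' =>
    obtain ⟨a, rfl⟩ := hf
    obtain ⟨b, rfl⟩ := hf'
    exact ⟨a + b, map_add _ _ _⟩
  | mul_X f v hf =>
    obtain ⟨a, rfl⟩ := hf
    exact ⟨a * (X v.castSucc - Polynomial.aeval (X (Fin.last m)) (h v.castSucc)),
      by rw [map_mul, straighten_X_sub]⟩

/-- In the new coordinates `I` is generated by the new variables and the last polynomial. A product
of M generators whose monomial in the new variables has degree |a| contains at least M - |a| copies
of the last polynomial. -/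
theorem pow_dvd_coeff (S : IsShape I D h) (M : ℕ) :
    ∀ f ∈ I ^ M, ∀ a, h (Fin.last m) ^ (M - a.degree) ∣ coeff a (straighten h f) := by
  induction M with
  | zero => intro f _ a; simp
  | succ M ih =>
    have h1 : ∀ y ∈ Ideal.span (shapeBasis h), ∀ b ∈ I ^ M, ∀ a,
        h (Fin.last m) ^ (M + 1 - a.degree) ∣ coeff a (straighten h (y * b)) := by
      intro y hy
      induction hy using Submodule.span_induction with
      | mem y hy =>
        obtain ⟨v, rfl⟩ := hy
        intro b hb a
        rw [map_mul]
        induction v using Fin.lastCases with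
        | last =>
          beta_reduce
          rw [if_pos rfl, straighten_aeval, coeff_C_mul]
          refine (pow_dvd_pow _ (by omega : M + 1 - a.degree ≤ (M - a.degree) + 1)).trans ?_
          rw [pow_succ']
          exact mul_dvd_mul_left _ (ih b hb a)
        | cast v =>
          beta_reduce
          rw [if_neg (Fin.castSucc_lt_last v).ne, straighten_X_sub, mul_comm, coeff_mul_X']
          split_ifs with hv
          · refine (pow_dvd_pow _ ?_).trans (ih b hb (a - Finsupp.single v 1))
            have h2 : (a - Finsupp.single v 1) + Finsupp.single v 1 = a := by
              refine tsub_add_cancel_of_le ?_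
              rw [Finsupp.single_le_iff]
              exact Nat.one_le_iff_ne_zero.2 (Finsupp.mem_support_iff.1 hv)
            have h3 := congrArg Finsupp.degree h2
            rw [map_add, Finsupp.degree_single] at h3
            omega
          · exact dvd_zero _
      | zero => intro b _ a; simp
      | add y y' _ _ hy hy' =>
        intro b hb a
        rw [add_mul, map_add, coeff_add]
        exact dvd_add (hy b hb a) (hy' b hb a)
      | smul c y _ hy =>
        intro b hb a
        rw [smul_eq_mul, mul_comm c, mul_assoc]
        exact hy _ (Ideal.mul_mem_left _ c hb) a
    intro f hf
    rw [pow_succ'] at hf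
    refine Submodule.mul_induction_on hf
      (fun y hy b hb => h1 y (S.gb.span_eq.symm ▸ hy) b hb) fun x y hx hy a => ?_
    rw [map_add, coeff_add]
    exact dvd_add (hx a) (hy a)

/-- The truncated coefficients after the change of variables `straighten`. -/
noncomputable def jets (h : Fin (m + 1) → Polynomial K) (M : ℕ) :
    MvPolynomial (Fin (m + 1)) K →ₗ[K] ((a : ExpLT m M) →
      Polynomial K ⧸ Ideal.span {h (Fin.last m) ^ (M - (a.1 : ℕ))}) :=
  LinearMap.pi fun a => (Ideal.Quotient.mkₐ K _).toLinearMap ∘ₗ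
    ((lcoeff (Polynomial K) a.2.1).restrictScalars K) ∘ₗ (straighten h).toLinearMap

theorem jets_apply (M : ℕ) (f : MvPolynomial (Fin (m + 1)) K) (a : ExpLT m M) :
    jets h M f a = Ideal.Quotient.mk _ (coeff a.2.1 (straighten h f)) := rfl

theorem jets_surjective (M : ℕ) : Function.Surjective (jets h M) := by
  classical
  intro y
  choose c hc using fun a => Ideal.Quotient.mk_surjective (y a)
  obtain ⟨f, hf⟩ := straighten_surjective (h := h) (∑ a : ExpLT m M, monomial a.2.1 (c a))
  refine ⟨f, funext fun a => ?_⟩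
  rw [jets_apply, hf, coeff_sum, Finset.sum_eq_single a, coeff_monomial, if_pos rfl, hc]
  · intro b _ hb
    rw [coeff_monomial, if_neg fun h => hb (ExpLT.ext_val h)]
  · simp

theorem jets_eq_zero (S : IsShape I D h) {M : ℕ} {f : MvPolynomial (Fin (m + 1)) K}
    (hf : f ∈ I ^ M) : jets h M f = 0 := by
  funext a
  rw [jets_apply, Pi.zero_apply, Ideal.Quotient.eq_zero_iff_mem, Ideal.mem_span_singleton]
  have h1 := S.pow_dvd_coeff M f hf a.2.1
  rwa [ExpLT.degree_eq a] at h1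

/-- The jet map is onto and kills I^M, so its restriction to polynomials of degree at most dM + D is
still onto; compare dimensions. -/
theorem mul_choose_le (S : IsShape I D h) (hF : Ideal.span F = I)
    (hd : ∀ f ∈ F, f.totalDegree ≤ d) (M : ℕ) :
    D * (m + M).choose (m + 1) ≤ (m + 1 + (d * M + D)).choose (d * M + D) := by
  classical
  set B := d * M + D with hB
  let L : (ExpLT (m + 1) (B + 1) → K) →ₗ[K] MvPolynomial (Fin (m + 1)) K :=
    ∑ a, (monomial a.2.1) ∘ₗ LinearMap.proj a
  have hL : ∀ p ∈ restrictTotalDegree (Fin (m + 1)) K B, p ∈ LinearMap.range L := by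
    intro p hp
    rw [mem_restrictTotalDegree] at hp
    rw [p.as_sum]
    refine Submodule.sum_mem _ fun t ht => ?_
    have ht' : t.degree ≤ B := (le_totalDegree ht).trans hp
    let a : ExpLT (m + 1) (B + 1) := ⟨⟨t.degree, by omega⟩, ⟨t, by
      rw [Finset.mem_finsuppAntidiag]
      exact ⟨(Finsupp.degree_eq_sum t).symm, Finset.subset_univ _⟩⟩⟩
    refine ⟨Pi.single a (coeff t p), ?_⟩
    simp only [L, LinearMap.sum_apply, LinearMap.comp_apply, LinearMap.proj_apply]
    rw [Finset.sum_eq_single a]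
    · simp [a]
    · intro b _ hb; simp [Pi.single_eq_of_ne hb]
    · simp
  have hsurj : Function.Surjective (jets h M ∘ₗ L) := by
    intro y
    obtain ⟨f, rfl⟩ := jets_surjective M y
    obtain ⟨p, hp, hfp⟩ := S.exists_low_degree_pow hF hd M f
    obtain ⟨c, rfl⟩ := hL p hp
    refine ⟨c, ?_⟩
    have := S.jets_eq_zero hfp
    rw [map_sub, sub_eq_zero] at this
    exact this.symm
  have hfin : ∀ a : ExpLT m M, Module.Finite K
      (Polynomial K ⧸ Ideal.span {h (Fin.last m) ^ (M - (a.1 : ℕ))}) := fun a =>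
    (S.monic.pow _).finite_quotient
  have h1 := LinearMap.finrank_le_finrank_of_surjective hsurj
  rw [Module.finrank_fintype_fun_eq_card, ExpLT.card, Module.finrank_pi_fintype] at h1
  refine le_trans (le_of_eq ?_) h1
  have h2 : ∀ a : ExpLT m M, Module.finrank K
      (Polynomial K ⧸ Ideal.span {h (Fin.last m) ^ (M - (a.1 : ℕ))}) = (M - a.1) * D := fun a => by
    rw [finrank_quotient_span_eq_natDegree, S.monic.natDegree_pow, S.natDegree_last]
  rw [Finset.sum_congr rfl fun a _ => h2 a, Fintype.sum_sigma]
  simp only [Finset.sum_const, Finset.card_univ, Fintype.card_coe,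
    Finset.card_finsuppAntidiag_nat_eq_choose, Fintype.card_fin, smul_eq_mul]
  rw [Fin.sum_univ_eq_sum_range (fun i => (m + i - 1).choose i * ((M - i) * D)),
    ← sum_choose_mul, Finset.mul_sum]
  exact Finset.sum_congr rfl fun i _ => by ring

/-- **Bézout's bound**: an ideal in Shape Position that is generated by polynomials of degree at
most `d` has at most `d ^ n` solutions, counted with multiplicities. -/
theorem le_pow (S : IsShape I D h) (hF : Ideal.span F = I)
    (hd : ∀ f ∈ F, f.totalDegree ≤ d) : D ≤ d ^ (m + 1) := by
  refine le_pow_of_forall_mul_pow_le (e := D + (m + 1)) fun M => ?_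
  have h1 := S.mul_choose_le hF hd M
  rw [show (m + 1 + (d * M + D)).choose (d * M + D) = (m + 1 + (d * M + D)).choose (m + 1) from
    by rw [Nat.choose_symm_add]] at h1
  -- Multiplied by (m + 1)!, both binomials become falling factorials; one is at least M^(m+1), the
  -- other at most (dM + D + m + 1)^(m+1).
  have h2 := Nat.pow_sub_le_descFactorial (m + M) (m + 1)
  have h3 := Nat.descFactorial_le_pow (m + 1 + (d * M + D)) (m + 1)
  rw [Nat.descFactorial_eq_factorial_mul_choose] at h2 h3
  rw [show m + M + 1 - (m + 1) = M by omega] at h2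
  calc D * M ^ (m + 1) ≤ D * ((m + 1).factorial * (m + M).choose (m + 1)) :=
        Nat.mul_le_mul_left _ h2
    _ = (m + 1).factorial * (D * (m + M).choose (m + 1)) := by ring
    _ ≤ _ := Nat.mul_le_mul_left _ h1
    _ ≤ _ := h3
    _ = _ := by congr 1; ring

end IsShape

end Bezout

/-! ## Probability of failure -/

section Probability

open MvPolynomial

variable {K : Type u} [Field K]

theorem hankelSingular_iff_det {s : ℕ → K} {D : ℕ} :
    HankelSingular s D ↔ (Matrix.of fun i j : Fin D => s (i + j)).det = 0 := by
  rw [← Matrix.exists_mulVec_eq_zero_iff]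
  constructor
  · rintro ⟨a, ⟨l, hl, hal⟩, ha⟩
    refine ⟨fun i => a i, fun h => hal (congrFun h ⟨l, hl⟩), funext fun b => ?_⟩
    rw [Pi.zero_apply, ← ha b b.2, ← Fin.sum_univ_eq_sum_range (fun i => a i * s (i + b))]
    simp only [Matrix.mulVec, dotProduct, Matrix.of_apply]
    exact Finset.sum_congr rfl fun i _ => by rw [mul_comm, add_comm (b : ℕ)]
  · rintro ⟨v, hv, hv0⟩
    obtain ⟨l, hl⟩ := Function.ne_iff.1 hv
    refine ⟨fun i => if hi : i < D then v ⟨i, hi⟩ else 0, ⟨l, l.2, by simpa using hl⟩,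
      fun b hb => ?_⟩
    have h1 := congrFun hv0 ⟨b, hb⟩
    simp only [Matrix.mulVec, dotProduct, Matrix.of_apply, Pi.zero_apply] at h1
    refine ((Fin.sum_univ_eq_sum_range
      (fun i => (if hi : i < D then v ⟨i, hi⟩ else 0) * s (i + b)) D).symm.trans
        (Finset.sum_congr rfl fun i _ => ?_)).trans h1
    rw [dif_pos i.2, mul_comm, add_comm]

/-- The determinant of the Hankel matrix of the Wiedemann sequence, as a polynomial in the entries
of the random vector. -/
noncomputable def hankelDet {n : ℕ} (sh : GBShape n) (T : Matrix (Fin sh.D) (Fin sh.D) K) :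
    MvPolynomial (Fin sh.D) K :=
  (Matrix.of fun i j : Fin sh.D =>
    ∑ l, X l * C ((T ^ (i + j : ℕ)).mulVec (oneCoords sh K) l)).det

theorem eval_hankelDet {n : ℕ} (sh : GBShape n) (T : Matrix (Fin sh.D) (Fin sh.D) K)
    (r : Fin sh.D → K) : eval r (hankelDet sh T) =
      (Matrix.of fun i j : Fin sh.D => wiedemannSeq sh T r (i + j)).det := by
  rw [hankelDet, RingHom.map_det]
  congr 1
  ext i j
  simp [wiedemannSeq, dotProduct]
  rfl

/-- Each of the D factors in a term of the determinant is a linear form in the random vector. -/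
theorem totalDegree_hankelDet_le {n : ℕ} (sh : GBShape n) (T : Matrix (Fin sh.D) (Fin sh.D) K) :
    (hankelDet sh T).totalDegree ≤ sh.D := by
  rw [hankelDet, Matrix.det_apply']
  refine (totalDegree_finsetSum _ _).trans (Finset.sup_le fun σ _ => ?_)
  refine (totalDegree_mul _ _).trans ?_
  have h1 : totalDegree (((Equiv.Perm.sign σ : ℤ) : MvPolynomial (Fin sh.D) K)) = 0 := by
    rw [← map_intCast (C : K →+* MvPolynomial (Fin sh.D) K), totalDegree_C]
  rw [h1, zero_add]
  have h2 : ∀ w : Fin sh.D → K,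
      (∑ l, X l * C (w l) : MvPolynomial (Fin sh.D) K).totalDegree ≤ 1 := fun w =>
    totalDegree_finsetSum_le fun l _ => (totalDegree_mul _ _).trans
      (by rw [totalDegree_X, totalDegree_C])
  refine (totalDegree_finsetProd _ _).trans ?_
  calc _ ≤ ∑ _i : Fin sh.D, 1 := Finset.sum_le_sum fun i _ => h2 _
    _ = sh.D := by simp

theorem uniformProb_hankelSingular_le {n : ℕ} {sh : GBShape n}
    {T : Matrix (Fin sh.D) (Fin sh.D) K}
    (h : ∃ r, ¬ HankelSingular (wiedemannSeq sh T r) sh.D) (S : Finset K) :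
    uniformProb S (fun r => HankelSingular (wiedemannSeq sh T r) sh.D)
      ≤ (sh.D : ℝ) / S.card := by
  classical
  have hiff : ∀ r, HankelSingular (wiedemannSeq sh T r) sh.D ↔ eval r (hankelDet sh T) = 0 :=
    fun r => by rw [hankelSingular_iff_det, eval_hankelDet]
  have h0 : hankelDet sh T ≠ 0 := by
    rintro h0
    obtain ⟨r, hr⟩ := h
    exact hr ((hiff r).2 (by rw [h0, map_zero]))
  have h1 := schwartz_zippel_totalDegree h0 S
  have h2 : ((Finset.card {f ∈ Fintype.piFinset fun _ => S | eval f (hankelDet sh T) = 0} : ℝ)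
      / (S.card : ℝ) ^ sh.D) ≤ ((hankelDet sh T).totalDegree : ℝ) / S.card := by
    have := (NNRat.cast_le (K := ℝ)).2 h1
    push_cast at this
    exact this
  have h3 : uniformProb S (fun r => HankelSingular (wiedemannSeq sh T r) sh.D) =
      ((Finset.card {f ∈ Fintype.piFinset fun _ => S | eval f (hankelDet sh T) = 0} : ℝ)
      / (S.card : ℝ) ^ sh.D) := by
    unfold uniformProb
    congr 3
    exact Finset.filter_congr fun r _ => hiff r
  rw [h3]
  refine h2.trans ?_
  gcongr
  exact totalDegree_hankelDet_le sh T

end Probability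

/-! ## Bounds for the cost -/

section Cost

variable {K : Type u} [Field K] {m : ℕ} {I : Ideal (MvPolynomial (Fin (m + 1)) K)}
  {sh : GBShape (m + 1)} {g : Fin sh.s → MvPolynomial (Fin (m + 1)) K}

theorem ncard_reducibleVars_le (sh : GBShape (m + 1)) : (reducibleVars sh).ncard ≤ m + 1 := by
  simpa using Set.ncard_le_card (reducibleVars sh)

theorem IsDRLBasis.ncard_irreducibleVars_le (H : IsDRLBasis I sh g) :
    (irreducibleVars sh).ncard ≤ sh.D := by
  have h1 : (fun v => Finsupp.single v 1) '' irreducibleVars sh ⊆ Set.range sh.basis := by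
    rw [H.range_basis]
    rintro _ ⟨v, hv, rfl⟩
    exact hv.2
  rw [← Set.ncard_image_of_injective _ (Finsupp.single_left_injective (one_ne_zero (α := ℕ)))]
  refine (Set.ncard_le_ncard h1 (Set.finite_range _)).trans ?_
  rw [← Set.image_univ]
  refine (Set.ncard_image_le).trans ?_
  simp

theorem eq_zero_or_single_of_degree_le_one {n : ℕ} {a : Fin n →₀ ℕ} (ha : a.degree ≤ 1) :
    a = 0 ∨ ∃ v, a = Finsupp.single v 1 := by
  rcases eq_or_ne a 0 with h0 | h0
  · exact Or.inl h0
  · obtain ⟨v, hv⟩ := Finsupp.ne_iff.1 h0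
    have h1 : Finsupp.single v 1 ≤ a := by
      rw [Finsupp.single_le_iff]
      exact Nat.one_le_iff_ne_zero.2 hv
    obtain ⟨b, rfl⟩ := exists_add_of_le h1
    rw [map_add, Finsupp.degree_single] at ha
    have hb : b = 0 := by rw [← Finsupp.degree_eq_zero_iff]; omega
    exact Or.inr ⟨v, by rw [hb, add_zero]⟩

/-- Besides the irreducible variables before the last one, only 1 and x_m can have degree at most 1.
-/
theorem IsDRLBasis.card_lowIdx_le (H : IsDRLBasis I sh g) :
    sh.lowIdx.card ≤ (irreducibleVars sh).ncard + 2 := by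
  classical
  have h1 : sh.basis '' sh.lowIdx ⊆ (fun v => Finsupp.single v 1) '' irreducibleVars sh ∪
      {0, Finsupp.single (Fin.last m) 1} := by
    rintro _ ⟨i, hi, rfl⟩
    have hi' : (sh.basis i).degree ≤ 1 := by simpa [GBShape.lowIdx] using hi
    rcases eq_zero_or_single_of_degree_le_one hi' with h0 | ⟨v, hv⟩
    · exact Or.inr (Or.inl h0)
    · rcases eq_or_ne v (Fin.last m) with rfl | hne
      · exact Or.inr (Or.inr hv)
      · exact Or.inl ⟨v, ⟨hne, fun j => hv ▸ H.not_lead_le i j⟩, hv.symm⟩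
  have h2 := Set.ncard_le_ncard h1 (Set.toFinite _)
  rw [Set.ncard_image_of_injective _ H.basis_injective, Set.ncard_coe_finset] at h2
  refine h2.trans ((Set.ncard_union_le _ _).trans ?_)
  rw [Set.ncard_image_of_injective _ (Finsupp.single_left_injective (one_ne_zero (α := ℕ)))]
  refine Nat.add_le_add_left ((Set.ncard_insert_le _ _).trans ?_) _
  simp

theorem clog_two_mul_le (D : ℕ) :
    (Nat.clog 2 (2 * D) : ℝ) ≤ Real.logb 2 D + 2 := by
  have h1 : Nat.clog 2 (2 * D) ≤ Nat.log 2 D + 2 := by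
    refine Nat.clog_le_of_le_pow ?_
    have := Nat.lt_pow_succ_log_self one_lt_two D
    rw [pow_succ]
    omega
  have h2 := Real.natLog_le_logb D 2
  have h3 : (Nat.clog 2 (2 * D) : ℝ) ≤ Nat.log 2 D + 2 := by exact_mod_cast h1
  push_cast at h2
  linarith

theorem IsDRLBasis.reduceCost_le (H : IsDRLBasis I sh g) (μ : ℕ) :
    (reduceCost sh μ : ℝ) ≤ μ + (5 * ((m + 1 : ℝ) * sh.D) +
      2 * (((reducibleVars sh).ncard : ℝ) * (irreducibleVars sh).ncard * sh.D)) := by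
  have h1 : reduceCost sh μ ≤ μ + (5 * ((m + 1) * sh.D) +
      2 * ((reducibleVars sh).ncard * (irreducibleVars sh).ncard * sh.D)) := by
    unfold reduceCost
    split_ifs
    · generalize (m + 1) * sh.D = a
      omega
    · calc (reducibleVars sh).ncard * (sh.D * (2 * sh.lowIdx.card + 1))
          ≤ (reducibleVars sh).ncard * (sh.D * (2 * ((irreducibleVars sh).ncard + 2) + 1)) := by
            gcongr
            exact H.card_lowIdx_le
        _ = 5 * ((reducibleVars sh).ncard * sh.D) +
            2 * ((reducibleVars sh).ncard * (irreducibleVars sh).ncard * sh.D) := by ring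
        _ ≤ 5 * ((m + 1) * sh.D) +
            2 * ((reducibleVars sh).ncard * (irreducibleVars sh).ncard * sh.D) := by
            gcongr
            exact ncard_reducibleVars_le sh
        _ ≤ _ := Nat.le_add_left _ _
  exact_mod_cast h1

theorem changeCost_eq (sh : GBShape (m + 1)) (μ : ℕ) : (changeCost sh μ : ℝ) =
    (2 * (Nat.clog 2 (2 * sh.D) : ℝ) + 1) * μ + 34 * (sh.D : ℝ) ^ 2 + reduceCost sh μ := by
  simp [changeCost]

variable {ω c : ℝ} {μ : ℕ}

theorem sq_le_rpow (hω : 2 ≤ ω) {D : ℕ} (hD : 0 < D) : (D : ℝ) ^ 2 ≤ (D : ℝ) ^ ω := by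
  rw [← Real.rpow_natCast]
  exact Real.rpow_le_rpow_of_exponent_le (by exact_mod_cast hD) (by simpa using hω)

/-- Cost of the part of the computation that does not depend on the number of variables. -/
theorem cost_main_le (hω : 2 ≤ ω) {D : ℕ} (hD : 0 < D)
    (hμ : (μ : ℝ) ≤ |c| * (2 * D : ℝ) ^ ω) :
    (2 * (Nat.clog 2 (2 * D) : ℝ) + 1) * μ + 34 * (D : ℝ) ^ 2 + μ ≤
      ((2 * Real.logb 2 D + 6) * (|c| * 2 ^ ω) + 34) * (D : ℝ) ^ ω := by
  have h1 := clog_two_mul_le D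
  have h2 := sq_le_rpow hω hD
  rw [Real.mul_rpow (by norm_num) (Nat.cast_nonneg _), ← mul_assoc] at hμ
  have hlog : 0 ≤ Real.logb 2 D := Real.logb_nonneg one_lt_two (by exact_mod_cast hD)
  calc (2 * (Nat.clog 2 (2 * D) : ℝ) + 1) * μ + 34 * (D : ℝ) ^ 2 + μ
      = (2 * (Nat.clog 2 (2 * D) : ℝ) + 2) * μ + 34 * (D : ℝ) ^ 2 := by ring
    _ ≤ (2 * Real.logb 2 D + 6) * (|c| * 2 ^ ω * (D : ℝ) ^ ω) + 34 * (D : ℝ) ^ ω := by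
        exact add_le_add (mul_le_mul (by linarith) hμ (by positivity) (by linarith)) (by linarith)
    _ = _ := by ring

theorem changeCost_le (H : IsDRLBasis I sh g) (hω : 2 ≤ ω) (hD : 0 < sh.D)
    (hμ : (μ : ℝ) ≤ |c| * (2 * sh.D : ℝ) ^ ω) : (changeCost sh μ : ℝ) ≤
      ((2 * Real.logb 2 sh.D + 6) * (|c| * 2 ^ ω) + 34) * (sh.D : ℝ) ^ ω +
      (5 * ((m + 1 : ℝ) * sh.D) +
      2 * (((reducibleVars sh).ncard : ℝ) * (irreducibleVars sh).ncard * sh.D)) := by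
  rw [changeCost_eq]
  linarith [cost_main_le hω hD hμ, H.reduceCost_le μ]

theorem changeCost_le_of_le (hω : 2 ≤ ω) (hD : 0 < sh.D) (hm : m + 1 ≤ sh.D)
    (hμ : (μ : ℝ) ≤ |c| * (2 * sh.D : ℝ) ^ ω) : (changeCost sh μ : ℝ) ≤
      ((2 * Real.logb 2 sh.D + 6) * (|c| * 2 ^ ω) + 34) * (sh.D : ℝ) ^ ω +
      (m + 1 : ℝ) * sh.D := by
  have h1 : (reduceCost sh μ : ℝ) = μ + (m + 1 : ℝ) * sh.D := by
    rw [reduceCost, if_pos hm]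
    push_cast
    ring
  rw [changeCost_eq, h1]
  linarith [cost_main_le hω hD hμ]

/-- Since 1 ≤ L, the factor 2L + 6 is at most 8L, and the constants 34 and 5 together give 39. -/
theorem main_term_le {a L W P : ℝ} (ha : 0 ≤ a) (hL : 1 ≤ L) (hW : 0 ≤ W) (hP : 0 ≤ P) :
    ((2 * L + 6) * a + 34) * W + 5 * P ≤ (8 * a + 39) * (L * (W + L * P)) := by
  have hLP : P ≤ L * (L * P) :=
    (le_mul_of_one_le_left hP hL).trans (le_mul_of_one_le_left (by positivity) hL)
  have hW' : W ≤ L * W := le_mul_of_one_le_left hW hL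
  have h3 : 0 ≤ L * (L * P) := by positivity
  have h4 : a * W ≤ a * (L * W) := by gcongr
  have h5 : 0 ≤ a * (L * (L * P)) := by positivity
  nlinarith

theorem changeCost_le_of_le' (hω : 2 ≤ ω) (hD : 2 ≤ sh.D) (hm : m + 1 ≤ sh.D)
    (hμ : (μ : ℝ) ≤ |c| * (2 * sh.D : ℝ) ^ ω) : (changeCost sh μ : ℝ) ≤
      (8 * (|c| * 2 ^ ω) + 39) * (Real.logb 2 sh.D * ((sh.D : ℝ) ^ ω
        + (m + 1 : ℝ) * Real.logb 2 sh.D * sh.D)) := by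
  have hL : 1 ≤ Real.logb 2 sh.D := by
    rw [Real.le_logb_iff_rpow_le one_lt_two (by positivity), Real.rpow_one]
    exact_mod_cast hD
  have h1 := changeCost_le_of_le hω (by omega) hm hμ
  have hP : 0 ≤ (m + 1 : ℝ) * sh.D := by positivity
  have h2 := main_term_le (a := |c| * 2 ^ ω) (W := (sh.D : ℝ) ^ ω) (by positivity) hL
    (by positivity) hP
  rw [show (m + 1 : ℝ) * Real.logb 2 sh.D * sh.D = Real.logb 2 sh.D * ((m + 1 : ℝ) * sh.D) by ring]
  linarith

theorem changeCost_le' (H : IsDRLBasis I sh g) (hω : 2 ≤ ω) (hD : 2 ≤ sh.D)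
    (hμ : (μ : ℝ) ≤ |c| * (2 * sh.D : ℝ) ^ ω) : (changeCost sh μ : ℝ) ≤
      (8 * (|c| * 2 ^ ω) + 39) * (Real.logb 2 sh.D * ((sh.D : ℝ) ^ ω
        + (m + 1 : ℝ) * Real.logb 2 sh.D * sh.D)
        + ((reducibleVars sh).ncard : ℝ) * (irreducibleVars sh).ncard * sh.D) := by
  have hL : 1 ≤ Real.logb 2 sh.D := by
    rw [Real.le_logb_iff_rpow_le one_lt_two (by positivity), Real.rpow_one]
    exact_mod_cast hD
  have h1 := changeCost_le H hω (by omega) hμ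
  have h2 := main_term_le (a := |c| * 2 ^ ω) (W := (sh.D : ℝ) ^ ω) (P := (m + 1 : ℝ) * sh.D)
    (by positivity) hL (by positivity) (by positivity)
  rw [show (m + 1 : ℝ) * Real.logb 2 sh.D * sh.D = Real.logb 2 sh.D * ((m + 1 : ℝ) * sh.D) by ring]
  set Q : ℝ := ((reducibleVars sh).ncard : ℝ) * (irreducibleVars sh).ncard * sh.D with hQ
  have hQ0 : 0 ≤ Q := by positivity
  have h3 : 2 * Q ≤ (8 * (|c| * 2 ^ ω) + 39) * Q := by
    gcongr
    have : 0 ≤ |c| * 2 ^ ω := by positivity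
    linarith
  rw [mul_add (8 * (|c| * 2 ^ ω) + 39)]
  linarith

/-- Bézout gives log D ≤ n log d, so the logarithm costs only a factor n times a constant depending
on d. The reducible variables number at most n and the irreducible ones at most D, so the
elimination term is at most n D² ≤ n D^ω. -/
theorem changeCost_le_degree (H : IsDRLBasis I sh g) (hω : 2 ≤ ω) (hD : 0 < sh.D)
    (hμ : (μ : ℝ) ≤ |c| * (2 * sh.D : ℝ) ^ ω) {d : ℕ} (hd : 1 < d)
    (hDd : sh.D ≤ d ^ (m + 1)) : (changeCost sh μ : ℝ) ≤
      ((2 * Real.logb 2 d + 6) * (|c| * 2 ^ ω) + 41) *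
        ((m + 1 : ℝ) * (d : ℝ) ^ (ω * (m + 1 : ℝ))) := by
  have h1 := changeCost_le H hω hD hμ
  have hn : (1 : ℝ) ≤ (m + 1 : ℝ) := by
    have : (0 : ℝ) ≤ m := Nat.cast_nonneg m
    linarith
  have hDpos : (0 : ℝ) < sh.D := by exact_mod_cast hD
  have hd0 : (0 : ℝ) < d := by exact_mod_cast (by omega : 0 < d)
  have hDd' : (sh.D : ℝ) ≤ (d : ℝ) ^ (m + 1) := by exact_mod_cast hDd
  have hlogd : 0 ≤ Real.logb 2 d := Real.logb_nonneg one_lt_two (by exact_mod_cast hd.le)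
  have hlog : Real.logb 2 sh.D ≤ (m + 1 : ℝ) * Real.logb 2 d := by
    refine (Real.logb_le_logb_of_le one_lt_two hDpos hDd').trans (le_of_eq ?_)
    rw [Real.logb_pow]
    push_cast
    ring
  have hW : (sh.D : ℝ) ^ ω ≤ (d : ℝ) ^ (ω * (m + 1 : ℝ)) := by
    refine (Real.rpow_le_rpow hDpos.le hDd' (by linarith)).trans (le_of_eq ?_)
    rw [← Real.rpow_natCast, ← Real.rpow_mul hd0.le]
    push_cast
    ring_nf
  set W : ℝ := (sh.D : ℝ) ^ ω with hWdef
  set W' : ℝ := (d : ℝ) ^ (ω * (m + 1 : ℝ)) with hW'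
  have hW0 : 0 ≤ W := by positivity
  have hsq : (sh.D : ℝ) ^ 2 ≤ W := sq_le_rpow hω hD
  have hlin : (sh.D : ℝ) ≤ W := by
    refine le_trans ?_ hsq
    have : (1 : ℝ) ≤ sh.D := by exact_mod_cast hD
    nlinarith
  have hred : ((reducibleVars sh).ncard : ℝ) ≤ m + 1 := by
    exact_mod_cast ncard_reducibleVars_le sh
  have hirr : ((irreducibleVars sh).ncard : ℝ) ≤ sh.D := by
    exact_mod_cast H.ncard_irreducibleVars_le
  have hQ : ((reducibleVars sh).ncard : ℝ) * (irreducibleVars sh).ncard * sh.D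
      ≤ (m + 1 : ℝ) * W := by
    calc _ ≤ (m + 1 : ℝ) * sh.D * sh.D := by gcongr
      _ = (m + 1 : ℝ) * (sh.D : ℝ) ^ 2 := by ring
      _ ≤ _ := by gcongr
  have hP : (m + 1 : ℝ) * sh.D ≤ (m + 1 : ℝ) * W := by gcongr
  have ha : 0 ≤ |c| * 2 ^ ω := by positivity
  have hmain : ((2 * Real.logb 2 sh.D + 6) * (|c| * 2 ^ ω) + 34) * W ≤
      (m + 1 : ℝ) * (((2 * Real.logb 2 d + 6) * (|c| * 2 ^ ω) + 34) * W) := by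
    rw [← mul_assoc (m + 1 : ℝ)]
    refine mul_le_mul_of_nonneg_right ?_ hW0
    have h5 : 2 * Real.logb 2 sh.D + 6 ≤ (m + 1 : ℝ) * (2 * Real.logb 2 d + 6) := by
      nlinarith
    calc (2 * Real.logb 2 sh.D + 6) * (|c| * 2 ^ ω) + 34
        ≤ (m + 1 : ℝ) * (2 * Real.logb 2 d + 6) * (|c| * 2 ^ ω) + (m + 1 : ℝ) * 34 := by
          gcongr
          linarith
      _ = _ := by ring
  calc (changeCost sh μ : ℝ) ≤ (m + 1 : ℝ) * (((2 * Real.logb 2 d + 6) * (|c| * 2 ^ ω) + 34) * W)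
        + (5 * ((m + 1 : ℝ) * W) + 2 * ((m + 1 : ℝ) * W)) := by linarith
    _ = ((2 * Real.logb 2 d + 6) * (|c| * 2 ^ ω) + 41) * ((m + 1 : ℝ) * W) := by ring
    _ ≤ _ := by gcongr

end Cost

/-! ## The main theorem -/

theorem uniformProb_eq_zero {K : Type u} {D : ℕ} {S : Finset K} {E : (Fin D → K) → Prop} (hE : ∀ r, ¬ E r) :
    uniformProb S E = 0 := by
  simp [uniformProb, hE]

section Main

variable {K : Type u} [Field K] {m : ℕ} {I : Ideal (MvPolynomial (Fin (m + 1)) K)}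
  {sh : GBShape (m + 1)} {g : Fin sh.s → MvPolynomial (Fin (m + 1)) K}
  {T : Matrix (Fin sh.D) (Fin sh.D) K} {h : Fin (m + 1) → Polynomial K}

/-- Output, failure and cost of `changeTree`, whatever the number of solutions. -/
theorem changeTree_result_cost {k : Type u} [Field k] [Algebra k K]
    {N : ℕ} {t : CompTree k ((Fin N × Fin N) ⊕ (Fin N × Fin N)) (Fin N × Fin N)} {μ : ℕ}
    (S : IsShape I sh.D h) (H : IsDRLBasis I sh g)
    (hT : IsMultMatrix I sh (Fin.last m) T) (ht : IsMulTree t K μ) (hN : 2 * sh.D ≤ N) :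
    (∀ r y, (changeTree t sh).result (chgInput sh T g r) = some y →
      ∀ v i, y (v, i) = (h v).coeff i) ∧
    (∀ r, (changeTree t sh).result (chgInput sh T g r) = none ↔
      minPolyDegree (wiedemannSeq sh T r) (2 * sh.D) < sh.D) ∧
    (∀ A : Finset K, uniformProb A
        (fun r => (changeTree t sh).result (chgInput sh T g r) = none) ≤ (sh.D : ℝ) / A.card) ∧
    (∀ r, (changeTree t sh).cost (chgInput sh T g r) ≤ if sh.D = 0 then 0 else changeCost sh μ) := by
  rcases Nat.eq_zero_or_pos sh.D with hD | hD
  · have h1 : ∀ r, ((changeTree t sh).runFrom (chgInput sh T g r) []) =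
        (some fun _ => algebraMap k K 0, 0) := fun r => by
      simp only [changeTree, if_pos hD, CompTree.runFrom, Operand.val]
    have hres : ∀ r, (changeTree t sh).result (chgInput sh T g r) ≠ none := fun r => by
      simp [CompTree.result, h1]
    refine ⟨fun r y _ v i => absurd i.2 (by omega), fun r => ⟨fun hr => absurd hr (hres r),
      fun hr => absurd hr (by omega)⟩, fun A => ?_, fun r => by simp [CompTree.cost, h1]⟩
    rw [uniformProb_eq_zero hres]
    positivity
  · have hspec := changeTree_spec S H hD hT ht hN
    have hnone : ∀ r, (changeTree t sh).result (chgInput sh T g r) = none ↔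
        HankelSingular (wiedemannSeq sh T r) sh.D := fun r => by
      rcases (hspec r).1 with ⟨h1, h2⟩ | ⟨h1, h2⟩ <;> simp [h1, h2]
    refine ⟨fun r y hy v i => ?_, fun r => (hnone r).trans
      (minPolyDegree_lt_iff (S.wiedemannSeq_recurrence H hD hT r)).symm, fun A => ?_, fun r => ?_⟩
    · rcases (hspec r).1 with ⟨-, h2⟩ | ⟨-, h2⟩
      · rw [h2] at hy
        cases hy
      · rw [h2, Option.some.injEq] at hy
        rw [← hy]
    · simp only [hnone]
      exact uniformProb_hankelSingular_le (S.exists_not_hankelSingular H hD hT) A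
    · rw [if_neg hD.ne']
      exact (hspec r).2

end Main

theorem mainTheorem7 (ω : ℝ) (hω : 2 ≤ ω) (c : ℝ) :
    ∃ (C : ℝ) (C' : ℕ → ℝ), ∀ (k : Type u) [Field k], MatMulIn k ω c →
      ∃ alg : ∀ (m : ℕ) (sh : GBShape (m + 1)),
          CompTree k (ChgInput sh) (Fin (m + 1) × Fin sh.D),
        ∀ (K : Type u) [Field K] [Algebra k K] (m : ℕ) (sh : GBShape (m + 1))
          (I : Ideal (MvPolynomial (Fin (m + 1)) K))
          (g : Fin sh.s → MvPolynomial (Fin (m + 1)) K)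
          (T : Matrix (Fin sh.D) (Fin sh.D) K),
          IsDRLBasis I sh g → IsMultMatrix I sh (Fin.last m) T → IsShapePosition I sh.D →
          -- an output that is not `fail` is the LEX Gröbner basis
          (∀ r y, (alg m sh).result (chgInput sh T g r) = some y →
            IsReducedGB MonomialOrder.lex I (shapeBasis (outPoly y))) ∧
          -- the algorithm fails exactly when the minimal polynomial has degree less than `D`
          (∀ r, (alg m sh).result (chgInput sh T g r) = none ↔
            minPolyDegree (wiedemannSeq sh T r) (2 * sh.D) < sh.D) ∧
          -- probability of failure
          (∀ S : Finset K, S.Nonempty →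
            uniformProb S (fun r => (alg m sh).result (chgInput sh T g r) = none)
              ≤ (sh.D : ℝ) / S.card) ∧
          -- number of operations, in terms of the number of solutions; the second bound is for any
          -- number of variables, with the cost of eliminating the linear polynomials
          (2 ≤ sh.D → m + 1 ≤ sh.D → ∀ r,
            ((alg m sh).cost (chgInput sh T g r) : ℝ) ≤
              C * (Real.logb 2 sh.D * ((sh.D : ℝ) ^ ω
                + (m + 1 : ℝ) * Real.logb 2 sh.D * sh.D))) ∧
          (2 ≤ sh.D → ∀ r,
            ((alg m sh).cost (chgInput sh T g r) : ℝ) ≤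
              C * (Real.logb 2 sh.D * ((sh.D : ℝ) ^ ω
                + (m + 1 : ℝ) * Real.logb 2 sh.D * sh.D)
                + ((reducibleVars sh).ncard : ℝ) * (irreducibleVars sh).ncard * sh.D)) ∧
          -- number of operations, in terms of the degree of the input system
          (∀ (d : ℕ) (F : Set (MvPolynomial (Fin (m + 1)) K)), 1 < d → Ideal.span F = I →
            (∀ f ∈ F, f.totalDegree ≤ d) → ∀ r,
            ((alg m sh).cost (chgInput sh T g r) : ℝ) ≤
              C' d * ((m + 1 : ℝ) * (d : ℝ) ^ (ω * (m + 1 : ℝ)))) := by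
  refine ⟨8 * (|c| * 2 ^ ω) + 39, fun d => (2 * Real.logb 2 d + 6) * (|c| * 2 ^ ω) + 41,
    fun k _ hmul => ?_⟩
  choose t ht using hmul
  -- Size 2D accommodates the D × 2D arrays of Krylov vectors.
  refine ⟨fun m sh => changeTree (t (2 * sh.D)) sh, fun K _ _ m sh I g T H hT hS => ?_⟩
  obtain ⟨h, hlt, hlast, hgb⟩ := hS
  have S : IsShape I sh.D h := ⟨hlt, hlast, hgb⟩
  have hpos : 0 ≤ |c| * (2 * sh.D : ℝ) ^ ω := by positivity
  have hμ := Nat.floor_le hpos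
  -- Costs are integers, so the real bound may be rounded down; |c| makes it nonnegative without a
  -- discussion of the sign of c.
  have htree : IsMulTree (t (2 * sh.D)) K ⌊|c| * (2 * sh.D : ℝ) ^ ω⌋₊ := fun A B =>
    ⟨(ht _ K A B).1, Nat.le_floor (((ht _ K A B).2).trans (by
      push_cast
      gcongr
      exact le_abs_self c))⟩
  obtain ⟨hsome, hnone, hprob, hcost⟩ := changeTree_result_cost S H hT htree le_rfl
  have hcost' : 0 < sh.D → ∀ r, (((changeTree (t (2 * sh.D)) sh).cost (chgInput sh T g r) : ℕ) : ℝ)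
      ≤ changeCost sh ⌊|c| * (2 * sh.D : ℝ) ^ ω⌋₊ := fun hD r => by
    have h1 := hcost r
    rw [if_neg hD.ne'] at h1
    exact_mod_cast h1
  refine ⟨fun r y hy => by rw [S.outPoly_eq (hsome r y hy)]; exact hgb, hnone,
    fun A _ => hprob A,
    fun hD hm r => (hcost' (by omega) r).trans (changeCost_le_of_le' hω hD hm hμ),
    fun hD r => (hcost' (by omega) r).trans (changeCost_le' H hω hD hμ),
    fun d F hd hF hdeg r => ?_⟩
  rcases Nat.eq_zero_or_pos sh.D with hD | hD
  · have h1 := hcost r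
    rw [if_pos hD, Nat.le_zero] at h1
    rw [h1, Nat.cast_zero]
    have : 0 ≤ Real.logb 2 d := Real.logb_nonneg one_lt_two (by exact_mod_cast hd.le)
    positivity
  · exact (hcost' hD r).trans (changeCost_le_degree H hω hD hμ hd (S.le_pow hF hdeg))
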